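/- All manifolds and maps are smooth, and manifolds have no boundary. Let $\pi\colon M\to S^2$ be a smooth fiber bundle with fiber $S^2$ over $S^2$ that is not trivial (i.e. there is no diffeomorphism $M\cong S^2\times S^2$ over the base), so $M$ is a closed $4$-manifold. Let $dvol$ be any volume form (nowhere vanishing $2$-form) on the base $S^2$, and put $\alpha:=\pi^*dvol$. A $k$-form on an $n$-manifold is called intrinsically harmonic if it is closed and its Hodge dual with respect to some Riemannian metric is also closed. (The Hodge dual is formed with respect to local orientations; a change of orientation only changes its sign, so whether it is closed does not depend on them.) A $k$-form is called transitive if through every point outside its zero set there is a closed connected embedded $k$-dimensional submanifold to which the form restricts as a volume form. It has constant rank $r$ if at every point its kernel $\{v : \iota_v\alpha=0\}$ has codimension $r$. Then $\alpha$ is a closed, transitive $2$-form of constant rank $2$ on $M$, and $\alpha$ is not intrinsically harmonic. Moreover such a nontrivial bundle exists. Hence there is a closed $4$-manifold with a closed, transitive $2$-form of constant rank $2$ that is not intrinsically harmonic: transitivity does not suffice for intrinsic harmonicity in intermediate degrees. -/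

import Mathlib

open Set Filter Topology Manifold
open scoped ContDiff

noncomputable section

namespace HarmonicForms

/-- A (not necessarily continuous) differential `k`-form on an `n`-manifold `M` without boundary. -/
abbrev DForm (n k : ℕ) (M : Type*) [TopologicalSpace M]
    [ChartedSpace (EuclideanSpace ℝ (Fin n)) M] : Type _ :=
  ∀ x : M, (TangentSpace (𝓡 n) x) [⋀^Fin k]→L[ℝ] ℝ

/-- Pullback of a `k`-form along a map, `(f^*α)_x = α_{f x}(df_x ·, …, df_x ·)`. -/
def DForm.pullback {m n k : ℕ}
    {N : Type*} [TopologicalSpace N] [ChartedSpace (EuclideanSpace ℝ (Fin m)) N]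
    {M : Type*} [TopologicalSpace M] [ChartedSpace (EuclideanSpace ℝ (Fin n)) M]
    (f : N → M) (α : DForm n k M) : DForm m k N :=
  fun x => (α (f x)).compContinuousLinearMap (mfderiv (𝓡 m) (𝓡 n) f x)

/-- Derivative at `y` of the inverse of the preferred chart around `x₀`. -/
def chartSymmDeriv {E : Type*} [NormedAddCommGroup E] [NormedSpace ℝ E]
    {M : Type*} [TopologicalSpace M] [ChartedSpace E M] (x₀ : M) (y : E) :
    E →L[ℝ] TangentSpace 𝓘(ℝ, E) ((extChartAt 𝓘(ℝ, E) x₀).symm y) :=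
  mfderiv 𝓘(ℝ, E) 𝓘(ℝ, E) (extChartAt 𝓘(ℝ, E) x₀).symm y

section Forms

variable {n k : ℕ} {M : Type*} [TopologicalSpace M] [ChartedSpace (EuclideanSpace ℝ (Fin n)) M]

/-- The form `α` written in the preferred chart around `x₀`, i.e. its pullback along the inverse of
that chart. It is meaningful on the target of the chart. -/
def DForm.inChart (α : DForm n k M) (x₀ : M) :
    EuclideanSpace ℝ (Fin n) → (EuclideanSpace ℝ (Fin n)) [⋀^Fin k]→L[ℝ] ℝ :=
  fun y => (α ((extChartAt (𝓡 n) x₀).symm y)).compContinuousLinearMap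
    (chartSymmDeriv x₀ y)

/-- `α` is smooth on the open set `U`: its coefficients in all charts are smooth there. -/
def DForm.IsSmoothOn (α : DForm n k M) (U : Set M) : Prop :=
  ∀ x₀ : M, ∀ y ∈ (extChartAt (𝓡 n) x₀).target, (extChartAt (𝓡 n) x₀).symm y ∈ U →
    ContDiffAt ℝ ∞ (α.inChart x₀) y

/-- `α` is smooth on the open set `U` and `dα = 0` there, `d` being computed in charts. -/
def DForm.IsClosedOn (α : DForm n k M) (U : Set M) : Prop :=
  α.IsSmoothOn U ∧
    ∀ x₀ : M, ∀ y ∈ (extChartAt (𝓡 n) x₀).target, (extChartAt (𝓡 n) x₀).symm y ∈ U →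
      extDeriv (α.inChart x₀) y = 0

/-- Closed (smooth) differential form. -/
def DForm.IsClosed (α : DForm n k M) : Prop := α.IsClosedOn univ

/-- A volume form on an `n`-manifold: a smooth nowhere vanishing `n`-form. -/
def DForm.IsVolumeForm (η : DForm n n M) : Prop := η.IsSmoothOn univ ∧ ∀ x, η x ≠ 0

/-- `α` has constant rank `r`: at every point the linear map `v ↦ ι_v α` has rank `r`, i.e. the
kernel `{v | ι_v α = 0}` has codimension `r`. -/
def DForm.HasConstantRank (α : DForm n (k + 1) M) (r : ℕ) : Prop :=
  ∀ x : M, Module.finrank ℝ (LinearMap.range (α x).toAlternatingMap.curryLeft) = r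

/-- A `k`-form is transitive if through every point outside its zero set there is a closed
transversal to its kernel: a closed connected embedded `k`-dimensional submanifold to which `α`
restricts as a volume form. (Embedded submanifolds are given by smooth embeddings.) -/
def DForm.IsTransitive (α : DForm n k M) : Prop :=
  ∀ p : M, α p ≠ 0 →
    ∃ (N : Type) (_ : TopologicalSpace N) (_ : ChartedSpace (EuclideanSpace ℝ (Fin k)) N)
      (_ : IsManifold (𝓡 k) ∞ N) (_ : T2Space N) (_ : CompactSpace N) (_ : ConnectedSpace N)
      (f : N → M), IsSmoothEmbedding (𝓡 k) (𝓡 n) ∞ f ∧ p ∈ range f ∧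
        (DForm.pullback f α).IsVolumeForm

variable (n M) in
/-- Smooth Riemannian metrics on `M`. -/
abbrev SmoothMetric [IsManifold (𝓡 n) ∞ M] : Type _ :=
  Bundle.ContMDiffRiemannianMetric (𝓡 n) ∞ (EuclideanSpace ℝ (Fin n))
    (fun x : M => TangentSpace (𝓡 n) x)

variable (n M) in
/-- A choice of orientation of each tangent space (only its values on a given open set matter). -/
abbrev TangentOrientation : Type _ :=
  ∀ x : M, Orientation ℝ (TangentSpace (𝓡 n) x) (Fin n)

/-- `o` is an orientation of the open submanifold `U`: around each point of `U` it is the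
orientation given by a smooth local frame. -/
def TangentOrientation.IsOrientationOn [IsManifold (𝓡 n) ∞ M] (o : TangentOrientation n M)
    (U : Set M) : Prop :=
  ∀ x ∈ U, ∃ X : Fin n → ∀ y : M, TangentSpace (𝓡 n) y,
    (∀ i, ContMDiffAt (𝓡 n) ((𝓡 n).prod 𝓘(ℝ, EuclideanSpace ℝ (Fin n))) ∞
      (fun y => (⟨y, X i y⟩ : TangentBundle (𝓡 n) M)) x) ∧
    ∀ᶠ y in 𝓝 x, ∃ b : Module.Basis (Fin n) ℝ (TangentSpace (𝓡 n) y),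
      (∀ i, b i = X i y) ∧ b.orientation = o y

end Forms

section Hodge

variable {k l : ℕ} {M : Type*} [TopologicalSpace M]
  [ChartedSpace (EuclideanSpace ℝ (Fin (k + l))) M] [IsManifold (𝓡 (k + l)) ∞ M]

/-- `ψ = ⋆α` at the point `x`, for the metric `g` and the orientation `o`: for every positively
oriented orthonormal basis `e₁, …, e_{k+l}` of the tangent space,
`ψ(e_{k+1}, …, e_{k+l}) = α(e₁, …, e_k)`. -/
def IsHodgeDualAt (g : SmoothMetric (k + l) M) (o : TangentOrientation (k + l) M)
    (α : DForm (k + l) k M) (ψ : DForm (k + l) l M) (x : M) : Prop :=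
  ∀ e : Module.Basis (Fin (k + l)) ℝ (TangentSpace (𝓡 (k + l)) x),
    (∀ i j, g.inner x (e i) (e j) = if i = j then 1 else 0) → e.orientation = o x →
      ψ x (fun j => e (Fin.natAdd k j)) = α x (fun i => e (Fin.castAdd l i))

/-- `⋆α` is closed. The Hodge dual depends on the orientation only up to a locally constant sign
and being closed is a local condition, so the Hodge dual is formed over every open set `U` and for
every orientation of `U`. If `M` is oriented, this says that the globally defined
`⋆α` is closed. -/
def HodgeDualIsClosed (g : SmoothMetric (k + l) M) (α : DForm (k + l) k M) : Prop :=
  ∀ U : Set M, IsOpen U → ∀ o : TangentOrientation (k + l) M, o.IsOrientationOn U →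
    ∃ ψ : DForm (k + l) l M, (∀ x ∈ U, IsHodgeDualAt g o α ψ x) ∧ ψ.IsClosedOn U

/-- A `k`-form on a `(k+l)`-manifold is intrinsically harmonic if it is closed and its Hodge dual
with respect to some Riemannian metric is also closed. -/
def IsIntrinsicallyHarmonic (α : DForm (k + l) k M) : Prop :=
  α.IsClosed ∧ ∃ g : SmoothMetric (k + l) M, HodgeDualIsClosed g α

end Hodge

/-- The unit sphere in `ℝ³`, with its smooth structure from Mathlib. -/
abbrev S2 : Type := Metric.sphere (0 : EuclideanSpace ℝ (Fin 3)) 1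

section Bundles

variable {M : Type*} [TopologicalSpace M] [ChartedSpace (EuclideanSpace ℝ (Fin 4)) M]

/-- `π : M → S²` is a smooth fiber bundle with fiber `S²`: around each point of the base there is a
local trivialization which is a diffeomorphism. -/
def IsSphereBundle (π : M → S2) : Prop :=
  ∀ b : S2, ∃ e : Bundle.Trivialization S2 π, b ∈ e.baseSet ∧
    ContMDiffOn (𝓡 4) ((𝓡 2).prod (𝓡 2)) ∞ e e.source ∧
    ContMDiffOn ((𝓡 2).prod (𝓡 2)) (𝓡 4) ∞ e.toOpenPartialHomeomorph.symm e.target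

/-- The bundle `π : M → S²` is trivial: there is a diffeomorphism `M ≃ S² × S²` over the base. -/
def IsTrivialSphereBundle (π : M → S2) : Prop :=
  ∃ Φ : M ≃ₘ^∞⟮𝓡 4, (𝓡 2).prod (𝓡 2)⟯ (S2 × S2), ∀ x, (Φ x).1 = π x

end Bundles

end HarmonicForms

end

open HarmonicForms

/-! The kernel of `α` is the vertical distribution `ker dπ`. Since `dvol` has top degree, it is
closed and so is its pullback; since `π` is a submersion, the rank is `2`. A section of `π` through
a point is a transversal there, because `α` restricts to `dvol` along it. Such sections exist
(`IsSphereBundle.exists_section`): the bundle is trivial over a large disc, and a constant section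
over this disc, seen on an annulus in a trivialization around the opposite point, moves along a loop
in the fiber. A smooth loop misses a point of `S²`, so it can be contracted within the complement,
and the section is then continued as a constant one.

Suppose that `ψ = ⋆α` is closed for some metric. By linear algebra (`kernel_hodgeDual`) the kernel
of `ψ` is the orthogonal complement `H` of the fibers. The kernel of a closed form of constant rank
is integrable, so `H` is a flat Ehresmann connection. The fibers are compact and the base is simply
connected, so parallel transport trivializes the bundle: a contradiction. Frobenius' theorem is not
invoked. Instead, constant sections are transported along rays from the centre of a small disc. If
`∂ₜ` is the radial direction, then `ι_{∂ₜ} ψ = 0` and `dψ = 0` make `ψ` invariant in `t`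
(`fderiv_apply_eq_zero_of_extDeriv_eq_zero`). At the centre the angular variation of the transported
section vanishes, hence it remains horizontal along the ray (`IsConeParam.isHorizontal_transport`).
This gives flat local trivializations. Their transition maps are locally constant in the base point,
so they glue over sets with connected intersection: first over boxes in the plane, and then over two
pieces of the sphere meeting in an annulus. To solve the transport equation in a vector space, the
fiber `S²` is thickened to `ℝ³ ∖ {0}` (`IsConeParam`), the connection being tangent to the spheres.
Smooth dependence on parameters follows from the contraction principle and the implicit function
theorem in `C([0,1], E)`.

The nontrivial bundle is glued from two copies of disc `× S²` by one full rotation along the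
equator. A trivialization would produce two families of independent pairs of vectors in `ℝ³`, each
over a disc, which differ by a full turn on the boundary. This contradicts the nontriviality of the
full turn in `π₁(SO(3))`, which is detected by lifting isotropic vectors in `ℂ³` to spinors
(`frames_not_full_turn`). -/

open Set Filter Topology Manifold
open scoped ContDiff

namespace HarmonicForms

noncomputable section

/-! ### Local trivializations and their gluing -/

section Trivializations

variable {M : Type*} [TopologicalSpace M] [ChartedSpace (EuclideanSpace ℝ (Fin 4)) M]

/-- `T` is a smooth trivialization of `π` over `U`, and `S` is the fiber coordinate of its
inverse. -/
structure IsTrivOn (π : M → S2) (U : Set S2) (T : S2 × S2 → M) (S : M → S2) : Prop where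
  contMDiffOn : ContMDiffOn ((𝓡 2).prod (𝓡 2)) (𝓡 4) ∞ T (U ×ˢ univ)
  smooth_snd : ContMDiffOn (𝓡 4) (𝓡 2) ∞ S (π ⁻¹' U)
  proj : ∀ b ∈ U, ∀ x, π (T (b, x)) = b
  snd : ∀ b ∈ U, ∀ x, S (T (b, x)) = x
  total : ∀ m, π m ∈ U → T (π m, S m) = m

variable {π : M → S2}

lemma IsTrivOn.mono {U V : Set S2} {T : S2 × S2 → M} {S : M → S2} (h : IsTrivOn π U T S)
    (hVU : V ⊆ U) : IsTrivOn π V T S where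
  contMDiffOn := h.contMDiffOn.mono (prod_mono hVU subset_rfl)
  smooth_snd := h.smooth_snd.mono (preimage_mono hVU)
  proj b hb := h.proj b (hVU hb)
  snd b hb := h.snd b (hVU hb)
  total m hm := h.total m (hVU hm)

lemma IsSphereBundle.exists_isTrivOn (h : IsSphereBundle π) (b : S2) :
    ∃ U, IsOpen U ∧ b ∈ U ∧ ∃ T S, IsTrivOn π U T S := by
  obtain ⟨e, hb, h1, h2⟩ := h b
  refine ⟨e.baseSet, e.open_baseSet, hb, e.toOpenPartialHomeomorph.symm, fun m => (e m).2, ?_⟩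
  refine ⟨?_, ?_, ?_, ?_, ?_⟩
  · rwa [e.target_eq] at h2
  · rw [← e.source_eq]
    exact contMDiff_snd.comp_contMDiffOn h1
  · intro b hb x
    exact e.proj_symm_apply (by simpa [e.target_eq] using hb)
  · intro b hb x
    have := e.apply_symm_apply (x := (b, x)) (by simpa [e.target_eq] using hb)
    simp [this]
  · intro m hm
    have hm' : m ∈ e.source := by simpa [e.source_eq] using hm
    have : (π m, (e m).2) = e m := Prod.ext (e.coe_fst hm').symm rfl
    rw [this]
    exact e.left_inv hm'

lemma IsSphereBundle.contMDiff (h : IsSphereBundle π) : ContMDiff (𝓡 4) (𝓡 2) ∞ π := by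
  intro m
  obtain ⟨e, hb, h1, -⟩ := h (π m)
  have hm : m ∈ e.source := e.mem_source.2 hb
  have h3 : ContMDiffAt (𝓡 4) (𝓡 2) ∞ (fun m => (e m).1) m :=
    contMDiff_fst.contMDiffAt.comp m (h1.contMDiffAt (e.open_source.mem_nhds hm))
  refine h3.congr_of_eventuallyEq ?_
  filter_upwards [e.open_source.mem_nhds hm] with m' hm'
  exact (e.coe_fst hm').symm

/-- The trivialization over `U' ∪ V` glued from one over `U ⊇ U'` and one over `V`, where `ρ` maps
`V` to `U ∩ V` without changing the transition function over `U' ∩ V`. -/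
lemma IsTrivOn.glue {U U' V : Set S2} {T₁ T₂ : S2 × S2 → M} {S₁ S₂ : M → S2}
    (hπ : ContMDiff (𝓡 4) (𝓡 2) ∞ π)
    (h₁ : IsTrivOn π U T₁ S₁) (h₂ : IsTrivOn π V T₂ S₂) (hU' : IsOpen U') (hV : IsOpen V)
    (hU'U : U' ⊆ U) {ρ : S2 → S2} (hρ : ContMDiffOn (𝓡 2) (𝓡 2) ∞ ρ V)
    (hρm : MapsTo ρ V (U ∩ V))
    (hρT : ∀ b ∈ U' ∩ V, ∀ x, S₂ (T₁ (ρ b, x)) = S₂ (T₁ (b, x))) :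
    ∃ T S, IsTrivOn π (U' ∪ V) T S ∧ (∀ b ∈ U', ∀ x, T (b, x) = T₁ (b, x)) ∧
      ∀ b ∈ V, ∀ x, T (b, x) = T₂ (b, S₂ (T₁ (ρ b, x))) := by
  classical
  -- Over `V` the second trivialization is corrected by the transition function, which is extended
  -- from the overlap to all of `V` by precomposing with `ρ`. Over `U' ∩ V` the correction turns it
  -- into `T₁`.
  let T : S2 × S2 → M := fun z => if z.1 ∈ U' then T₁ z else T₂ (z.1, S₂ (T₁ (ρ z.1, z.2)))
  let S : M → S2 := fun m => if π m ∈ U' then S₁ m else S₁ (T₂ (ρ (π m), S₂ m))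
  have hT1 : ∀ b ∈ U', ∀ x, T (b, x) = T₁ (b, x) := fun b hb x => by simp [T, hb]
  have hT2 : ∀ b ∈ V, ∀ x, T (b, x) = T₂ (b, S₂ (T₁ (ρ b, x))) := by
    intro b hb x
    by_cases hb' : b ∈ U'
    · rw [hT1 b hb', hρT b ⟨hb', hb⟩]
      have h := h₂.total (T₁ (b, x)) (by rwa [h₁.proj b (hU'U hb')])
      rw [h₁.proj b (hU'U hb')] at h
      exact h.symm
    · simp [T, hb']
  have hS1 : ∀ m, π m ∈ U' → S m = S₁ m := fun m hm => by simp [S, hm]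
  have hS2 : ∀ m, π m ∈ V → S m = S₁ (T₂ (ρ (π m), S₂ m)) := by
    intro m hm
    by_cases hm' : π m ∈ U'
    · rw [hS1 m hm']
      have e1 := h₁.total m (hU'U hm')
      have e2 := hρT (π m) ⟨hm', hm⟩ (S₁ m)
      rw [e1] at e2
      rw [← e2]
      have hr := hρm hm
      have h := h₂.total (T₁ (ρ (π m), S₁ m)) (by rw [h₁.proj _ hr.1]; exact hr.2)
      rw [h₁.proj _ hr.1] at h
      rw [h, h₁.snd _ hr.1]
    · simp [S, hm']
  have hcU : IsOpen (π ⁻¹' U') := hU'.preimage hπ.continuous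
  have hcV : IsOpen (π ⁻¹' V) := hV.preimage hπ.continuous
  refine ⟨T, S, ⟨?_, ?_, ?_, ?_, ?_⟩, hT1, hT2⟩
  · rw [union_prod]
    refine ContMDiffOn.union_of_isOpen ?_ ?_ (hU'.prod isOpen_univ) (hV.prod isOpen_univ)
    · refine (h₁.contMDiffOn.mono (prod_mono hU'U subset_rfl)).congr ?_
      rintro ⟨b, x⟩ ⟨hb, -⟩
      exact hT1 b hb x
    · have k1 : ContMDiffOn ((𝓡 2).prod (𝓡 2)) ((𝓡 2).prod (𝓡 2)) ∞
          (fun z : S2 × S2 => (ρ z.1, z.2)) (V ×ˢ univ) :=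
        (hρ.comp contMDiffOn_fst (fun z hz => hz.1)).prodMk contMDiffOn_snd
      have k2 : ContMDiffOn ((𝓡 2).prod (𝓡 2)) (𝓡 4) ∞
          (fun z : S2 × S2 => T₁ (ρ z.1, z.2)) (V ×ˢ univ) :=
        h₁.contMDiffOn.comp k1 (fun z hz => ⟨(hρm hz.1).1, mem_univ _⟩)
      have k3 : ContMDiffOn ((𝓡 2).prod (𝓡 2)) (𝓡 2) ∞
          (fun z : S2 × S2 => S₂ (T₁ (ρ z.1, z.2))) (V ×ˢ univ) := by
        refine h₂.smooth_snd.comp k2 (fun z hz => ?_)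
        have := hρm hz.1
        simp only [mem_preimage]
        rw [h₁.proj _ this.1]
        exact this.2
      have k4 : ContMDiffOn ((𝓡 2).prod (𝓡 2)) (𝓡 4) ∞
          (fun z : S2 × S2 => T₂ (z.1, S₂ (T₁ (ρ z.1, z.2)))) (V ×ˢ univ) :=
        h₂.contMDiffOn.comp (contMDiffOn_fst.prodMk k3) (fun z hz => ⟨hz.1, mem_univ _⟩)
      refine k4.congr ?_
      rintro ⟨b, x⟩ ⟨hb, -⟩
      exact hT2 b hb x
  · rw [preimage_union]
    refine ContMDiffOn.union_of_isOpen ?_ ?_ hcU hcV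
    · exact (h₁.smooth_snd.mono (preimage_mono hU'U)).congr hS1
    · have k1 : ContMDiffOn (𝓡 4) ((𝓡 2).prod (𝓡 2)) ∞
          (fun m => (ρ (π m), S₂ m)) (π ⁻¹' V) :=
        (hρ.comp hπ.contMDiffOn (fun m hm => hm)).prodMk h₂.smooth_snd
      have k2 : ContMDiffOn (𝓡 4) (𝓡 4) ∞ (fun m => T₂ (ρ (π m), S₂ m)) (π ⁻¹' V) :=
        h₂.contMDiffOn.comp k1 (fun m hm => ⟨(hρm hm).2, mem_univ _⟩)
      refine (h₁.smooth_snd.comp k2 (fun m hm => ?_)).congr hS2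
      simp only [mem_preimage]
      rw [h₂.proj _ (hρm hm).2]
      exact (hρm hm).1
  · rintro b (hb | hb) x
    · rw [hT1 b hb, h₁.proj b (hU'U hb)]
    · rw [hT2 b hb, h₂.proj b hb]
  · rintro b (hb | hb) x
    · rw [hS1 _ (by rw [hT1 b hb, h₁.proj b (hU'U hb)]; exact hb), hT1 b hb, h₁.snd b (hU'U hb)]
    · have hr := hρm hb
      have e1 : π (T (b, x)) = b := by rw [hT2 b hb, h₂.proj b hb]
      rw [hS2 _ (by rwa [e1]), e1, hT2 b hb, h₂.snd b hb]
      have h := h₂.total (T₁ (ρ b, x)) (by rw [h₁.proj _ hr.1]; exact hr.2)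
      rw [h₁.proj _ hr.1] at h
      rw [h, h₁.snd _ hr.1]
  · rintro m (hm | hm)
    · rw [hT1 _ hm, hS1 _ hm, h₁.total m (hU'U hm)]
    · have hr := hρm hm
      rw [hT2 _ hm, hS2 _ hm]
      have h := h₁.total (T₂ (ρ (π m), S₂ m)) (by rw [h₂.proj _ hr.2]; exact hr.1)
      rw [h₂.proj _ hr.2] at h
      rw [h, h₂.snd _ hr.2, h₂.total m hm]

end Trivializations

/-! ### Induction over intervals and boxes -/

section Boxes

/-- A supremum argument: the right endpoints reachable from `a` are closed downwards, and they can
always be pushed a little beyond their supremum by gluing with a local piece. -/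
lemma interval_induction {Q : ℝ → ℝ → Prop}
    (mono : ∀ a a' b' b, a ≤ a' → b' ≤ b → Q a b → Q a' b')
    (loc : ∀ t, ∃ ε > 0, Q (t - ε) (t + ε))
    (glue : ∀ a a' b b', a < a' → a' < b → b < b' → Q a b → Q a' b' → Q a b') (a b : ℝ) :
    Q a b := by
  wlog hab : a ≤ b generalizing a b
  · exact mono b a b a (by linarith) (by linarith) (this b a (by linarith))
  -- The margin `ε` at both ends provides the strict overlaps that `glue` demands.
  let s : Set ℝ := {t | ∃ ε > 0, Q (a - ε) (t + ε)}
  suffices h : b ∈ s by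
    obtain ⟨ε, hε, h⟩ := h
    exact mono _ _ _ _ (by linarith) (by linarith) h
  have key : ∀ t, a ≤ t → (∀ δ > 0, ∃ u ∈ s, t - δ < u ∧ u ≤ t) → ∃ ε > 0, t + ε ∈ s := by
    intro t hat H
    obtain ⟨ε, hε, hQ⟩ := loc t
    obtain ⟨u, ⟨η, hη, hu⟩, htu, hut⟩ := H (ε / 2) (by linarith)
    have hη2 : 0 < min η (ε / 2) := lt_min hη (by linarith)
    refine ⟨ε / 2, by linarith, min η (ε / 2), hη2, ?_⟩
    have hle := min_le_left η (ε / 2)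
    have hle' := min_le_right η (ε / 2)
    by_cases hc : t + ε / 2 + min η (ε / 2) ≤ u + η
    · exact mono _ _ _ _ (by linarith) hc hu
    · by_cases hca : a - min η (ε / 2) < t - ε / 2
      · refine glue _ (t - ε / 2) (u + min η (ε / 2)) _ hca (by linarith) (by linarith) ?_ ?_
        · exact mono _ _ _ _ (by linarith) (by linarith) hu
        · exact mono _ _ _ _ (by linarith) (by linarith) hQ
      · exact mono _ _ _ _ (by linarith) (by linarith) hQ
  have ha : a ∈ s := by
    obtain ⟨ε, hε, hQ⟩ := loc a
    exact ⟨ε, hε, hQ⟩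
  have hdown : ∀ t u, u ∈ s → t ≤ u → t ∈ s := by
    rintro t u ⟨ε, hε, h⟩ htu
    exact ⟨ε, hε, mono _ _ _ _ le_rfl (by linarith) h⟩
  by_contra hb
  have hbdd : BddAbove s := ⟨b, fun u hu => le_of_not_gt fun h => hb (hdown b u hu h.le)⟩
  have hsup := isLUB_csSup ⟨a, ha⟩ hbdd
  obtain ⟨ε, hε, h⟩ := key (sSup s) (hsup.1 ha) (fun δ hδ => by
    obtain ⟨u, hu, h1, h2⟩ := hsup.exists_between (show sSup s - δ < sSup s by linarith)
    exact ⟨u, hu, h1, h2⟩)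
  exact absurd (hsup.1 h) (by linarith)

/-- An open box in the plane. -/
def box (a b c d : ℝ) : Set (EuclideanSpace ℝ (Fin 2)) :=
  {y | (a < y 0 ∧ y 0 < b) ∧ (c < y 1 ∧ y 1 < d)}

lemma convex_slab (i : Fin 2) (a b : ℝ) :
    Convex ℝ {y : EuclideanSpace ℝ (Fin 2) | a < y i ∧ y i < b} := by
  have h : IsLinearMap ℝ (fun y : EuclideanSpace ℝ (Fin 2) => y i) :=
    ⟨fun _ _ => rfl, fun _ _ => rfl⟩
  exact (convex_halfSpace_gt h a).inter (convex_halfSpace_lt h b)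

lemma isOpen_slab (i : Fin 2) (a b : ℝ) :
    IsOpen {y : EuclideanSpace ℝ (Fin 2) | a < y i ∧ y i < b} :=
  isOpen_Ioo.preimage (f := fun y : EuclideanSpace ℝ (Fin 2) => y i) (by fun_prop)

/-- The common engine for trivializations, flat trivializations and spinor lifts. In the gluing step
`K` is a slab in the other coordinate, so the two pieces overlap in a convex set, and moving the
`i`-th coordinate does not leave `K`. -/
lemma box_induction {P : Set (EuclideanSpace ℝ (Fin 2)) → Prop}
    (mono : ∀ s t, s ⊆ t → P t → P s) (loc : ∀ y, ∃ s ∈ 𝓝 y, P s)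
    (glue : ∀ (i : Fin 2) (K : Set (EuclideanSpace ℝ (Fin 2))) (a a' b b' : ℝ), IsOpen K →
      Convex ℝ K → (∀ y ∈ K, ∀ y', (∀ j ≠ i, y' j = y j) → y' ∈ K) → a < a' → a' < b → b < b' →
      P (K ∩ {y | a < y i ∧ y i < b}) → P (K ∩ {y | a' < y i ∧ y i < b'}) →
      P (K ∩ {y | a < y i ∧ y i < b'})) (a b c d : ℝ) : P (box a b c d) := by
  refine interval_induction (Q := fun c d => P (box a b c d)) ?_ ?_ ?_ c d
  · intro c c' d' d h1 h2
    refine mono _ _ ?_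
    rintro y ⟨h, h3, h4⟩
    exact ⟨h, by linarith, by linarith⟩
  · intro t
    -- At a fixed height `t` the box is first extended horizontally. The thickness of the strip may
    -- shrink at each gluing, which is why it is quantified inside the induction predicate.
    refine interval_induction (Q := fun a b => ∃ ε > 0, P (box a b (t - ε) (t + ε))) ?_ ?_ ?_ a b
    · rintro a a' b' b h1 h2 ⟨ε, hε, h⟩
      refine ⟨ε, hε, mono _ _ ?_ h⟩
      rintro y ⟨⟨h3, h4⟩, h⟩
      exact ⟨⟨by linarith, by linarith⟩, h⟩
    · intro u
      obtain ⟨s, hs, hP⟩ := loc !₂[u, t]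
      have : ∃ ε > 0, box (u - ε) (u + ε) (t - ε) (t + ε) ⊆ s := by
        obtain ⟨ε, hε, h⟩ := Metric.mem_nhds_iff.1 hs
        refine ⟨ε / 2, by linarith, fun y hy => h ?_⟩
        rw [Metric.mem_ball, EuclideanSpace.dist_eq, Fin.sum_univ_two,
          Real.sqrt_lt' hε]
        obtain ⟨⟨h1, h2⟩, h3, h4⟩ := hy
        have e0 : |y 0 - u| < ε / 2 := abs_lt.2 ⟨by linarith, by linarith⟩
        have e1 : |y 1 - t| < ε / 2 := abs_lt.2 ⟨by linarith, by linarith⟩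
        simp only [Real.dist_eq, Matrix.cons_val_zero, Matrix.cons_val_one]
        nlinarith [abs_nonneg (y 0 - u), abs_nonneg (y 1 - t)]
      obtain ⟨ε, hε, h⟩ := this
      exact ⟨ε, hε, ε, hε, mono _ _ h hP⟩
    · rintro a a' b b' h1 h2 h3 ⟨ε, hε, h⟩ ⟨ε', hε', h'⟩
      refine ⟨min ε ε', lt_min hε hε', ?_⟩
      have hl := min_le_left ε ε'
      have hr := min_le_right ε ε'
      have key : ∀ a b, box a b (t - min ε ε') (t + min ε ε') =
          {y | t - min ε ε' < y 1 ∧ y 1 < t + min ε ε'} ∩ {y | a < y 0 ∧ y 0 < b} := by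
        intro a b
        ext y
        simp [box, and_comm]
      rw [key]
      refine glue 0 _ a a' b b' (isOpen_slab _ _ _) (convex_slab _ _ _) ?_ h1 h2 h3 ?_ ?_
      · intro y hy y' h
        simpa [h 1 (by decide)] using hy
      · refine mono _ _ ?_ h
        rintro y ⟨⟨h4, h5⟩, h6⟩
        exact ⟨h6, by linarith, by linarith⟩
      · refine mono _ _ ?_ h'
        rintro y ⟨⟨h4, h5⟩, h6⟩
        exact ⟨h6, by linarith, by linarith⟩
  · rintro c c' d d' h1 h2 h3 h h'
    have key : ∀ c d, box a b c d =
        {y | a < y 0 ∧ y 0 < b} ∩ {y | c < y 1 ∧ y 1 < d} := fun c d => rfl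
    rw [key]
    refine glue 1 _ c c' d d' (isOpen_slab _ _ _) (convex_slab _ _ _) ?_ h1 h2 h3 h h'
    intro y hy y' h
    simpa [h 0 (by decide)] using hy

/-- A smooth retraction of `(a, ∞)` into `(a, b)` which is the identity on an initial part. -/
lemma exists_smooth_retraction {a b : ℝ} (hab : a < b) : ∃ (r : ℝ → ℝ) (m : ℝ), ContDiff ℝ ∞ r ∧
    a < m ∧ m < b ∧ (∀ t < m, r t = t) ∧ ∀ t > a, a < r t ∧ r t < b := by
  -- Interpolate between the identity (before `m₁`) and the constant `m₁` (after `m₂`). As `m₂ < b`,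
  -- both interpolated values lie in `(a, b)` as long as the identity contributes.
  let m₁ := a + (b - a) / 3
  let m₂ := a + 2 * (b - a) / 3
  have h12 : m₁ < m₂ := by simp only [m₁, m₂]; linarith
  let χ : ℝ → ℝ := fun t => Real.smoothTransition ((t - m₁) / (m₂ - m₁))
  have hχ : ContDiff ℝ ∞ χ := Real.smoothTransition.contDiff.comp (by fun_prop)
  refine ⟨fun t => (1 - χ t) * t + χ t * m₁, m₁, by fun_prop, by simp only [m₁]; linarith,
    by simp only [m₁]; linarith, fun t ht => ?_, fun t ht => ?_⟩
  · have : χ t = 0 := Real.smoothTransition.zero_of_nonpos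
      (div_nonpos_of_nonpos_of_nonneg (by linarith) (by linarith))
    simp [this]
  · have h0 : 0 ≤ χ t := Real.smoothTransition.nonneg _
    have h1 : χ t ≤ 1 := Real.smoothTransition.le_one _
    have hm1 : a < m₁ := by simp only [m₁]; linarith
    have hm2 : m₁ < b := by simp only [m₁]; linarith
    have hm3 : m₂ < b := by simp only [m₂]; linarith
    change a < (1 - χ t) * t + χ t * m₁ ∧ (1 - χ t) * t + χ t * m₁ < b
    rcases lt_or_ge t m₂ with h | h
    · constructor
      · rcases eq_or_lt_of_le h0 with h0 | h0
        · rw [← h0]; linarith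
        · nlinarith
      · rcases eq_or_lt_of_le h0 with h0 | h0
        · rw [← h0]; linarith
        · nlinarith
    · have : χ t = 1 := Real.smoothTransition.one_of_one_le
        ((one_le_div (by linarith)).2 (by linarith))
      simp [this, hm1, hm2]

end Boxes

/-! ### Stereographic charts -/

section SphereCharts

/-- The inverse of the stereographic chart of the sphere around `q`. -/
def stereoParam (q : S2) : EuclideanSpace ℝ (Fin 2) → S2 :=
  (chartAt (EuclideanSpace ℝ (Fin 2)) q).symm

lemma finrank_euclideanSpace_three :
    Fact (Module.finrank ℝ (EuclideanSpace ℝ (Fin 3)) = 2 + 1) :=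
  ⟨finrank_euclideanSpace_fin⟩

lemma contMDiff_coe_S2 :
    ContMDiff (𝓡 2) 𝓘(ℝ, EuclideanSpace ℝ (Fin 3)) ∞ ((↑) : S2 → EuclideanSpace ℝ (Fin 3)) :=
  have := finrank_euclideanSpace_three
  contMDiff_coe_sphere

lemma chartAt_S2_source (q : S2) : (chartAt (EuclideanSpace ℝ (Fin 2)) q).source = {-q}ᶜ :=
  have := finrank_euclideanSpace_three
  stereographic'_source (-q)

lemma chartAt_S2_target (q : S2) : (chartAt (EuclideanSpace ℝ (Fin 2)) q).target = univ :=
  have := finrank_euclideanSpace_three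
  stereographic'_target (-q)

lemma contMDiff_stereoParam (q : S2) : ContMDiff (𝓡 2) (𝓡 2) ∞ (stereoParam q) := by
  have h := contMDiffOn_chart_symm (I := 𝓡 2) (n := ∞) (x := q)
  rw [chartAt_S2_target, contMDiffOn_univ] at h
  exact h

lemma contMDiffOn_chartAt_S2 (q : S2) : ContMDiffOn (𝓡 2) (𝓡 2) ∞
    (chartAt (EuclideanSpace ℝ (Fin 2)) q) (chartAt (EuclideanSpace ℝ (Fin 2)) q).source :=
  contMDiffOn_chart

lemma chartAt_stereoParam (q : S2) (y : EuclideanSpace ℝ (Fin 2)) :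
    chartAt (EuclideanSpace ℝ (Fin 2)) q (stereoParam q y) = y :=
  (chartAt _ q).right_inv (by rw [chartAt_S2_target]; trivial)

lemma stereoParam_mem_source (q : S2) (y : EuclideanSpace ℝ (Fin 2)) :
    stereoParam q y ∈ (chartAt (EuclideanSpace ℝ (Fin 2)) q).source :=
  (chartAt _ q).map_target (by rw [chartAt_S2_target]; trivial)

lemma stereoParam_chartAt {q b : S2}
    (hb : b ∈ (chartAt (EuclideanSpace ℝ (Fin 2)) q).source) :
    stereoParam q (chartAt (EuclideanSpace ℝ (Fin 2)) q b) = b :=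
  (chartAt _ q).left_inv hb

/-- The part of the sphere which is mapped to `s` by the stereographic chart around `q`. -/
def stereoSet (q : S2) (s : Set (EuclideanSpace ℝ (Fin 2))) : Set S2 :=
  (chartAt (EuclideanSpace ℝ (Fin 2)) q).source ∩ chartAt (EuclideanSpace ℝ (Fin 2)) q ⁻¹' s

lemma isOpen_stereoSet (q : S2) {s : Set (EuclideanSpace ℝ (Fin 2))} (hs : IsOpen s) :
    IsOpen (stereoSet q s) :=
  (chartAt (EuclideanSpace ℝ (Fin 2)) q).isOpen_inter_preimage hs

lemma stereoSet_eq_image (q : S2) (s : Set (EuclideanSpace ℝ (Fin 2))) :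
    stereoSet q s = stereoParam q '' s := by
  ext b
  constructor
  · rintro ⟨h1, h2⟩
    exact ⟨_, h2, stereoParam_chartAt h1⟩
  · rintro ⟨y, hy, rfl⟩
    exact ⟨stereoParam_mem_source q y, by rwa [mem_preimage, chartAt_stereoParam]⟩

lemma stereoParam_mem_stereoSet (q : S2) {s : Set (EuclideanSpace ℝ (Fin 2))}
    {y : EuclideanSpace ℝ (Fin 2)} : stereoParam q y ∈ stereoSet q s ↔ y ∈ s := by
  constructor
  · rintro ⟨-, h⟩
    rwa [mem_preimage, chartAt_stereoParam] at h
  · intro h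
    rw [stereoSet_eq_image]
    exact mem_image_of_mem _ h

/-- A neighbourhood of the centre of projection contains the outside of a disc. -/
lemma exists_stereoParam_mem_of_norm_ge (q : S2) {V : Set S2} (hV : IsOpen V) (hq : -q ∈ V) :
    ∃ r > 0, ∀ y, r ≤ ‖y‖ → stereoParam q y ∈ V := by
  have hK : IsCompact Vᶜ := hV.isClosed_compl.isCompact
  have hsub : Vᶜ ⊆ (chartAt (EuclideanSpace ℝ (Fin 2)) q).source := by
    rw [chartAt_S2_source]
    intro b hb hbq
    rw [mem_singleton_iff.1 hbq] at hb
    exact hb hq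
  have hc := hK.image_of_continuousOn ((chartAt (EuclideanSpace ℝ (Fin 2)) q).continuousOn.mono hsub)
  obtain ⟨r, hr⟩ := hc.isBounded.exists_norm_le
  refine ⟨max r 0 + 1, by positivity, fun y hy => ?_⟩
  by_contra hn
  have := hr _ ⟨_, hn, chartAt_stereoParam q y⟩
  linarith [le_max_left r 0]

end SphereCharts

/-! ### Sections through every point -/

section Sections

variable {M : Type*} [TopologicalSpace M] [ChartedSpace (EuclideanSpace ℝ (Fin 4)) M] {π : M → S2}

/-- Replacing the `i`-th coordinate `t` by `r t`. -/
def coordMap (i : Fin 2) (r : ℝ → ℝ) (y : EuclideanSpace ℝ (Fin 2)) : EuclideanSpace ℝ (Fin 2) :=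
  y + (r (y i) - y i) • EuclideanSpace.single i (1 : ℝ)

lemma contDiff_coordMap (i : Fin 2) {r : ℝ → ℝ} (hr : ContDiff ℝ ∞ r) :
    ContDiff ℝ ∞ (coordMap i r) := by
  have : ContDiff ℝ ∞ (fun y : EuclideanSpace ℝ (Fin 2) => y i) := by fun_prop
  have h2 := hr.comp this
  unfold coordMap
  exact contDiff_id.add ((h2.sub this).smul contDiff_const)

lemma coordMap_self (i : Fin 2) (r : ℝ → ℝ) (y : EuclideanSpace ℝ (Fin 2)) :
    coordMap i r y i = r (y i) := by simp [coordMap]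

lemma coordMap_ne {i j : Fin 2} (h : j ≠ i) (r : ℝ → ℝ) (y : EuclideanSpace ℝ (Fin 2)) :
    coordMap i r y j = y j := by simp [coordMap, h]

lemma coordMap_eq {i : Fin 2} {r : ℝ → ℝ} {y : EuclideanSpace ℝ (Fin 2)} (h : r (y i) = y i) :
    coordMap i r y = y := by simp [coordMap, h]

/-- A sphere bundle is trivial over every open box in a stereographic chart. -/
lemma IsSphereBundle.exists_isTrivOn_box (h : IsSphereBundle π) (q : S2) (a b c d : ℝ) :
    ∃ T S, IsTrivOn π (stereoSet q (box a b c d)) T S := by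
  refine box_induction (P := fun s => ∃ T S, IsTrivOn π (stereoSet q s) T S) ?_ ?_ ?_ a b c d
  · rintro s t hst ⟨T, S, hT⟩
    exact ⟨T, S, hT.mono (inter_subset_inter_right _ (preimage_mono hst))⟩
  · intro y
    obtain ⟨U, hU, hy, T, S, hT⟩ := h.exists_isTrivOn (stereoParam q y)
    refine ⟨stereoParam q ⁻¹' U,
      (hU.preimage (contMDiff_stereoParam q).continuous).mem_nhds hy, T, S, hT.mono ?_⟩
    rintro b ⟨hb, hb'⟩
    simpa [stereoParam_chartAt hb] using hb'
  · rintro i K a a' b b' hK - hKi h1 h2 h3 ⟨T₁, S₁, hT₁⟩ ⟨T₂, S₂, hT₂⟩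
    -- The retraction acts on the `i`-th coordinate: it pushes the second slab into the overlap and
    -- fixes the points with coordinate below `m`, where the new trivialization must agree with the
    -- first.
    obtain ⟨r, m, hr, hm1, hm2, hr1, hr2⟩ := exists_smooth_retraction h2
    have hT := hT₁.glue h.contMDiff hT₂
      (U' := stereoSet q (K ∩ {y | a < y i ∧ y i < m}))
      (isOpen_stereoSet q (hK.inter (isOpen_slab _ _ _)))
      (isOpen_stereoSet q (hK.inter (isOpen_slab _ _ _)))
      (inter_subset_inter_right _ (preimage_mono
        (inter_subset_inter_right _ (fun y hy => ⟨hy.1, hy.2.trans hm2⟩))))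
      (ρ := fun x => stereoParam q (coordMap i r (chartAt _ q x))) ?_ ?_ ?_
    · obtain ⟨T, S, hTS, -⟩ := hT
      refine ⟨T, S, hTS.mono ?_⟩
      rintro x ⟨hx, hxK, hx1, hx2⟩
      by_cases hxm : (chartAt (EuclideanSpace ℝ (Fin 2)) q x) i < m
      · exact Or.inl ⟨hx, hxK, hx1, hxm⟩
      · exact Or.inr ⟨hx, hxK, by linarith, hx2⟩
    · refine (contMDiff_stereoParam q).comp_contMDiffOn
        ((contDiff_coordMap i hr).contMDiff.comp_contMDiffOn ?_)
      exact (contMDiffOn_chartAt_S2 q).mono inter_subset_left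
    · rintro x ⟨hx, hxK, hx1, hx2⟩
      have hk : coordMap i r (chartAt (EuclideanSpace ℝ (Fin 2)) q x) ∈ K :=
        hKi _ hxK _ (fun j hj => coordMap_ne hj _ _)
      have := hr2 _ hx1
      refine ⟨(stereoParam_mem_stereoSet q).2 ⟨hk, ?_⟩, (stereoParam_mem_stereoSet q).2 ⟨hk, ?_⟩⟩
      · rw [mem_ofPred_eq, coordMap_self]
        exact ⟨by linarith, this.2⟩
      · rw [mem_ofPred_eq, coordMap_self]
        exact ⟨this.1, by linarith⟩
    · rintro x ⟨⟨hx, -, -, hx2⟩, -⟩ z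
      rw [coordMap_eq (hr1 _ hx2), stereoParam_chartAt hx]

/-- A smooth loop in the sphere is not surjective. -/
lemma exists_notMem_range_of_contMDiff {c : ℝ → S2} (hc : ContMDiff 𝓘(ℝ, ℝ) (𝓡 2) ∞ c) :
    ∃ z, ∀ t, c t ≠ z := by
  have h1 : ContDiff ℝ ∞ (fun t => (c t : EuclideanSpace ℝ (Fin 3))) :=
    (contMDiff_coe_S2.comp hc).contDiff
  -- The cone over the curve is a smooth image of a plane in `ℝ³`, so its complement is dense; a
  -- point outside the cone is then normalized.
  have h2 : ContDiff ℝ ∞ (fun p : ℝ × ℝ => p.1 • (c p.2 : EuclideanSpace ℝ (Fin 3))) :=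
    contDiff_fst.smul (h1.comp contDiff_snd)
  have hd := (h2.of_le (show (1 : WithTop ℕ∞) ≤ ∞ by norm_cast)).dense_compl_range_of_finrank_lt_finrank
    (by simp)
  obtain ⟨v, hv⟩ := hd.nonempty
  have hv0 : v ≠ 0 := by
    rintro rfl
    exact hv ⟨(0, 0), by simp⟩
  refine ⟨⟨‖v‖⁻¹ • v, by simp [norm_smul, hv0]⟩, fun t ht => hv ⟨(‖v‖, t), ?_⟩⟩
  simp [ht, smul_smul, hv0]

/-- Avoiding `z` is an open condition, so by compactness of the sphere of radius `R` it persists on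
a uniform thickening. A point `y` of the annulus is compared with its radial projection `(R / ‖y‖) •
y`. -/
lemma exists_thin_annulus {E Y : Type*} [NormedAddCommGroup E] [NormedSpace ℝ E] [ProperSpace E]
    [TopologicalSpace Y] [T1Space Y]
    {c : E → Y} {r R : ℝ} (hr : 0 < r) (hrR : r < R)
    (hc : ContinuousOn c {y | r < ‖y‖ ∧ ‖y‖ < 2 * R})
    {z : Y} (hz : ∀ y, ‖y‖ = R → c y ≠ z) :
    ∃ ε > 0, r < R - ε ∧ ∀ y, R - ε < ‖y‖ → ‖y‖ < R + ε → c y ≠ z := by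
  have hopen : IsOpen {y : E | r < ‖y‖ ∧ ‖y‖ < 2 * R} :=
    isOpen_Ioo.preimage (f := fun y : E => ‖y‖) continuous_norm
  have hO : IsOpen ({y | r < ‖y‖ ∧ ‖y‖ < 2 * R} ∩ c ⁻¹' {z}ᶜ) :=
    hc.isOpen_inter_preimage hopen isOpen_compl_singleton
  obtain ⟨δ, hδ, hsub⟩ := (isCompact_sphere (0 : E) R).exists_thickening_subset_open hO (by
    intro y hy
    have hy' : ‖y‖ = R := by simpa using hy
    exact ⟨⟨by linarith, by linarith⟩, hz y hy'⟩)
  refine ⟨min δ ((R - r) / 2), lt_min hδ (by linarith), ?_, fun y h1 h2 => ?_⟩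
  · linarith [min_le_right δ ((R - r) / 2)]
  · have hy : 0 < ‖y‖ := by linarith [min_le_right δ ((R - r) / 2)]
    refine (hsub ?_).2
    rw [Metric.mem_thickening_iff]
    refine ⟨(R / ‖y‖) • y, by simp [norm_smul, hy.ne', abs_of_pos (hr.trans hrR)], ?_⟩
    have : y - (R / ‖y‖) • y = ((‖y‖ - R) / ‖y‖) • y := by
      rw [sub_div, sub_smul, div_self hy.ne', one_smul]
    rw [dist_eq_norm, this, norm_smul, norm_div, norm_norm, div_mul_cancel₀ _ hy.ne',
      Real.norm_eq_abs, abs_lt]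
    exact ⟨by linarith [min_le_left δ ((R - r) / 2)], by linarith [min_le_left δ ((R - r) / 2)]⟩

lemma exists_smooth_step {a b : ℝ} (hab : a < b) : ∃ χ : ℝ → ℝ, ContDiff ℝ ∞ χ ∧
    (∀ t ≤ a, χ t = 1) ∧ ∀ t ≥ b, χ t = 0 := by
  refine ⟨fun t => 1 - Real.smoothTransition ((t - a) / (b - a)),
    contDiff_const.sub (Real.smoothTransition.contDiff.comp (by fun_prop)), fun t ht => ?_,
    fun t ht => ?_⟩
  · simp [Real.smoothTransition.zero_of_nonpos
      (div_nonpos_of_nonpos_of_nonneg (show t - a ≤ 0 by linarith)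
        (show 0 ≤ b - a by linarith))]
  · simp [Real.smoothTransition.one_of_one_le
      ((one_le_div (show 0 < b - a by linarith)).2 (by linarith : b - a ≤ t - a))]

/-- The loop `t ↦ (R cos t, R sin t)`. -/
lemma contDiff_circleLoop (R : ℝ) :
    ContDiff ℝ ∞ (fun t : ℝ => !₂[R * Real.cos t, R * Real.sin t]) := by
  rw [contDiff_euclidean]
  intro i
  fin_cases i
  · exact contDiff_const.mul Real.contDiff_cos
  · exact contDiff_const.mul Real.contDiff_sin

lemma exists_circleLoop_eq {R : ℝ} {y : EuclideanSpace ℝ (Fin 2)} (hy : ‖y‖ = R) :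
    ∃ t : ℝ, !₂[R * Real.cos t, R * Real.sin t] = y := by
  refine ⟨Complex.arg ⟨y 0, y 1⟩, ?_⟩
  have hn : ‖(⟨y 0, y 1⟩ : ℂ)‖ = R := by
    rw [← hy, EuclideanSpace.norm_eq, Complex.norm_def, Complex.normSq_mk, Fin.sum_univ_two]
    simp [sq]
  ext i
  fin_cases i
  · simp [← hn, Complex.norm_mul_cos_arg]
  · simp [← hn, Complex.norm_mul_sin_arg]

/-- Through every point of a sphere bundle over the sphere there is a smooth section. -/
lemma IsSphereBundle.exists_section (h : IsSphereBundle π) (p : M) :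
    ∃ s : S2 → M, ContMDiff (𝓡 2) (𝓡 4) ∞ s ∧ (∀ b, π (s b) = b) ∧ s (π p) = p := by
  classical
  set q := π p with hq
  set φ := chartAt (EuclideanSpace ℝ (Fin 2)) q with hφ
  obtain ⟨V₀, hV₀, hqV₀, T₂, S₂, hT₂⟩ := h.exists_isTrivOn (-q)
  have hqs : q ∈ φ.source := mem_chart_source _ q
  have hqq : -q ≠ q := by
    intro hh
    rw [hφ, chartAt_S2_source] at hqs
    exact hqs hh.symm
  -- Removing `q` forces `φ q` into the disc of radius `r`. There the section will still be the
  -- constant one through `p`.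
  let V := V₀ \ {q}
  have hV : IsOpen V := hV₀.sdiff isClosed_singleton
  replace hT₂ : IsTrivOn π V T₂ S₂ := hT₂.mono sdiff_subset
  obtain ⟨r, hr, hrV⟩ := exists_stereoParam_mem_of_norm_ge q hV ⟨hqV₀, hqq⟩
  have hφq : ‖φ q‖ < r := by
    by_contra hn
    have := hrV (φ q) (not_lt.1 hn)
    rw [stereoParam_chartAt hqs] at this
    exact this.2 rfl
  obtain ⟨T₁, S₁, hT₁⟩ := h.exists_isTrivOn_box q (-(4 * r)) (4 * r) (-(4 * r)) (4 * r)
  replace hT₁ : IsTrivOn π (stereoSet q (Metric.ball 0 (4 * r))) T₁ S₁ := by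
    refine hT₁.mono (inter_subset_inter_right _ (preimage_mono ?_))
    intro y hy
    have hy : ‖y‖ < 4 * r := by simpa using hy
    have h0 := abs_lt.1 ((PiLp.norm_apply_le y 0).trans_lt hy)
    have h1 := abs_lt.1 ((PiLp.norm_apply_le y 1).trans_lt hy)
    exact ⟨h0, h1⟩
  have hmem : ∀ y : EuclideanSpace ℝ (Fin 2), ‖y‖ < 4 * r →
      stereoParam q y ∈ stereoSet q (Metric.ball 0 (4 * r)) := fun y hy =>
    (stereoParam_mem_stereoSet q).2 (by simpa using hy)
  set x₀ := S₁ p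
  have hp : T₁ (q, x₀) = p := hT₁.total p ⟨hqs, by simp; linarith⟩
  -- the section over the annulus, seen in the second trivialization
  let c : EuclideanSpace ℝ (Fin 2) → S2 := fun y => S₂ (T₁ (stereoParam q y, x₀))
  have hcs : ContMDiffOn (𝓡 2) (𝓡 2) ∞ c {y | r ≤ ‖y‖ ∧ ‖y‖ < 4 * r} := by
    refine hT₂.smooth_snd.comp (hT₁.contMDiffOn.comp
      ((contMDiff_stereoParam q).contMDiffOn.prodMk contMDiffOn_const)
      (fun y hy => ⟨hmem y hy.2, mem_univ _⟩)) (fun y hy => ?_)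
    simp only [mem_preimage]
    rw [hT₁.proj _ (hmem y hy.2)]
    exact hrV y hy.1
  have hcT : ∀ y, r ≤ ‖y‖ → ‖y‖ < 4 * r →
      T₂ (stereoParam q y, c y) = T₁ (stereoParam q y, x₀) := by
    intro y h1 h2
    have := hT₂.total (T₁ (stereoParam q y, x₀))
      (by rw [hT₁.proj _ (hmem y h2)]; exact hrV y h1)
    rwa [hT₁.proj _ (hmem y h2)] at this
  have hloop : ContMDiff 𝓘(ℝ, ℝ) (𝓡 2) ∞
      (fun t => c (!₂[(2 * r) * Real.cos t, (2 * r) * Real.sin t])) := by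
    refine hcs.comp_contMDiff (contDiff_circleLoop (2 * r)).contMDiff (fun t => ?_)
    have : ‖(!₂[(2 * r) * Real.cos t, (2 * r) * Real.sin t] : EuclideanSpace ℝ (Fin 2))‖
        = 2 * r := by
      rw [EuclideanSpace.norm_eq, Fin.sum_univ_two]
      simp only [Matrix.cons_val_zero, Matrix.cons_val_one, Real.norm_eq_abs, sq_abs]
      rw [show (2 * r * Real.cos t) ^ 2 + (2 * r * Real.sin t) ^ 2 = (2 * r) ^ 2 by
        linear_combination (2 * r) ^ 2 * Real.sin_sq_add_cos_sq t]
      exact Real.sqrt_sq (by linarith)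
    simp only [mem_ofPred_eq, this]
    constructor <;> linarith
  -- The loop at radius `2r` avoids some `z`, and so does `c` at radii in `(2r - ε, 2r + ε)`. The
  -- stereographic chart `ψ` around `-z` omits exactly `z`.
  obtain ⟨z, hz⟩ := exists_notMem_range_of_contMDiff hloop
  obtain ⟨ε, hε, hε1, hεz⟩ := exists_thin_annulus (c := c) (R := 2 * r) hr (by linarith)
    (hcs.continuousOn.mono fun y hy => ⟨hy.1.le, by linarith [hy.2]⟩) (z := z) (fun y hy => by
      obtain ⟨t, rfl⟩ := exists_circleLoop_eq hy
      exact hz t)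
  obtain ⟨χ, hχ, hχ1, hχ0⟩ := exists_smooth_step (a := 2 * r - 2 * ε / 3) (b := 2 * r - ε / 3)
    (by linarith)
  set ψ := chartAt (EuclideanSpace ℝ (Fin 2)) (-z) with hψ
  have hψs : ∀ w, w ≠ z → w ∈ ψ.source := by
    intro w hw
    rw [hψ, chartAt_S2_source]
    simpa using hw
  -- In the chart `ψ` the map `c` is scaled linearly to the origin. It is unchanged up to radius `2r
  -- - 2ε/3` and constant from `2r - ε/3` on, so the three definitions of the section agree on
  -- overlaps.
  let κ : EuclideanSpace ℝ (Fin 2) → S2 := fun y => stereoParam (-z) (χ ‖y‖ • ψ (c y))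
  let A : Set (EuclideanSpace ℝ (Fin 2)) := {y | 2 * r - ε < ‖y‖ ∧ ‖y‖ < 2 * r}
  have hA : IsOpen A := isOpen_Ioo.preimage (f := fun y => ‖y‖) continuous_norm
  have hκ : ContMDiffOn (𝓡 2) (𝓡 2) ∞ κ A := by
    refine (contMDiff_stereoParam (-z)).comp_contMDiffOn ?_
    have k1 : ContMDiffOn (𝓡 2) (𝓡 2) ∞ (fun y => ψ (c y)) A := by
      refine (contMDiffOn_chartAt_S2 (-z)).comp (hcs.mono ?_) ?_
      · intro y hy
        exact ⟨by linarith [hy.1], by linarith [hy.2]⟩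
      · intro y hy
        exact hψs _ (hεz y hy.1 (by linarith [hy.2]))
    have k2 : ContDiffOn ℝ ∞ (fun y : EuclideanSpace ℝ (Fin 2) => χ ‖y‖) A := by
      refine hχ.comp_contDiffOn (fun y hy => ?_)
      refine (contDiffAt_norm ℝ ?_).contDiffWithinAt
      rintro rfl
      have := hy.1
      simp only [norm_zero] at this
      linarith
    exact (k2.smul k1.contDiffOn).contMDiffOn
  let O₁ := stereoSet q (Metric.ball 0 (2 * r - 2 * ε / 3))
  let O₂ := stereoSet q A
  let O₃ := (stereoParam q '' Metric.closedBall 0 (2 * r - ε / 3))ᶜ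
  have hO₁ : IsOpen O₁ := isOpen_stereoSet q Metric.isOpen_ball
  have hO₂ : IsOpen O₂ := isOpen_stereoSet q hA
  have hO₃ : IsOpen O₃ := ((isCompact_closedBall _ _).image
    (contMDiff_stereoParam q).continuous).isClosed.isOpen_compl
  have hO₃V : O₃ ⊆ V := by
    intro b hb
    by_cases hbq : b = -q
    · rw [hbq]; exact ⟨hqV₀, hqq⟩
    · have hbs : b ∈ φ.source := by rw [hφ, chartAt_S2_source]; exact hbq
      rw [← stereoParam_chartAt hbs]
      refine hrV _ ?_
      by_contra hn
      refine hb ⟨φ b, ?_, stereoParam_chartAt hbs⟩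
      simp only [Metric.mem_closedBall, dist_zero_right]
      linarith
  let s : S2 → M := fun b => if b ∈ O₁ then T₁ (b, x₀) else
    if b ∈ O₂ then T₂ (b, κ (φ b)) else T₂ (b, stereoParam (-z) 0)
  have hs1 : ∀ b ∈ O₁, s b = T₁ (b, x₀) := fun b hb => by simp [s, hb]
  have hs2 : ∀ b ∈ O₂, s b = T₂ (b, κ (φ b)) := by
    intro b hb
    by_cases hb1 : b ∈ O₁
    · rw [hs1 b hb1]
      have hy1 : ‖φ b‖ < 2 * r - 2 * ε / 3 := by simpa using hb1.2
      have hy2 := hb.2.1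
      have e : κ (φ b) = c (φ b) := by
        simp only [κ]
        rw [hχ1 _ hy1.le, one_smul]
        exact stereoParam_chartAt (hψs _ (hεz _ hy2 (by linarith)))
      have := hcT (φ b) (by linarith) (by linarith)
      rw [stereoParam_chartAt hb.1] at this
      rw [e, this]
    · simp [s, hb1, hb]
  have hs3 : ∀ b ∈ O₃, s b = T₂ (b, stereoParam (-z) 0) := by
    intro b hb
    have hy : b ∈ φ.source → 2 * r - ε / 3 < ‖φ b‖ := by
      intro hbs
      by_contra hn
      exact hb ⟨φ b, by simpa using hn, stereoParam_chartAt hbs⟩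
    by_cases hb1 : b ∈ O₁
    · exfalso
      have hy1 : ‖φ b‖ < 2 * r - 2 * ε / 3 := by simpa using hb1.2
      linarith [hy hb1.1]
    by_cases hb2 : b ∈ O₂
    · rw [hs2 b hb2]
      simp only [κ]
      rw [hχ0 _ (hy hb2.1).le, zero_smul]
    · simp [s, hb1, hb2]
  have hcov : ∀ b, b ∈ O₁ ∨ b ∈ O₂ ∨ b ∈ O₃ := by
    intro b
    by_cases hb3 : b ∈ O₃
    · exact Or.inr (Or.inr hb3)
    · obtain ⟨y, hy, rfl⟩ := not_not.1 hb3
      have hy' : ‖y‖ ≤ 2 * r - ε / 3 := by simpa using hy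
      rw [stereoParam_mem_stereoSet, stereoParam_mem_stereoSet]
      by_cases hy2 : ‖y‖ < 2 * r - 2 * ε / 3
      · left; simpa using hy2
      · right; left; exact ⟨by linarith, by linarith⟩
  refine ⟨s, fun b => ?_, fun b => ?_, ?_⟩
  · rcases hcov b with hb | hb | hb
    · refine (ContMDiffOn.congr (s := O₁) ?_ hs1).contMDiffAt (hO₁.mem_nhds hb)
      refine hT₁.contMDiffOn.comp (contMDiffOn_id.prodMk contMDiffOn_const) ?_
      rintro b ⟨hb, hb'⟩
      refine ⟨⟨hb, ?_⟩, mem_univ _⟩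
      have hy1 : ‖φ b‖ < 2 * r - 2 * ε / 3 := by simpa using hb'
      simp only [mem_preimage, Metric.mem_ball, dist_zero_right]
      linarith
    · refine (ContMDiffOn.congr (s := O₂) ?_ hs2).contMDiffAt (hO₂.mem_nhds hb)
      refine hT₂.contMDiffOn.comp (contMDiffOn_id.prodMk
        (hκ.comp ((contMDiffOn_chartAt_S2 q).mono inter_subset_left) fun b hb => hb.2)) ?_
      rintro b ⟨hb, hb'⟩
      refine ⟨?_, mem_univ _⟩
      have := hrV (φ b) (by linarith [hb'.1])
      rwa [stereoParam_chartAt hb] at this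
    · refine (ContMDiffOn.congr (s := O₃) ?_ hs3).contMDiffAt (hO₃.mem_nhds hb)
      exact hT₂.contMDiffOn.comp (contMDiffOn_id.prodMk contMDiffOn_const)
        fun b hb => ⟨hO₃V hb, mem_univ _⟩
  · rcases hcov b with hb | hb | hb
    · rw [hs1 b hb]
      refine hT₁.proj b ⟨hb.1, ?_⟩ _
      have hy1 : ‖φ b‖ < 2 * r - 2 * ε / 3 := by simpa using hb.2
      simp only [mem_preimage, Metric.mem_ball, dist_zero_right]
      linarith
    · rw [hs2 b hb]
      refine hT₂.proj b ?_ _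
      have := hrV (φ b) (by linarith [hb.2.1])
      rwa [stereoParam_chartAt hb.1] at this
    · rw [hs3 b hb, hT₂.proj b (hO₃V hb)]
  · rw [hs1 q ⟨hqs, by simp; linarith⟩, hp]

end Sections

/-! ### Smooth families of alternating forms -/

section FormCalculus

variable {E F G : Type*} [NormedAddCommGroup E] [NormedSpace ℝ E] [NormedAddCommGroup F]
  [NormedSpace ℝ F] [NormedAddCommGroup G] [NormedSpace ℝ G] {k : ℕ}

lemma contDiffAt_of_injective_comp {V W : Type*} [NormedAddCommGroup V] [NormedSpace ℝ V]
    [NormedAddCommGroup W] [NormedSpace ℝ W] [FiniteDimensional ℝ W] (Λ : V →L[ℝ] W)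
    (hΛ : Function.Injective Λ) {f : E → V} {y : E} {n : WithTop ℕ∞}
    (h : ContDiffAt ℝ n (fun z => Λ (f z)) y) : ContDiffAt ℝ n f y := by
  obtain ⟨L, hL⟩ := LinearMap.exists_leftInverse_of_injective (Λ : V →ₗ[ℝ] W)
    (LinearMap.ker_eq_bot.2 hΛ)
  have h2 := (LinearMap.toContinuousLinearMap L).contDiff.contDiffAt.comp y h
  refine h2.congr_of_eventuallyEq (Eventually.of_forall fun z => ?_)
  exact (LinearMap.congr_fun hL (f z)).symm

/-- An alternating form is determined by its values on tuples of basis vectors, so finitely many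
scalar functions control smoothness. -/
lemma contDiffAt_alternating [FiniteDimensional ℝ F] {η : E → F [⋀^Fin k]→L[ℝ] ℝ} {y : E}
    {n : WithTop ℕ∞} (h : ∀ v : Fin k → F, ContDiffAt ℝ n (fun z => η z v) y) :
    ContDiffAt ℝ n η y := by
  let b := Module.finBasis ℝ F
  let Λ : (F [⋀^Fin k]→L[ℝ] ℝ) →L[ℝ] ((Fin k → Fin (Module.finrank ℝ F)) → ℝ) :=
    ContinuousLinearMap.pi fun σ => ContinuousAlternatingMap.apply ℝ F ℝ (fun i => b (σ i))
  refine contDiffAt_of_injective_comp Λ ?_ ?_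
  · rw [← ContinuousLinearMap.coe_coe, ← LinearMap.ker_eq_bot, LinearMap.ker_eq_bot']
    intro α hα
    have : α.toAlternatingMap = 0 := by
      refine Module.Basis.ext_alternating b fun σ _ => ?_
      exact congrFun hα σ
    ext v
    exact DFunLike.congr_fun this v
  · rw [contDiffAt_pi]
    intro σ
    exact h _

lemma contDiffAt_pullback [FiniteDimensional ℝ E] {η : F → F [⋀^Fin k]→L[ℝ] ℝ}
    {f : G → F} {L : G → E →L[ℝ] F} {y : G}
    {n : WithTop ℕ∞} (hη : ContDiffAt ℝ n η (f y)) (hf : ContDiffAt ℝ n f y)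
    (hL : ContDiffAt ℝ n L y) :
    ContDiffAt ℝ n (fun z => (η (f z)).compContinuousLinearMap (L z)) y := by
  refine contDiffAt_alternating fun v => ?_
  have h1 : ContDiffAt ℝ n (fun z => ContinuousMultilinearMap.compContinuousLinearMapContinuousMultilinear
      ℝ (fun _ : Fin k => E) (fun _ => F) ℝ (fun _ => L z)) y :=
    (ContinuousMultilinearMap.contDiff _).contDiffAt.comp y (contDiffAt_pi.2 fun _ => hL)
  have h2 : ContDiffAt ℝ n (fun z => (η (f z)).toContinuousMultilinearMap) y :=
    (ContinuousAlternatingMap.toContinuousMultilinearMapCLM (𝕜 := ℝ) (E := F) (F := ℝ)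
      (ι := Fin k) ℝ).contDiff.contDiffAt.comp y
      (hη.comp y hf)
  have h3 := (ContinuousMultilinearMap.apply ℝ (fun _ : Fin k => E) ℝ v).contDiff.contDiffAt.comp y
    (h1.clm_apply h2)
  exact h3

lemma extDeriv_eq_zero_of_finrank_lt [FiniteDimensional ℝ E] (hk : Module.finrank ℝ E < k + 1)
    (η : E → E [⋀^Fin k]→L[ℝ] ℝ) (y : E) : extDeriv η y = 0 := by
  ext v
  refine AlternatingMap.map_linearDependent (extDeriv η y).toAlternatingMap v fun h => ?_
  have := h.fintype_card_le_finrank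
  simp only [Fintype.card_fin] at this
  omega

end FormCalculus

/-! ### Pullback of forms in charts -/

section Pullback

variable {m n k : ℕ} {N : Type*} [TopologicalSpace N] [ChartedSpace (EuclideanSpace ℝ (Fin m)) N]
  [IsManifold (𝓡 m) ∞ N] {M : Type*} [TopologicalSpace M]
  [ChartedSpace (EuclideanSpace ℝ (Fin n)) M] [IsManifold (𝓡 n) ∞ M]

lemma contMDiffAt_extChartAt_symm_of_mem {x₀ : N} {y : EuclideanSpace ℝ (Fin m)}
    (hy : y ∈ (extChartAt (𝓡 m) x₀).target) :
    ContMDiffAt (𝓡 m) (𝓡 m) ∞ (extChartAt (𝓡 m) x₀).symm y :=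
  (contMDiffOn_extChartAt_symm x₀).contMDiffAt ((isOpen_extChartAt_target x₀).mem_nhds hy)

/-- The local formula for pullbacks of forms. -/
lemma DForm.pullback_inChart (α : DForm n k M) {f : N → M} {O : Set N} (hO : IsOpen O)
    (hf : ContMDiffOn (𝓡 m) (𝓡 n) ∞ f O) {x₀ : N} {y₀ : EuclideanSpace ℝ (Fin m)}
    (hy₀ : y₀ ∈ (extChartAt (𝓡 m) x₀).target) (hyO : (extChartAt (𝓡 m) x₀).symm y₀ ∈ O) :
    ∃ (x₁ : M) (F : EuclideanSpace ℝ (Fin m) → EuclideanSpace ℝ (Fin n)),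
      x₁ = f ((extChartAt (𝓡 m) x₀).symm y₀) ∧ F y₀ = extChartAt (𝓡 n) x₁ x₁ ∧
      ContDiffAt ℝ ∞ F y₀ ∧
      (DForm.pullback f α).inChart x₀ =ᶠ[𝓝 y₀]
        fun y => (α.inChart x₁ (F y)).compContinuousLinearMap (fderiv ℝ F y) := by
  set σ := (extChartAt (𝓡 m) x₀).symm with hσ
  set x₁ := f (σ y₀) with hx₁
  have hσs := contMDiffAt_extChartAt_symm_of_mem hy₀
  let F := fun y => extChartAt (𝓡 n) x₁ (f (σ y))
  have htgt : (extChartAt (𝓡 m) x₀).target ∈ 𝓝 y₀ := (isOpen_extChartAt_target x₀).mem_nhds hy₀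
  have hcont : ContinuousAt (fun y => f (σ y)) y₀ :=
    ((hf.contMDiffAt (hO.mem_nhds hyO)).comp y₀ hσs).continuousAt
  have hmemO : ∀ᶠ y in 𝓝 y₀, σ y ∈ O := hσs.continuousAt.eventually_mem (hO.mem_nhds hyO)
  have hsrc : ∀ᶠ y in 𝓝 y₀, f (σ y) ∈ (chartAt (EuclideanSpace ℝ (Fin n)) x₁).source :=
    hcont.eventually_mem ((chartAt _ x₁).open_source.mem_nhds (mem_chart_source _ _))
  have hFs : ∀ y, y ∈ (extChartAt (𝓡 m) x₀).target → σ y ∈ O →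
      f (σ y) ∈ (chartAt (EuclideanSpace ℝ (Fin n)) x₁).source → ContDiffAt ℝ ∞ F y := by
    intro y h1 h2 h3
    refine ContMDiffAt.contDiffAt ?_
    exact (contMDiffAt_extChartAt' h3).comp y
      ((hf.contMDiffAt (hO.mem_nhds h2)).comp y (contMDiffAt_extChartAt_symm_of_mem h1))
  refine ⟨x₁, F, rfl, rfl, hFs y₀ hy₀ hyO hsrc.self_of_nhds, ?_⟩
  filter_upwards [htgt, hmemO, hsrc, hsrc.eventually_nhds] with y h1 h2 h3 h4
  have hp : (extChartAt (𝓡 n) x₁).symm (F y) = f (σ y) :=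
    (extChartAt (𝓡 n) x₁).left_inv (by rwa [extChartAt_source])
  -- Near `y₀` the map `y ↦ f (σ y)` also factors as the inverse chart around `x₁` after `F`.
  -- Comparing the two chain rules gives the formula.
  have e1 : HasMFDerivAt (𝓡 m) (𝓡 n) (fun y => f (σ y)) y
      ((mfderiv (𝓡 m) (𝓡 n) f (σ y)).comp (mfderiv (𝓡 m) (𝓡 m) σ y)) :=
    (((hf.contMDiffAt (hO.mem_nhds h2)).mdifferentiableAt (by simp)).hasMFDerivAt).comp y
      ((contMDiffAt_extChartAt_symm_of_mem h1).mdifferentiableAt (by simp)).hasMFDerivAt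
  have hFt : F y ∈ (extChartAt (𝓡 n) x₁).target :=
    (extChartAt (𝓡 n) x₁).map_source (by rwa [extChartAt_source])
  have e2 : HasMFDerivAt (𝓡 m) (𝓡 n) (fun y => (extChartAt (𝓡 n) x₁).symm (F y)) y
      ((mfderiv (𝓡 n) (𝓡 n) (extChartAt (𝓡 n) x₁).symm (F y)).comp (fderiv ℝ F y)) :=
    ((contMDiffAt_extChartAt_symm_of_mem hFt).mdifferentiableAt (by simp)).hasMFDerivAt.comp y
      ((hFs y h1 h2 h3).differentiableAt (by simp)).hasFDerivAt.hasMFDerivAt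
  have e3 : HasMFDerivAt (𝓡 m) (𝓡 n) (fun y => (extChartAt (𝓡 n) x₁).symm (F y)) y
      ((mfderiv (𝓡 m) (𝓡 n) f (σ y)).comp (mfderiv (𝓡 m) (𝓡 m) σ y)) := by
    refine e1.congr_of_eventuallyEq ?_
    filter_upwards [h4] with z hz
    exact (extChartAt (𝓡 n) x₁).left_inv (by rwa [extChartAt_source])
  have e4 := hasMFDerivAt_unique e2 e3
  ext v
  change α (f (σ y)) (fun i => (mfderiv (𝓡 m) (𝓡 n) f (σ y)).comp (mfderiv (𝓡 m) (𝓡 m) σ y) (v i))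
    = α ((extChartAt (𝓡 n) x₁).symm (F y)) (fun i =>
      (mfderiv (𝓡 n) (𝓡 n) (extChartAt (𝓡 n) x₁).symm (F y)).comp (fderiv ℝ F y) (v i))
  rw [← e4, hp]
  rfl

lemma DForm.IsSmoothOn.pullback {α : DForm n k M} {W : Set M} (hα : α.IsSmoothOn W) {f : N → M}
    {O : Set N} (hO : IsOpen O) (hf : ContMDiffOn (𝓡 m) (𝓡 n) ∞ f O) (hOW : MapsTo f O W) :
    (DForm.pullback (m := m) f α).IsSmoothOn O := by
  intro x₀ y₀ hy₀ hyO
  obtain ⟨x₁, F, hx₁, hFx, hF, he⟩ := α.pullback_inChart (m := m) hO hf hy₀ hyO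
  refine ContDiffAt.congr_of_eventuallyEq ?_ he
  refine contDiffAt_pullback ?_ hF (hF.fderiv_right (by simp))
  rw [hFx]
  refine hα x₁ _ (mem_extChartAt_target x₁) ?_
  rw [extChartAt_to_inv, hx₁]
  exact hOW hyO

lemma DForm.IsClosedOn.pullback {α : DForm n k M} {W : Set M} (hα : α.IsClosedOn W) {f : N → M}
    {O : Set N} (hO : IsOpen O) (hf : ContMDiffOn (𝓡 m) (𝓡 n) ∞ f O) (hOW : MapsTo f O W) :
    (DForm.pullback (m := m) f α).IsClosedOn O := by
  refine ⟨hα.1.pullback hO hf hOW, ?_⟩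
  intro x₀ y₀ hy₀ hyO
  obtain ⟨x₁, F, hx₁, hFx, hF, he⟩ := α.pullback_inChart (m := m) hO hf hy₀ hyO
  have hmem : (extChartAt (𝓡 n) x₁).symm (extChartAt (𝓡 n) x₁ x₁) ∈ W := by
    rw [extChartAt_to_inv, hx₁]
    exact hOW hyO
  rw [he.extDeriv_eq, extDeriv_pullback (r := ∞) ?_ hF
    (by rw [minSmoothness_of_isRCLikeNormedField]; exact WithTop.coe_le_coe.2 (le_top : (2 : ℕ∞) ≤ ⊤))]
  · rw [hFx, hα.2 x₁ _ (mem_extChartAt_target x₁) hmem]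
    ext v
    rfl
  · rw [hFx]
    exact (hα.1 x₁ _ (mem_extChartAt_target x₁) hmem).differentiableAt (by simp)

/-- On Euclidean space the chart expression of a form is the form itself. -/
lemma DForm.inChart_euclideanSpace (α : DForm n k (EuclideanSpace ℝ (Fin n)))
    (x₀ : EuclideanSpace ℝ (Fin n)) : α.inChart x₀ = α := by
  funext y
  ext v
  have h : chartSymmDeriv x₀ y = ContinuousLinearMap.id ℝ (EuclideanSpace ℝ (Fin n)) := by
    unfold chartSymmDeriv
    simp only [mfld_simps]
    exact mfderiv_id
  change α ((extChartAt (𝓡 n) x₀).symm y) (fun i => chartSymmDeriv x₀ y (v i)) = α y v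
  rw [h]
  rfl

end Pullback

lemma DForm.IsSmoothOn.isClosed_of_top {n : ℕ} {M : Type*} [TopologicalSpace M]
    [ChartedSpace (EuclideanSpace ℝ (Fin n)) M] {α : DForm n n M} (h : α.IsSmoothOn univ) :
    α.IsClosed :=
  ⟨h, fun _ _ _ _ => extDeriv_eq_zero_of_finrank_lt (by simp) _ _⟩

/-! ### Sections are embeddings -/

section SectionEmbedding

variable {M : Type*} [TopologicalSpace M] [ChartedSpace (EuclideanSpace ℝ (Fin 4)) M]
  [IsManifold (𝓡 4) ∞ M] {π : M → S2}

/-- An identification of `ℝ² × ℝ²` with `ℝ⁴`. -/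
def prodPlaneEquiv : (EuclideanSpace ℝ (Fin 2) × EuclideanSpace ℝ (Fin 2)) ≃L[ℝ]
    EuclideanSpace ℝ (Fin 4) :=
  ContinuousLinearEquiv.ofFinrankEq (by simp)

/-- A smooth section of a sphere bundle is a smooth embedding. -/
lemma IsSphereBundle.isSmoothEmbedding_section (h : IsSphereBundle π) {s : S2 → M}
    (hs : ContMDiff (𝓡 2) (𝓡 4) ∞ s) (hπs : ∀ b, π (s b) = b) :
    IsSmoothEmbedding (𝓡 2) (𝓡 4) ∞ s := by
  refine ⟨?_, .of_leftInverse hπs h.contMDiff.continuous hs.continuous⟩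
  refine IsImmersionOfComplement.isImmersion (F := EuclideanSpace ℝ (Fin 2)) fun b => ?_
  obtain ⟨U, hU, hbU, T, S, hT⟩ := h.exists_isTrivOn b
  set φ := chartAt (EuclideanSpace ℝ (Fin 2)) b with hφ
  set ψ := chartAt (EuclideanSpace ℝ (Fin 2)) (S (s b)) with hψ
  have hSs : ContMDiffOn (𝓡 2) (𝓡 2) ∞ (fun b => S (s b)) U :=
    hT.smooth_snd.comp hs.contMDiffOn (fun b hb => by simpa [hπs] using hb)
  let U₁ : Set S2 := (U ∩ (fun b => S (s b)) ⁻¹' ψ.source)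
  have hU₁ : IsOpen U₁ := hSs.continuousOn.isOpen_inter_preimage hU ψ.open_source
  let D : Set M := π ⁻¹' (U₁ ∩ φ.source) ∩ S ⁻¹' ψ.source
  have hDs : π ⁻¹' (U₁ ∩ φ.source) ⊆ π ⁻¹' U := fun m hm => hm.1.1
  have hD : IsOpen D := (hT.smooth_snd.continuousOn.mono hDs).isOpen_inter_preimage
    ((hU₁.inter φ.open_source).preimage h.contMDiff.continuous) ψ.open_source
  let g : S2 → EuclideanSpace ℝ (Fin 2) := fun b => ψ (S (s b))
  have hg : ContMDiffOn (𝓡 2) (𝓡 2) ∞ g U₁ :=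
    (contMDiffOn_chartAt_S2 _).comp (hSs.mono inter_subset_left) (fun b hb => hb.2)
  let κ := prodPlaneEquiv
  -- Subtracting the fiber coordinate `g` of the section straightens it: in this chart the section
  -- becomes `y ↦ (y, 0)`.
  let fw : M → EuclideanSpace ℝ (Fin 4) := fun m => κ (φ (π m), ψ (S m) - g (π m))
  let bw : EuclideanSpace ℝ (Fin 4) → M := fun z =>
    T (stereoParam b (κ.symm z).1, stereoParam (S (s b))
      ((κ.symm z).2 + g (stereoParam b (κ.symm z).1)))
  let R : Set (EuclideanSpace ℝ (Fin 4)) := (fun z => stereoParam b (κ.symm z).1) ⁻¹' U₁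
  have hcs : ContMDiff (𝓡 4) (𝓡 2) ∞ (fun z => stereoParam b (κ.symm z).1) :=
    (contMDiff_stereoParam b).comp
      (contDiff_fst.comp κ.symm.contDiff).contMDiff
  have hfw : ContMDiffOn (𝓡 4) (𝓡 4) ∞ fw D := by
    have k1 : ContMDiffOn (𝓡 4) (𝓡 2) ∞ (fun m => φ (π m)) D :=
      (contMDiffOn_chartAt_S2 b).comp h.contMDiff.contMDiffOn (fun m hm => hm.1.2)
    have k2 : ContMDiffOn (𝓡 4) (𝓡 2) ∞ (fun m => ψ (S m)) D :=
      (contMDiffOn_chartAt_S2 _).comp (hT.smooth_snd.mono fun m hm => hm.1.1.1)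
        (fun m hm => hm.2)
    have k3 : ContMDiffOn (𝓡 4) (𝓡 2) ∞ (fun m => g (π m)) D :=
      hg.comp h.contMDiff.contMDiffOn (fun m hm => hm.1.1)
    exact κ.contDiff.contMDiff.comp_contMDiffOn (k1.prodMk_space (k2.sub k3))
  have hbw : ContMDiffOn (𝓡 4) (𝓡 4) ∞ bw R := by
    have k1 : ContMDiffOn (𝓡 4) (𝓡 2) ∞ (fun z => g (stereoParam b (κ.symm z).1)) R :=
      hg.comp hcs.contMDiffOn (fun z hz => hz)
    have k2 : ContMDiff (𝓡 4) (𝓡 2) ∞ (fun z => (κ.symm z).2) :=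
      (contDiff_snd.comp κ.symm.contDiff).contMDiff
    exact hT.contMDiffOn.comp (hcs.contMDiffOn.prodMk
      ((contMDiff_stereoParam _).comp_contMDiffOn (k2.contMDiffOn.add k1)))
      (fun z hz => ⟨hz.1, mem_univ _⟩)
  have hπbw : ∀ z ∈ R, π (bw z) = stereoParam b (κ.symm z).1 := fun z hz => hT.proj _ hz.1 _
  have hSbw : ∀ z ∈ R, S (bw z) = stereoParam (S (s b))
      ((κ.symm z).2 + g (stereoParam b (κ.symm z).1)) := fun z hz => hT.snd _ hz.1 _
  let e : OpenPartialHomeomorph M (EuclideanSpace ℝ (Fin 4)) :=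
    { toFun := fw
      invFun := bw
      source := D
      target := R
      map_source' := by
        rintro m ⟨⟨hm1, hm2⟩, hm3⟩
        simp only [fw, R, mem_preimage, ContinuousLinearEquiv.symm_apply_apply]
        rwa [stereoParam_chartAt hm2]
      map_target' := by
        intro z hz
        refine ⟨?_, ?_⟩
        · rw [mem_preimage, hπbw z hz]
          exact ⟨hz, stereoParam_mem_source _ _⟩
        · rw [mem_preimage, hSbw z hz]
          exact stereoParam_mem_source _ _
      left_inv' := by
        rintro m ⟨⟨hm1, hm2⟩, hm3⟩
        simp only [fw, bw, ContinuousLinearEquiv.symm_apply_apply]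
        rw [stereoParam_chartAt hm2, sub_add_cancel, stereoParam_chartAt hm3]
        exact hT.total m hm1.1
      right_inv' := by
        intro z hz
        simp only [fw]
        rw [hπbw z hz, hSbw z hz, chartAt_stereoParam, chartAt_stereoParam, add_sub_cancel_right]
        simp
      open_source := hD
      open_target := hU₁.preimage hcs.continuous
      continuousOn_toFun := hfw.continuousOn
      continuousOn_invFun := hbw.continuousOn }
  have he : e ∈ IsManifold.maximalAtlas (𝓡 4) ∞ M := e.mem_maximalAtlas_of_contMDiffOn hfw hbw
  have hbU₁ : b ∈ U₁ := ⟨hbU, mem_chart_source (EuclideanSpace ℝ (Fin 2)) (S (s b))⟩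
  refine IsImmersionAtOfComplement.mk_of_continuousAt hs.continuous.continuousAt κ
    (φ.restr U₁) e ?_ ?_ ?_ he ?_
  · rw [φ.restr_source' _ hU₁]
    exact ⟨mem_chart_source _ _, hbU₁⟩
  · refine ⟨?_, ?_⟩
    · rw [mem_preimage, hπs]
      exact ⟨hbU₁, mem_chart_source _ _⟩
    · exact mem_chart_source (EuclideanSpace ℝ (Fin 2)) (S (s b))
  · exact restr_mem_maximalAtlas _ (IsManifold.chart_mem_maximalAtlas b) hU₁
  · intro y hy
    have : fw (s (stereoParam b y)) = κ (y, 0) := by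
      simp only [fw, hπs, g, sub_self]
      rw [chartAt_stereoParam]
    exact this

end SectionEmbedding

/-! ### Closedness, rank and transitivity of the pulled back form -/

section BasicForm

variable {M : Type*} [TopologicalSpace M] [ChartedSpace (EuclideanSpace ℝ (Fin 4)) M]
  {π : M → S2}

lemma mfderiv_comp_section (h : IsSphereBundle π) {s : S2 → M}
    (hs : ContMDiff (𝓡 2) (𝓡 4) ∞ s) (hπs : ∀ b, π (s b) = b) (b : S2)
    (v : EuclideanSpace ℝ (Fin 2)) :
    mfderiv (𝓡 4) (𝓡 2) π (s b) (mfderiv (𝓡 2) (𝓡 4) s b v) = v := by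
  have h1 : HasMFDerivAt (𝓡 2) (𝓡 2) (fun b => π (s b)) b
      ((mfderiv (𝓡 4) (𝓡 2) π (s b)).comp (mfderiv (𝓡 2) (𝓡 4) s b)) :=
    ((h.contMDiff (s b)).mdifferentiableAt (by simp)).hasMFDerivAt.comp b
      ((hs b).mdifferentiableAt (by simp)).hasMFDerivAt
  have h2 : (fun b => π (s b)) = id := funext hπs
  rw [h2] at h1
  have h3 := hasMFDerivAt_unique h1 (hasMFDerivAt_id b)
  exact DFunLike.congr_fun h3 v

/-- The differential of a section through `p` is a right inverse. -/
lemma IsSphereBundle.surjective_mfderiv (h : IsSphereBundle π) (p : M) :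
    Function.Surjective (mfderiv (𝓡 4) (𝓡 2) π p) := by
  obtain ⟨s, hs, hπs, hsp⟩ := h.exists_section p
  intro v
  have := mfderiv_comp_section h hs hπs (π p) v
  rw [hsp] at this
  exact ⟨_, this⟩

/-- A nonzero `a` would extend to a basis `(a, w)` of the plane on which `η` vanishes, forcing `η =
0`. -/
lemma eq_zero_of_alternating_eq_zero {V : Type*} [AddCommGroup V] [Module ℝ V]
    (hV : Module.finrank ℝ V = 2) {η : V [⋀^Fin 2]→ₗ[ℝ] ℝ} (hη : η ≠ 0) {a : V}
    (ha : ∀ w, η ![a, w] = 0) : a = 0 := by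
  by_contra ha0
  have hfin : FiniteDimensional ℝ V := Module.finite_of_finrank_eq_succ hV
  obtain ⟨w, hw⟩ := exists_linearIndependent_pair_of_one_lt_finrank (R := ℝ) (by omega) ha0
  let b := basisOfLinearIndependentOfCardEqFinrank hw (by simp [hV])
  refine hη (Module.Basis.ext_alternating b fun σ hσ => ?_)
  have h1 : ∀ i, b i = ![a, w] i := fun i => by simp [b]
  have h2 : η b = 0 := by
    have : (b : Fin 2 → V) = ![a, w] := funext h1
    rw [this]
    exact ha w
  let τ := Equiv.ofBijective σ (Finite.injective_iff_bijective.1 hσ)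
  have h3 : (fun i => b (σ i)) = b ∘ τ := rfl
  rw [h3, AlternatingMap.map_perm, h2]
  simp

/-- As `dvol` is nondegenerate on the base and `dπ` is onto, the kernel of `v ↦ ι_v α` is `ker dπ`;
rank–nullity, applied twice, gives `2`. -/
lemma IsSphereBundle.hasConstantRank_pullback (h : IsSphereBundle π) {dvol : DForm 2 2 S2}
    (hd : dvol.IsVolumeForm) : (DForm.pullback π dvol : DForm 4 2 M).HasConstantRank 2 := by
  intro p
  let L : EuclideanSpace ℝ (Fin 4) →L[ℝ] EuclideanSpace ℝ (Fin 2) := mfderiv (𝓡 4) (𝓡 2) π p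
  have hL : Function.Surjective L := h.surjective_mfderiv p
  let η : EuclideanSpace ℝ (Fin 2) [⋀^Fin 2]→L[ℝ] ℝ := dvol (π p)
  have hη : η.toAlternatingMap ≠ 0 := by
    intro h0
    refine hd.2 (π p) ?_
    ext v
    exact DFunLike.congr_fun h0 v
  let A := ((η.compContinuousLinearMap L).toAlternatingMap).curryLeft
  have hA : ∀ v w, A v ![w] = η ![L v, L w] := by
    intro v w
    simp only [A, AlternatingMap.curryLeft_apply_apply]
    change η (fun i => L (![v, w] i)) = _
    congr 1
    ext i
    fin_cases i <;> rfl
  change Module.finrank ℝ (LinearMap.range A) = 2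
  have hker : LinearMap.ker A = LinearMap.ker (L : EuclideanSpace ℝ (Fin 4) →ₗ[ℝ] EuclideanSpace ℝ (Fin 2)) := by
    ext v
    simp only [LinearMap.mem_ker, ContinuousLinearMap.coe_coe]
    constructor
    · intro hv
      refine eq_zero_of_alternating_eq_zero (by simp) hη fun w => ?_
      obtain ⟨w, rfl⟩ := hL w
      have := hA v w
      rw [hv] at this
      exact this.symm
    · intro hv
      ext w
      have : w = ![w 0] := by ext i; fin_cases i; rfl
      rw [this, hA, hv]
      exact η.map_coord_zero 0 rfl
  have h1 := A.finrank_range_add_finrank_ker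
  have h2 := (L : EuclideanSpace ℝ (Fin 4) →ₗ[ℝ] EuclideanSpace ℝ (Fin 2)).finrank_range_add_finrank_ker
  rw [LinearMap.range_eq_top.2 hL, finrank_top] at h2
  rw [hker] at h1
  simp only [finrank_euclideanSpace_fin] at h1 h2
  have e : Module.finrank ℝ (EuclideanSpace ℝ (Fin 4)) = 4 := by simp
  omega

/-- The transversal is the image of a section `s` through `p`, for `s^* π^* dvol = (π ∘ s)^* dvol =
dvol`. -/
lemma IsSphereBundle.isTransitive_pullback [IsManifold (𝓡 4) ∞ M] (h : IsSphereBundle π) {dvol : DForm 2 2 S2}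
    (hd : dvol.IsVolumeForm) : (DForm.pullback π dvol : DForm 4 2 M).IsTransitive := by
  intro p _
  obtain ⟨s, hs, hπs, hsp⟩ := h.exists_section p
  have hconn : ConnectedSpace S2 := by
    have : IsConnected (Metric.sphere (0 : EuclideanSpace ℝ (Fin 3)) 1) :=
      isConnected_sphere (by rw [← Module.finrank_eq_rank]; simp) 0 zero_le_one
    exact isConnected_iff_connectedSpace.1 this
  refine ⟨S2, inferInstance, inferInstance, inferInstance, inferInstance, inferInstance, hconn, s,
    h.isSmoothEmbedding_section hs hπs, ⟨π p, hsp⟩, ?_⟩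
  have : DForm.pullback s (DForm.pullback π dvol : DForm 4 2 M) = dvol := by
    funext b
    ext v
    change dvol (π (s b)) (fun i => mfderiv (𝓡 4) (𝓡 2) π (s b) (mfderiv (𝓡 2) (𝓡 4) s b (v i)))
      = dvol b v
    have h1 : (fun i => mfderiv (𝓡 4) (𝓡 2) π (s b) (mfderiv (𝓡 2) (𝓡 4) s b (v i))) = v :=
      funext fun i => mfderiv_comp_section h hs hπs b (v i)
    -- The two sides are forms at the points `π (s b)` and `b`, so the equality of the points has to
    -- be substituted.
    have h2 : ∀ b', b' = b → dvol b' v = dvol b v := by rintro _ rfl; rfl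
    exact (congrArg (dvol (π (s b))) h1).trans (h2 _ (hπs b))
  rwa [this]

lemma IsSphereBundle.isClosed_pullback [IsManifold (𝓡 4) ∞ M] (h : IsSphereBundle π) {dvol : DForm 2 2 S2}
    (hd : dvol.IsVolumeForm) : (DForm.pullback π dvol : DForm 4 2 M).IsClosed :=
  hd.1.isClosed_of_top.pullback isOpen_univ h.contMDiff.contMDiffOn (mapsTo_univ _ _)

end BasicForm

/-! ### The kernel of the Hodge dual of a 2-form in dimension four -/

section LinearAlgebra

/-- Join orthonormal bases of `Kᗮ` and `K`. Adjusting the orientation changes vectors at most by a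
sign, which respects membership in `K`. -/
lemma exists_adapted_orthonormalBasis {V : Type*} [NormedAddCommGroup V] [InnerProductSpace ℝ V]
    (hV : Module.finrank ℝ V = 4) (K : Submodule ℝ V) (hK : Module.finrank ℝ K = 2)
    (o : Orientation ℝ V (Fin 4)) :
    ∃ e : OrthonormalBasis (Fin 4) ℝ V, e.toBasis.orientation = o ∧ e 2 ∈ K ∧ e 3 ∈ K := by
  have hfin : FiniteDimensional ℝ V := Module.finite_of_finrank_eq_succ hV
  have hK' : Module.finrank ℝ Kᗮ = 2 := by
    have := K.finrank_add_finrank_orthogonal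
    omega
  let b := (stdOrthonormalBasis ℝ K).reindex (finCongr hK)
  let c := (stdOrthonormalBasis ℝ Kᗮ).reindex (finCongr hK')
  let f : Fin 4 → V := ![c 0, c 1, b 0, b 1]
  have hb : ∀ i j, inner ℝ (b i : V) (b j : V) = if i = j then 1 else 0 := fun i j => by
    have := orthonormal_iff_ite.1 b.orthonormal i j
    simpa using this
  have hc : ∀ i j, inner ℝ (c i : V) (c j : V) = if i = j then 1 else 0 := fun i j => by
    have := orthonormal_iff_ite.1 c.orthonormal i j
    simpa using this
  have hbc : ∀ i j, inner ℝ (b i : V) (c j : V) = 0 := fun i j =>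
    Submodule.inner_right_of_mem_orthogonal (b i).2 (c j).2
  have hcb : ∀ i j, inner ℝ (c i : V) (b j : V) = 0 := fun i j =>
    Submodule.inner_left_of_mem_orthogonal (b j).2 (c i).2
  have hf : Orthonormal ℝ f := by
    rw [orthonormal_iff_ite]
    intro i j
    fin_cases i <;> fin_cases j <;> simp [f, hb, hc, hbc, hcb, -inner_self_eq_norm_sq_to_K]
  let e₀ := (basisOfOrthonormalOfCardEqFinrank hf (by simp [hV])).toOrthonormalBasis (by simpa)
  have he₀ : ∀ i, e₀ i = f i := fun i => by simp [e₀]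
  refine ⟨e₀.adjustToOrientation o, e₀.orientation_adjustToOrientation o, ?_, ?_⟩
  · rcases e₀.adjustToOrientation_apply_eq_or_eq_neg o 2 with h | h <;> rw [h, he₀]
    · exact (b 0).2
    · exact K.neg_mem (b 0).2
  · rcases e₀.adjustToOrientation_apply_eq_or_eq_neg o 3 with h | h <;> rw [h, he₀]
    · exact (b 1).2
    · exact K.neg_mem (b 1).2

variable {V : Type*} [AddCommGroup V] [Module ℝ V]

/-- A Riemannian metric is given as a bilinear form on each tangent space, so the inner product
structure is built from `B` on the spot. -/
lemma exists_adapted_basis (hV : Module.finrank ℝ V = 4) (B : V →ₗ[ℝ] V →ₗ[ℝ] ℝ)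
    (hB : ∀ v w, B v w = B w v) (hpos : ∀ v, v ≠ 0 → 0 < B v v) (K : Submodule ℝ V)
    (hK : Module.finrank ℝ K = 2) (o : Orientation ℝ V (Fin 4)) :
    ∃ e : Module.Basis (Fin 4) ℝ V, (∀ i j, B (e i) (e j) = if i = j then 1 else 0) ∧
      e.orientation = o ∧ e 2 ∈ K ∧ e 3 ∈ K := by
  let core : InnerProductSpace.Core ℝ V :=
    { inner := fun v w => B v w
      conj_inner_symm := fun v w => by simp [hB v w]
      re_inner_nonneg := fun v => by
        by_cases hv : v = 0
        · simp [hv]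
        · exact (hpos v hv).le
      add_left := fun v w u => by simp
      smul_left := fun v w r => by simp
      definite := fun v hv => by
        by_contra h
        exact (hpos v h).ne' hv }
  let _ := core.toNormedAddCommGroup
  let _ := InnerProductSpace.ofCore core.toCore
  obtain ⟨e, he, h2, h3⟩ := exists_adapted_orthonormalBasis (V := V) hV K hK o
  refine ⟨e.toBasis, fun i j => ?_, he, by simpa using h2, by simpa using h3⟩
  simp only [OrthonormalBasis.coe_toBasis]
  exact orthonormal_iff_ite.1 e.orthonormal i j

/-- The bilinear map given by an alternating `2`-form. -/
def bilinOfAlternating (η : V [⋀^Fin 2]→ₗ[ℝ] ℝ) : V →ₗ[ℝ] V →ₗ[ℝ] ℝ :=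
  have hs : ∀ a b, η ![a, b] = -η ![b, a] := fun a b => by
    have h := η.map_swap ![a, b] (i := 0) (j := 1) (by decide)
    have e : (![a, b] ∘ ⇑(Equiv.swap (0 : Fin 2) 1)) = ![b, a] := by
      ext i; fin_cases i <;> simp
    rw [e] at h
    rw [h, neg_neg]
  LinearMap.mk₂ ℝ (fun a b => η ![a, b])
    (fun a a' b => η.map_vecCons_add ![b] a a')
    (fun c a b => η.map_vecCons_smul ![b] c a)
    (fun a b b' => by
      rw [hs, hs a b, hs a b', η.map_vecCons_add ![a] b b']; ring)
    (fun c a b => by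
      rw [hs, hs a b, η.map_vecCons_smul ![a] c b]; simp)

lemma bilinOfAlternating_apply (η : V [⋀^Fin 2]→ₗ[ℝ] ℝ) (a b : V) :
    bilinOfAlternating η a b = η ![a, b] := rfl

lemma bilinOfAlternating_self (η : V [⋀^Fin 2]→ₗ[ℝ] ℝ) (a : V) :
    bilinOfAlternating η a a = 0 :=
  η.map_eq_zero_of_eq ![a, a] (i := 0) (j := 1) rfl (by decide)

lemma bilinOfAlternating_swap (η : V [⋀^Fin 2]→ₗ[ℝ] ℝ) (a b : V) :
    bilinOfAlternating η a b = -bilinOfAlternating η b a := by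
  have h := bilinOfAlternating_self η (a + b)
  simp only [map_add, LinearMap.add_apply, bilinOfAlternating_self] at h
  linarith

/-- Evenness preserves the orientation of a reindexed basis. Since `i < 2`, the complement of `{i,
j}` contains `2` or `3`, that is, the index of a vector in the kernel of `α`. -/
lemma exists_even_perm : ∀ i j : Fin 4, i < 2 → j ≠ i →
    ∃ σ : Equiv.Perm (Fin 4), Equiv.Perm.sign σ = 1 ∧ σ 2 = i ∧ σ 3 = j ∧ (2 ≤ σ 0 ∨ 2 ≤ σ 1) := by
  decide

lemma orientation_reindex_of_even (e : Module.Basis (Fin 4) ℝ V) {σ : Equiv.Perm (Fin 4)}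
    (hσ : Equiv.Perm.sign σ = 1) : (e.reindex σ.symm).orientation = e.orientation := by
  rw [eq_comm, e.orientation_eq_iff_det_pos]
  have : (⇑(e.reindex σ.symm) : Fin 4 → V) = e ∘ σ := by ext i; simp
  rw [this, AlternatingMap.map_perm, hσ, one_smul, e.det_self]
  exact one_pos

/-- If `ψ` is the Hodge dual of a nonzero `2`-form `α` whose kernel `K` is a plane, the kernel of
`ψ` is the orthogonal complement of `K`. -/
lemma kernel_hodgeDual (hV : Module.finrank ℝ V = 4) (B : V →ₗ[ℝ] V →ₗ[ℝ] ℝ)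
    (hB : ∀ v w, B v w = B w v) (hpos : ∀ v, v ≠ 0 → 0 < B v v) (K : Submodule ℝ V)
    (hK : Module.finrank ℝ K = 2) (o : Orientation ℝ V (Fin 4)) {α ψ : V [⋀^Fin 2]→ₗ[ℝ] ℝ}
    (hα : α ≠ 0) (hαK : ∀ u ∈ K, ∀ w, α ![u, w] = 0)
    (hψ : ∀ e : Module.Basis (Fin 4) ℝ V, (∀ i j, B (e i) (e j) = if i = j then 1 else 0) →
      e.orientation = o → ψ ![e 2, e 3] = α ![e 0, e 1]) :
    (∀ h, (∀ w ∈ K, B h w = 0) → ∀ w, ψ ![h, w] = 0) ∧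
      ∀ h, (∀ w ∈ K, ψ ![h, w] = 0) → ∀ w ∈ K, B h w = 0 := by
  obtain ⟨e, heB, heo, he2, he3⟩ := exists_adapted_basis hV B hB hpos K hK o
  simp only [← bilinOfAlternating_apply] at hαK hψ ⊢
  set a := bilinOfAlternating α with ha
  set p := bilinOfAlternating ψ with hp
  have hKge : ∀ i : Fin 4, 2 ≤ i → e i ∈ K := by
    intro i hi
    fin_cases i
    · exact absurd hi (by decide)
    · exact absurd hi (by decide)
    · exact he2
    · exact he3
  have hp23 : p (e 2) (e 3) = a (e 0) (e 1) := hψ e heB heo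
  have ha01 : a (e 0) (e 1) ≠ 0 := by
    intro h0
    refine hα (Module.Basis.ext_alternating e fun σ hσ => ?_)
    have : (fun i => e (σ i)) = ![e (σ 0), e (σ 1)] := by ext i; fin_cases i <;> rfl
    rw [this, ← bilinOfAlternating_apply, ← ha]
    have hne : σ 0 ≠ σ 1 := fun h => absurd (hσ h) (by decide)
    change a (e (σ 0)) (e (σ 1)) = 0
    rcases le_or_gt 2 (σ 0) with h | h
    · exact hαK _ (hKge _ h) _
    rcases le_or_gt 2 (σ 1) with h' | h'
    · rw [ha, bilinOfAlternating_swap, ← ha, hαK _ (hKge _ h'), neg_zero]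
    have hdec : ∀ i j : Fin 4, i < 2 → j < 2 → i ≠ j → (i = 0 ∧ j = 1) ∨ (i = 1 ∧ j = 0) := by
      decide
    rcases hdec _ _ h h' hne with ⟨h1, h2⟩ | ⟨h1, h2⟩ <;> rw [h1, h2]
    · exact h0
    · rw [ha, bilinOfAlternating_swap, ← ha, h0, neg_zero]
  -- Apply the defining property of `⋆` to an even reindexing: `ψ(eᵢ, eⱼ)` becomes a value of `α`
  -- with an argument in `K`, hence zero.
  have hp0 : ∀ i j : Fin 4, i < 2 → p (e i) (e j) = 0 := by
    intro i j hi
    by_cases hij : j = i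
    · rw [hij]; exact bilinOfAlternating_self _ _
    obtain ⟨σ, hσ, rfl, rfl, hσK⟩ := exists_even_perm i j hi hij
    have h1 := hψ (e.reindex σ.symm) (fun i j => by simp [heB])
      (by rw [orientation_reindex_of_even e hσ, heo])
    simp only [Module.Basis.reindex_apply, Equiv.symm_symm] at h1
    rw [h1]
    rcases hσK with h | h
    · exact hαK _ (hKge _ h) _
    · rw [ha, bilinOfAlternating_swap, ← ha, hαK _ (hKge _ h), neg_zero]
  have hBe : ∀ v i, e.repr v i = B v (e i) := by
    intro v i
    have := congrArg (fun u => B u (e i)) (e.sum_repr v)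
    simp only [map_sum, LinearMap.sum_apply, map_smul, LinearMap.smul_apply, heB] at this
    simpa using this
  have hexp : ∀ v, v = ∑ i, B v (e i) • e i := fun v => by
    conv_lhs => rw [← e.sum_repr v]
    exact Finset.sum_congr rfl fun i _ => by rw [hBe]
  constructor
  · intro h hh w
    have h1 : p h = 0 := by
      refine e.ext fun j => ?_
      rw [hexp h]
      simp [Fin.sum_univ_four, hh _ he2, hh _ he3, hp0 0 j (by decide), hp0 1 j (by decide)]
    rw [h1]; rfl
  · intro h hh w hw
    have h3 := hh _ he3
    have h2 := hh _ he2
    rw [hexp h] at h2 h3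
    have hp33 : p (e 3) (e 3) = 0 := bilinOfAlternating_self _ _
    have hp22 : p (e 2) (e 2) = 0 := bilinOfAlternating_self _ _
    have hp32 : p (e 3) (e 2) = -a (e 0) (e 1) := by
      rw [hp, bilinOfAlternating_swap, ← hp, hp23]
    simp [Fin.sum_univ_four, hp0 0 _ (by decide), hp0 1 _ (by decide), hp33, hp23,
      ha01] at h3
    simp [Fin.sum_univ_four, hp0 0 _ (by decide), hp0 1 _ (by decide), hp22, hp32,
      ha01] at h2
    have ha23 : ∀ v, a (e 2) v = 0 ∧ a (e 3) v = 0 := fun v => ⟨hαK _ he2 v, hαK _ he3 v⟩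
    have ha11 : a (e 1) (e 1) = 0 := bilinOfAlternating_self _ _
    have ha00 : a (e 0) (e 0) = 0 := bilinOfAlternating_self _ _
    have ha10 : a (e 1) (e 0) = -a (e 0) (e 1) := by
      rw [ha, bilinOfAlternating_swap]
    -- Since `α(e₀, e₁) ≠ 0`, inserting `w ∈ K` into `α` kills its components along `e₀` and `e₁`.
    -- The components of `h` along `e₂` and `e₃` vanish by the preceding computation with `ψ`.
    have w0 := hαK w hw (e 1)
    have w1 := hαK w hw (e 0)
    rw [hexp w] at w0 w1
    simp [Fin.sum_univ_four, ha23, ha11, ha01] at w0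
    simp [Fin.sum_univ_four, ha23, ha00, ha10, ha01] at w1
    rw [hexp w]
    simp [Fin.sum_univ_four, w0, w1, h2, h3]

end LinearAlgebra

/-! ### From a closed Hodge dual to local closed forms with horizontal kernel -/

section Hodge

variable {M : Type*} [TopologicalSpace M] [ChartedSpace (EuclideanSpace ℝ (Fin 4)) M]
  [IsManifold (𝓡 4) ∞ M] {π : M → S2}

/-- `h` is orthogonal to the fiber of `π` through `x`. -/
def IsHorizontal (g : SmoothMetric 4 M) (π : M → S2) (x : M) (h : EuclideanSpace ℝ (Fin 4)) :
    Prop :=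
  ∀ w : EuclideanSpace ℝ (Fin 4), mfderiv (𝓡 4) (𝓡 2) π x w = 0 → g.inner x h w = 0

-- No orientation of `M` is given, so Hodge duals are only available over oriented open sets; a
-- tangent frame from a trivialization orients a neighbourhood.
variable (M) in
lemma exists_local_orientation (x₀ : M) : ∃ (U : Set M) (o : TangentOrientation 4 M),
    IsOpen U ∧ x₀ ∈ U ∧ o.IsOrientationOn U := by
  let e := trivializationAt (EuclideanSpace ℝ (Fin 4)) (TangentSpace (𝓡 4) : M → Type _) x₀
  let b : Module.Basis (Fin 4) ℝ (EuclideanSpace ℝ (Fin 4)) :=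
    (EuclideanSpace.basisFun (Fin 4) ℝ).toBasis
  classical
  let o : TangentOrientation 4 M := fun y =>
    if hy : y ∈ e.baseSet then (e.basisAt b hy).orientation else b.orientation
  refine ⟨e.baseSet, o, e.open_baseSet, mem_baseSet_trivializationAt _ _ _, fun x hx => ?_⟩
  refine ⟨e.localFrame b, fun i => contMDiffAt_localFrame_of_mem ∞ e b i hx, ?_⟩
  filter_upwards [e.open_baseSet.mem_nhds hx] with y hy
  exact ⟨e.basisAt b hy, fun i => (e.localFrame_apply_of_mem_baseSet b hy).symm, by simp [o, hy]⟩

/-- The derivative of `π` as a linear map between the model spaces. -/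
def fiberDeriv (π : M → S2) (p : M) : EuclideanSpace ℝ (Fin 4) →ₗ[ℝ] EuclideanSpace ℝ (Fin 2) :=
  let L : EuclideanSpace ℝ (Fin 4) →L[ℝ] EuclideanSpace ℝ (Fin 2) := mfderiv (𝓡 4) (𝓡 2) π p
  L

lemma IsSphereBundle.finrank_ker (h : IsSphereBundle π) (p : M) :
    Module.finrank ℝ (LinearMap.ker (fiberDeriv π p)) = 2 := by
  have h2 := (fiberDeriv π p).finrank_range_add_finrank_ker
  rw [show (fiberDeriv π p).range = ⊤ from LinearMap.range_eq_top.2 (h.surjective_mfderiv p), finrank_top] at h2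
  simp only [finrank_euclideanSpace_fin] at h2
  omega

/-- If the Hodge dual of `π^* dvol` is closed, then locally there is a closed `2`-form whose kernel
is the orthogonal complement of the fibers. -/
lemma IsSphereBundle.exists_closed_form_of_hodgeDualIsClosed (h : IsSphereBundle π)
    {dvol : DForm 2 2 S2} (hd : dvol.IsVolumeForm) {g : SmoothMetric 4 M}
    (hg : HodgeDualIsClosed (k := 2) (l := 2) g (DForm.pullback π dvol)) (x₀ : M) :
    ∃ (W : Set M) (ψ : DForm 4 2 M), IsOpen W ∧ x₀ ∈ W ∧ ψ.IsClosedOn W ∧ ∀ x ∈ W,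
      (∀ v, IsHorizontal g π x v → ∀ w : EuclideanSpace ℝ (Fin 4), ψ x ![v, w] = 0) ∧
      ∀ v, (∀ w : EuclideanSpace ℝ (Fin 4), mfderiv (𝓡 4) (𝓡 2) π x w = 0 → ψ x ![v, w] = 0) →
        IsHorizontal g π x v := by
  obtain ⟨W, o, hW, hx₀, ho⟩ := exists_local_orientation M x₀
  obtain ⟨ψ, hψ, hcl⟩ := hg W hW o ho
  refine ⟨W, ψ, hW, hx₀, hcl, fun x hx => ?_⟩
  let B : EuclideanSpace ℝ (Fin 4) →ₗ[ℝ] EuclideanSpace ℝ (Fin 4) →ₗ[ℝ] ℝ :=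
    let G : EuclideanSpace ℝ (Fin 4) →L[ℝ] EuclideanSpace ℝ (Fin 4) →L[ℝ] ℝ := g.inner x
    G.toLinearMap₁₂
  let K := LinearMap.ker (fiberDeriv π x)
  let α : EuclideanSpace ℝ (Fin 4) [⋀^Fin 2]→L[ℝ] ℝ := (DForm.pullback π dvol : DForm 4 2 M) x
  let ψx : EuclideanSpace ℝ (Fin 4) [⋀^Fin 2]→L[ℝ] ℝ := ψ x
  have hα : α.toAlternatingMap ≠ 0 := by
    intro h0
    refine hd.2 (π x) ?_
    ext v
    choose w hw using fun i => h.surjective_mfderiv x (v i)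
    have h1 : α w = 0 := DFunLike.congr_fun h0 w
    have h2 : α w = dvol (π x) v := by
      change dvol (π x) (fun i => mfderiv (𝓡 4) (𝓡 2) π x (w i)) = _
      simp only [hw]
    rw [← h2, h1]; rfl
  have key := kernel_hodgeDual (V := EuclideanSpace ℝ (Fin 4)) (by simp) B
    (fun v w => g.symm x v w) (fun v hv => g.pos x v hv) K (h.finrank_ker x) (o x)
    (α := α.toAlternatingMap) (ψ := ψx.toAlternatingMap) hα ?_ ?_
  · constructor
    · intro v hv w
      exact key.1 v (fun w hw => hv w hw) w
    · intro v hv w hw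
      exact key.2 v (fun w hw => hv w hw) w hw
  · intro u hu w
    refine (dvol (π x)).map_coord_zero (m := fun i => mfderiv (𝓡 4) (𝓡 2) π x (![u, w] i)) 0 ?_
    exact hu
  · intro e he heo
    have := hψ x hx e he heo
    have e1 : (fun j => e (Fin.natAdd 2 j)) = ![e 2, e 3] := by ext j; fin_cases j <;> rfl
    have e2 : (fun i => e (Fin.castAdd 2 i)) = ![e 0, e 1] := by ext j; fin_cases j <;> rfl
    have e3 : ψx (fun j => e (Fin.natAdd 2 j)) = α (fun i => e (Fin.castAdd 2 i)) := this
    rw [e1, e2] at e3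
    exact e3

end Hodge

/-! ### Smoothness of superposition operators on continuous functions -/

section Nemytskii

variable {I : Type*} [TopologicalSpace I] [CompactSpace I]

/-- Pointwise application of operator-valued functions. -/
def pointwiseApply (I : Type*) [TopologicalSpace I] [CompactSpace I] (W F : Type*)
    [NormedAddCommGroup W] [NormedSpace ℝ W] [NormedAddCommGroup F] [NormedSpace ℝ F] :
    C(I, W →L[ℝ] F) →L[ℝ] C(I, W) →L[ℝ] C(I, F) :=
  LinearMap.mkContinuous₂
    (LinearMap.mk₂ ℝ (fun (A : C(I, W →L[ℝ] F)) (v : C(I, W)) =>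
        (⟨fun t => A t (v t), by fun_prop⟩ : C(I, F)))
      (fun A A' v => by ext; simp) (fun c A v => by ext; simp)
      (fun A v v' => by ext; simp) (fun c A v => by ext; simp)) 1
    (fun A v => by
      refine (ContinuousMap.norm_le _ (by positivity)).2 fun t => ?_
      rw [one_mul]
      exact ((A t).le_opNorm _).trans (mul_le_mul (A.norm_coe_le_norm t) (v.norm_coe_le_norm t)
        (norm_nonneg _) (norm_nonneg A)))

universe u

variable {W F : Type u} [NormedAddCommGroup W] [NormedSpace ℝ W]
  [NormedAddCommGroup F] [NormedSpace ℝ F]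

/-- The mean value inequality is applied at each `t`. The estimate is uniform in `t` because `u ↦ f'
∘ u` is continuous for the supremum norm. -/
lemma hasFDerivAt_postcomp {f : W → F} {f' : W → W →L[ℝ] F} (hf : ∀ w, HasFDerivAt f (f' w) w)
    (hf' : Continuous f') (u : C(I, W)) :
    HasFDerivAt (fun u : C(I, W) => (⟨f, continuous_iff_continuousAt.2
        fun w => (hf w).continuousAt⟩ : C(W, F)).comp u)
      (pointwiseApply I W F ((⟨f', hf'⟩ : C(W, W →L[ℝ] F)).comp u)) u := by
  rw [hasFDerivAt_iff_isLittleO, Asymptotics.isLittleO_iff]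
  intro ε hε
  have hc : Continuous fun u : C(I, W) => (⟨f', hf'⟩ : C(W, W →L[ℝ] F)).comp u :=
    ContinuousMap.continuous_postcomp _
  obtain ⟨δ, hδ, hδ'⟩ := Metric.mem_nhds_iff.1
    (hc.continuousAt (x := u) (Metric.ball_mem_nhds ((⟨f', hf'⟩ : C(W, W →L[ℝ] F)).comp u) hε))
  filter_upwards [Metric.ball_mem_nhds u hδ] with v hv
  refine (ContinuousMap.norm_le _ (by positivity)).2 fun t => ?_
  have hcv : Convex ℝ (Metric.ball (u t) δ) := convex_ball _ _
  have hmv := hcv.norm_image_sub_le_of_norm_hasFDerivWithin_le' (f := f) (f' := f')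
    (φ := f' (u t)) (C := ε) (x := u t) (y := v t)
    (fun z _ => (hf z).hasFDerivWithinAt) (fun z hz => ?_) (Metric.mem_ball_self hδ) ?_
  · refine hmv.trans (mul_le_mul_of_nonneg_left ?_ hε.le)
    exact (v - u).norm_coe_le_norm t
  -- Translating `u` by the constant `z - u t` gives a curve in the `δ`-ball around `u` that passes
  -- through `z` at time `t`.
  · have h1 := hδ' (show u + ContinuousMap.const I (z - u t) ∈ Metric.ball u δ by
      rw [mem_ball_iff_norm, add_sub_cancel_left]
      refine lt_of_le_of_lt ((ContinuousMap.norm_le _ (norm_nonneg (z - u t))).2 fun _ => le_rfl) ?_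
      rwa [← mem_ball_iff_norm])
    have h2 := (ContinuousMap.dist_apply_le_dist t).trans (Metric.mem_ball.1 h1).le
    simpa [dist_eq_norm] using h2
  · exact (ContinuousMap.dist_apply_le_dist t).trans_lt hv

/-- Induction on the order: the derivative is pointwise application of the superposition operator of
`fderiv ℝ f`. The target space varies in the induction, as this derivative takes values in `W →L[ℝ]
F`. -/
lemma contDiff_postcomp_nat (n : ℕ) : ∀ {F : Type u} [NormedAddCommGroup F] [NormedSpace ℝ F]
    {f : W → F} (hf : ContDiff ℝ n f),
    ContDiff ℝ n (fun u : C(I, W) => (⟨f, hf.continuous⟩ : C(W, F)).comp u) := by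
  induction n with
  | zero =>
    intro F _ _ f hf
    exact contDiff_zero.2 (ContinuousMap.continuous_postcomp _)
  | succ n ih =>
    intro F _ _ f hf
    have h1 : ContDiff ℝ ((n : WithTop ℕ∞) + 1) f := by exact_mod_cast hf
    have h2 := (contDiff_succ_iff_fderiv.1 h1).2.2
    have h3 : ∀ w, HasFDerivAt f (fderiv ℝ f w) w := fun w =>
      ((contDiff_succ_iff_fderiv.1 h1).1 w).hasFDerivAt
    have h4 := fun u : C(I, W) => hasFDerivAt_postcomp h3 h2.continuous u
    have : ContDiff ℝ ((n : WithTop ℕ∞) + 1)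
        (fun u : C(I, W) => (⟨f, hf.continuous⟩ : C(W, F)).comp u) := by
      refine contDiff_succ_iff_hasFDerivAt.2 ⟨_, ?_, h4⟩
      exact (pointwiseApply I W F).contDiff.comp (ih h2)
    exact_mod_cast this

lemma contDiff_postcomp {f : W → F} (hf : ContDiff ℝ ∞ f) :
    ContDiff ℝ ∞ (fun u : C(I, W) => (⟨f, hf.continuous⟩ : C(W, F)).comp u) :=
  contDiff_infty.2 fun n => contDiff_postcomp_nat n (hf.of_le (by exact_mod_cast le_top))

end Nemytskii

/-! ### The integration operator -/

section Primitive

variable {E : Type*} [NormedAddCommGroup E] [NormedSpace ℝ E]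

/-- The projection of the real line to the unit interval. -/
abbrev projUnit : ℝ → unitInterval := projIcc 0 1 zero_le_one

lemma continuous_comp_projUnit (v : C(unitInterval, E)) : Continuous fun τ => v (projUnit τ) :=
  v.continuous.comp continuous_projIcc

/-- The primitive vanishing at `a`, as an operator on continuous functions. -/
def primitive (E : Type*) [NormedAddCommGroup E] [NormedSpace ℝ E] (a : unitInterval) :
    C(unitInterval, E) →L[ℝ] C(unitInterval, E) :=
  LinearMap.mkContinuous
    { toFun := fun v => ⟨fun t => ∫ τ in (a : ℝ)..t, v (projUnit τ),
        (intervalIntegral.continuous_primitive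
          (fun _ _ => (continuous_comp_projUnit v).intervalIntegrable _ _) _).comp
          continuous_subtype_val⟩
      map_add' := fun v w => by
        ext t
        exact intervalIntegral.integral_add ((continuous_comp_projUnit v).intervalIntegrable _ _)
          ((continuous_comp_projUnit w).intervalIntegrable _ _)
      map_smul' := fun c v => by
        ext t
        exact intervalIntegral.integral_smul c _ } 1
    (fun v => by
      refine (ContinuousMap.norm_le _ (by positivity)).2 fun t => ?_
      have h1 := intervalIntegral.norm_integral_le_of_norm_le_const (a := (a : ℝ)) (b := t)
        (f := fun τ => v (projUnit τ)) (C := ‖v‖) (fun τ _ => v.norm_coe_le_norm _)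
      refine h1.trans ?_
      rw [one_mul]
      refine mul_le_of_le_one_right (norm_nonneg _) ?_
      rw [abs_le]
      constructor <;> linarith [t.2.1, t.2.2, a.2.1, a.2.2])

lemma norm_primitive_le (a : unitInterval) : ‖primitive E a‖ ≤ 1 :=
  LinearMap.mkContinuous_norm_le _ zero_le_one _

end Primitive

/-! ### Integral equations with parameters and radial parallel transport -/

section ODE

universe u

variable {B E : Type u} [NormedAddCommGroup B] [NormedSpace ℝ B] [CompleteSpace B]
  [NormedAddCommGroup E] [NormedSpace ℝ E] [CompleteSpace E]

/-- The curve `t ↦ (t, b, v t)`, as a function of `(b, v)`. -/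
def graphCurve (q : B × C(unitInterval, E)) : C(unitInterval, ℝ × B × E) :=
  ⟨fun t => (t, q.1, q.2 t), by fun_prop⟩

lemma contDiff_graphCurve : ContDiff ℝ ∞ (graphCurve : B × C(unitInterval, E) → _) := by
  let c₀ : C(unitInterval, ℝ × B × E) := ⟨fun t => (t, 0, 0), by fun_prop⟩
  let Λ : B × C(unitInterval, E) →L[ℝ] C(unitInterval, ℝ × B × E) :=
    (ContinuousLinearMap.compLeftContinuous ℝ unitInterval
      (ContinuousLinearMap.inr ℝ ℝ (B × E) ∘L ContinuousLinearMap.inl ℝ B E) ∘L ContinuousLinearMap.const ℝ unitInterval (M := B)) ∘L ContinuousLinearMap.fst ℝ _ _ +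
    ContinuousLinearMap.compLeftContinuous ℝ unitInterval
      (ContinuousLinearMap.inr ℝ ℝ (B × E) ∘L ContinuousLinearMap.inr ℝ B E) ∘L ContinuousLinearMap.snd ℝ _ _
  have : (graphCurve : B × C(unitInterval, E) → _) = fun q => c₀ + Λ q := by
    funext q
    ext t <;> simp [graphCurve, c₀, Λ]
  rw [this]
  exact contDiff_const.add Λ.contDiff

/-- Integral curves of `f`, contracting on a time interval of length one, depend smoothly on
parameters and on the value prescribed at a time `a`. -/
lemma exists_smooth_integral_curves {f : ℝ × B × E → E} (hf : ContDiff ℝ ∞ f) {O : Set B}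
    (hO : IsOpen O) {K : NNReal} (hK : K < 1)
    (hL : ∀ b ∈ O, ∀ t ∈ Icc (0 : ℝ) 1, LipschitzWith K fun y => f (t, b, y)) (a : unitInterval) :
    ∃ u : B × E → C(unitInterval, E), (∀ p ∈ O ×ˢ univ, ContDiffAt ℝ ∞ u p) ∧
      ∀ b ∈ O, ∀ (x : E) (v : C(unitInterval, E)),
        (∀ t, v t = x + ∫ τ in (a : ℝ)..t, f (projUnit τ, b, v (projUnit τ))) ↔ v = u (b, x) := by
  let N : B × C(unitInterval, E) → C(unitInterval, E) := fun q =>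
    (⟨f, hf.continuous⟩ : C(ℝ × B × E, E)).comp (graphCurve q)
  have hN : ContDiff ℝ ∞ N := (contDiff_postcomp hf).comp contDiff_graphCurve
  let constE : E →L[ℝ] C(unitInterval, E) := .const ℝ unitInterval
  let R : B × C(unitInterval, E) → C(unitInterval, E) := fun q => primitive E a (N q)
  have hR : ContDiff ℝ ∞ R := (primitive E a).contDiff.comp hN
  have hRL : ∀ b ∈ O, LipschitzWith K fun v => R (b, v) := by
    intro b hb
    refine LipschitzWith.of_dist_le_mul fun v w => ?_
    rw [dist_eq_norm, dist_eq_norm, ← map_sub]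
    refine ((primitive E a).le_of_opNorm_le (norm_primitive_le a) _).trans ?_
    rw [one_mul]
    refine (ContinuousMap.norm_le _ (by positivity)).2 fun t => ?_
    have := (hL b hb t t.2).dist_le_mul (v t) (w t)
    rw [dist_eq_norm, dist_eq_norm] at this
    exact this.trans (mul_le_mul_of_nonneg_left ((v - w).norm_coe_le_norm t) K.2)
  have hiff : ∀ (b : B) (x : E) (v : C(unitInterval, E)),
      (∀ t, v t = x + ∫ τ in (a : ℝ)..t, f (projUnit τ, b, v (projUnit τ))) ↔
        constE x + R (b, v) = v := by
    intro b x v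
    rw [eq_comm, DFunLike.ext_iff]
    rfl
  have hex : ∀ b ∈ O, ∀ x : E, ∃ u, ∀ v, constE x + R (b, v) = v ↔ v = u := by
    intro b hb x
    have hc : ContractingWith K fun v => constE x + R (b, v) :=
      ⟨hK, LipschitzWith.of_dist_le_mul fun v w => by
        rw [dist_add_left]; exact (hRL b hb).dist_le_mul v w⟩
    exact ⟨hc.fixedPoint, fun v => ⟨fun h => hc.fixedPoint_unique h, fun h => by
      rw [h]; exact hc.fixedPoint_isFixedPt⟩⟩
  classical
  let u : B × E → C(unitInterval, E) := fun p =>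
    if h : p.1 ∈ O then Classical.choose (hex p.1 h p.2) else 0
  have hu : ∀ b ∈ O, ∀ (x : E) (v : C(unitInterval, E)),
      constE x + R (b, v) = v ↔ v = u (b, x) := by
    intro b hb x v
    simp only [u, hb, dif_pos]
    exact Classical.choose_spec (hex b hb x) v
  refine ⟨u, ?_, fun b hb x v => (hiff b x v).trans (hu b hb x v)⟩
  rintro ⟨b, x⟩ ⟨hb, -⟩
  let Φ : (B × E) × C(unitInterval, E) → C(unitInterval, E) := fun q =>
    q.2 - constE q.1.2 - R (q.1.1, q.2)
  have hΦ : ContDiff ℝ ∞ Φ := by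
    refine (contDiff_snd.sub (constE.contDiff.comp
      (contDiff_snd.comp contDiff_fst))).sub (hR.comp ?_)
    fun_prop
  have hΦ0 : ∀ b ∈ O, ∀ x v, Φ ((b, x), v) = 0 ↔ v = u (b, x) := by
    intro b hb x v
    rw [← hu b hb x v, eq_comm (a := constE x + R (b, v)), ← sub_eq_zero (a := v)]
    simp only [Φ, sub_sub]
  -- The partial derivative in `v` is `1 - Q` with `‖Q‖ ≤ K < 1`, hence invertible by the Neumann
  -- series. The implicit function theorem then gives smoothness of `u`.
  have hinv : (fderiv ℝ Φ ((b, x), u (b, x)) ∘L .inr ℝ (B × E) C(unitInterval, E)).IsInvertible := by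
    let Q := fderiv ℝ (fun v => R (b, v)) (u (b, x))
    have hQ : ‖Q‖ < 1 := (norm_fderiv_le_of_lipschitz ℝ (hRL b hb)).trans_lt (by exact_mod_cast hK)
    have hd : DifferentiableAt ℝ (fun v => R (b, v)) (u (b, x)) :=
      (hR.differentiable (by simp)).differentiableAt.comp _
        ((differentiableAt_const _).prodMk differentiableAt_id)
    have h1 : HasFDerivAt (fun v => Φ ((b, x), v)) (1 - Q) (u (b, x)) :=
      ((hasFDerivAt_id (u (b, x))).sub_const (constE x)).sub hd.hasFDerivAt
    have h2 : HasFDerivAt (fun v => Φ ((b, x), v))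
        (fderiv ℝ Φ ((b, x), u (b, x)) ∘L .inr ℝ (B × E) C(unitInterval, E)) (u (b, x)) :=
      (hΦ.differentiable (by simp)).differentiableAt.hasFDerivAt.comp _
        (hasFDerivAt_prodMk_right _ _)
    rw [h2.unique h1]
    obtain ⟨w, hw⟩ := isUnit_one_sub_of_norm_lt_one (x := Q) hQ
    rw [← hw]
    exact ⟨ContinuousLinearEquiv.ofUnit w, rfl⟩
  have hΦat : ContDiffAt ℝ ∞ Φ ((b, x), u (b, x)) := hΦ.contDiffAt
  refine (hΦat.contDiffAt_implicitFunction (by simp) hinv).congr_of_eventuallyEq ?_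
  filter_upwards [hΦat.eventually_apply_implicitFunction (by simp) hinv,
    (hO.prod isOpen_univ).mem_nhds (show (b, x) ∈ O ×ˢ univ from ⟨hb, mem_univ _⟩)] with p hp hpO
  rw [(hΦ0 b hb x _).2 rfl] at hp
  exact ((hΦ0 p.1 hpO.1 p.2 _).1 hp).symm

/-- The parallel transport of the connection `G` along rays from the origin. -/
lemma exists_radial_transport {G : B × E → B →L[ℝ] E} (hG : ContDiff ℝ ∞ G) {K : NNReal}
    (hK : LipschitzWith K G) :
    ∃ δ > 0, ∃ s s' : B × E → E,
      (∀ p ∈ Metric.ball 0 δ ×ˢ univ, ContDiffAt ℝ ∞ s p) ∧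
      (∀ p ∈ Metric.ball 0 δ ×ˢ univ, ContDiffAt ℝ ∞ s' p) ∧
      (∀ b ∈ Metric.ball 0 δ, ∀ x, s' (b, s (b, x)) = x ∧ s (b, s' (b, x)) = x) ∧
      (∀ x, s (0, x) = x) ∧
      ∀ b ∈ Metric.ball 0 δ, ∀ x, ∀ t ∈ Icc (0 : ℝ) 1,
        fderiv ℝ (fun b' => s (b', x)) (t • b) b = G (t • b, s (t • b, x)) b := by
  let f : ℝ × B × E → E := fun p => G (p.1 • p.2.1, p.2.2) p.2.1
  have hf : ContDiff ℝ ∞ f :=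
    (hG.comp ((contDiff_fst.smul (contDiff_fst.comp contDiff_snd)).prodMk
      (contDiff_snd.comp contDiff_snd))).clm_apply (contDiff_fst.comp contDiff_snd)
  -- For `‖b‖ < δ` the field `G(t b, ·) b` has Lipschitz constant at most `K ‖b‖ ≤ 1/2`, so the
  -- equation is contracting on the whole unit time interval.
  let δ : ℝ := 1 / (2 * (K + 1))
  have hδ : 0 < δ := by positivity
  have hL : ∀ b ∈ Metric.ball (0 : B) δ, ∀ t ∈ Icc (0 : ℝ) 1,
      LipschitzWith (1 / 2) fun y => f (t, b, y) := by
    intro b hb t _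
    refine LipschitzWith.of_dist_le_mul fun y y' => ?_
    have h1 := hK.dist_le_mul (t • b, y) (t • b, y')
    rw [dist_eq_norm] at h1
    have h2 : dist (t • b, y) (t • b, y') = dist y y' := by simp [Prod.dist_eq]
    rw [h2] at h1
    have h3 : (K : ℝ) * ‖b‖ ≤ 1 / 2 := by
      have h4 : ‖b‖ < δ := by simpa using hb
      calc (K : ℝ) * ‖b‖ ≤ (K + 1) * δ :=
            mul_le_mul (by linarith) h4.le (norm_nonneg _) (by positivity)
        _ = 1 / 2 := by simp only [δ]; field_simp
    rw [dist_eq_norm]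
    change ‖G (t • b, y) b - G (t • b, y') b‖ ≤ _
    rw [← _root_.sub_apply]
    calc _ ≤ ‖G (t • b, y) - G (t • b, y')‖ * ‖b‖ := ContinuousLinearMap.le_opNorm _ _
      _ ≤ (K * dist y y') * ‖b‖ := mul_le_mul_of_nonneg_right h1 (norm_nonneg _)
      _ = (K * ‖b‖) * dist y y' := by ring
      _ ≤ 1 / 2 * dist y y' := mul_le_mul_of_nonneg_right h3 dist_nonneg
      _ = _ := by simp
  have hhalf : (1 / 2 : NNReal) < 1 := by
    rw [← NNReal.coe_lt_coe]; norm_num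
  obtain ⟨u, hu, hu'⟩ := exists_smooth_integral_curves hf Metric.isOpen_ball hhalf hL 0
  obtain ⟨w, hw, hw'⟩ := exists_smooth_integral_curves hf Metric.isOpen_ball hhalf hL 1
  have hcont : ∀ b (v : C(unitInterval, E)),
      Continuous fun τ => f (projUnit τ, b, v (projUnit τ)) := fun b v =>
    hf.continuous.comp ((continuous_subtype_val.comp continuous_projIcc).prodMk
      (continuous_const.prodMk (continuous_comp_projUnit v)))
  have hint : ∀ b (v : C(unitInterval, E)) (a c : ℝ), IntervalIntegrable
      (fun τ => f (projUnit τ, b, v (projUnit τ))) MeasureTheory.volume a c := fun b v a c =>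
    (hcont b v).intervalIntegrable _ _
  have hueq : ∀ b ∈ Metric.ball (0 : B) δ, ∀ x t, u (b, x) t =
      x + ∫ τ in (0 : ℝ)..t, f (projUnit τ, b, u (b, x) (projUnit τ)) := fun b hb x =>
    (hu' b hb x _).2 rfl
  have hweq : ∀ b ∈ Metric.ball (0 : B) δ, ∀ x t, w (b, x) t =
      x + ∫ τ in (1 : ℝ)..t, f (projUnit τ, b, w (b, x) (projUnit τ)) := fun b hb x =>
    (hw' b hb x _).2 rfl
  -- The curve with direction `c b` is the curve with direction `b` run at speed `c`. Thus the
  -- endpoint map `s` records every curve along the ray, and its radial derivative can be read off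
  -- from the equation.
  have hscale : ∀ b ∈ Metric.ball (0 : B) δ, ∀ x, ∀ c : unitInterval,
      u ((c : ℝ) • b, x) 1 = u (b, x) c := by
    intro b hb x c
    have hcb : (c : ℝ) • b ∈ Metric.ball (0 : B) δ := by
      rw [mem_ball_zero_iff] at hb ⊢
      rw [norm_smul, Real.norm_eq_abs, abs_of_nonneg c.2.1]
      exact (mul_le_of_le_one_left (norm_nonneg _) c.2.2).trans_lt hb
    let v : C(unitInterval, E) := ⟨fun t => u (b, x) (c * t), by fun_prop⟩
    have hv : v = u ((c : ℝ) • b, x) := by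
      refine (hu' _ hcb x v).1 fun t => ?_
      have h1 := hueq b hb x (c * t)
      have h2 := intervalIntegral.smul_integral_comp_mul_left (a := 0) (b := (t : ℝ))
        (fun τ => f (projUnit τ, b, u (b, x) (projUnit τ))) (c : ℝ)
      rw [mul_zero] at h2
      change u (b, x) (c * t) = _
      rw [h1]
      congr 1
      rw [show ((c * t : unitInterval) : ℝ) = (c : ℝ) * t from rfl, ← h2,
        ← intervalIntegral.integral_smul]
      refine intervalIntegral.integral_congr fun τ hτ => ?_
      have hτ' : τ ∈ Icc (0 : ℝ) 1 := by
        rw [uIcc_of_le t.2.1] at hτ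
        exact ⟨hτ.1, hτ.2.trans t.2.2⟩
      have e1 : projUnit τ = ⟨τ, hτ'⟩ := projIcc_of_mem _ hτ'
      have hcτ : (c : ℝ) * τ ∈ Icc (0 : ℝ) 1 := (c * ⟨τ, hτ'⟩ : unitInterval).2
      have e2 : projUnit ((c : ℝ) * τ) = c * ⟨τ, hτ'⟩ := projIcc_of_mem _ hcτ
      simp only [e1, e2, f, v, ContinuousMap.coe_mk, map_smul, smul_smul]
      rw [mul_comm τ]
      rfl
    rw [← hv]
    simp [v]
  have hev : ∀ t : unitInterval, ContDiff ℝ ∞ fun v : C(unitInterval, E) => v t := fun t =>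
    (ContinuousMap.evalCLM ℝ t : C(unitInterval, E) →L[ℝ] E).contDiff
  have hs : ∀ p ∈ Metric.ball (0 : B) δ ×ˢ univ, ContDiffAt ℝ ∞ (fun p : B × E => u p 1) p :=
    fun p hp => (hev 1).contDiffAt.comp p (hu p hp)
  -- Forward transport is the value at time `1` of the curve prescribed at time `0`, and backward
  -- transport the value at time `0` of the curve prescribed at time `1`. Uniqueness makes them
  -- inverse to each other.
  refine ⟨δ, hδ, fun p => u p 1, fun p => w p 0, hs,
    fun p hp => (hev 0).contDiffAt.comp p (hw p hp), fun b hb x => ⟨?_, ?_⟩, fun x => ?_, ?_⟩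
  · have : u (b, x) = w (b, u (b, x) 1) := by
      refine (hw' b hb _ _).1 fun t => ?_
      rw [hueq b hb x t, hueq b hb x 1, add_assoc,
        intervalIntegral.integral_add_adjacent_intervals (hint _ _ _ _) (hint _ _ _ _)]
    change w (b, u (b, x) 1) 0 = x
    rw [← this, hueq b hb x 0]
    simp
  · have : w (b, x) = u (b, w (b, x) 0) := by
      refine (hu' b hb _ _).1 fun t => ?_
      rw [hweq b hb x t, hweq b hb x 0, add_assoc,
        intervalIntegral.integral_add_adjacent_intervals (hint _ _ _ _) (hint _ _ _ _)]
    change u (b, w (b, x) 0) 1 = x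
    rw [← this, hweq b hb x 1]
    simp
  · change u (0, x) 1 = x
    rw [hueq 0 (Metric.mem_ball_self hδ) x 1]
    simp [f]
  · intro b hb x t ht
    have htb : t • b ∈ Metric.ball (0 : B) δ := by
      rw [mem_ball_zero_iff] at hb ⊢
      rw [norm_smul, Real.norm_eq_abs, abs_of_nonneg ht.1]
      exact (mul_le_of_le_one_left (norm_nonneg _) ht.2).trans_lt hb
    have hd : HasFDerivAt (fun b' => u (b', x) 1) (fderiv ℝ (fun b' => u (b', x) 1) (t • b))
        (t • b) := by
      have h1 : DifferentiableAt ℝ (fun p : B × E => u p 1) (t • b, x) :=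
        (hs (t • b, x) ⟨htb, mem_univ _⟩).differentiableAt (by simp)
      have h2 : DifferentiableAt ℝ (fun b' : B => (b', x)) (t • b) := by fun_prop
      exact (DifferentiableAt.comp (g := fun p : B × E => u p 1) (t • b) h1 h2).hasFDerivAt
    -- The radial derivative is computed twice, by the chain rule and by the integral equation,
    -- within `[0, 1]`: the curve is only defined there.
    have h2 : HasDerivWithinAt (fun r : ℝ => u (r • b, x) 1)
        (fderiv ℝ (fun b' => u (b', x) 1) (t • b) b) (Icc 0 1) t := by
      have h3 : HasDerivAt (fun r : ℝ => r • b) b t := by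
        simpa using (hasDerivAt_id t).smul_const b
      exact (hd.comp_hasDerivAt t h3).hasDerivWithinAt
    have h4 : HasDerivWithinAt (fun r : ℝ => u (r • b, x) 1)
        (G (t • b, u (t • b, x) 1) b) (Icc 0 1) t := by
      have h5 : HasDerivAt (fun r : ℝ => x + ∫ τ in (0 : ℝ)..r,
          f (projUnit τ, b, u (b, x) (projUnit τ)))
          (f (projUnit t, b, u (b, x) (projUnit t))) t :=
        (intervalIntegral.integral_hasDerivAt_right (hint _ _ _ _)
          (hcont b (u (b, x))).aestronglyMeasurable.stronglyMeasurableAtFilter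
          (hcont b (u (b, x))).continuousAt).const_add x
      have e1 : projUnit t = ⟨t, ht⟩ := projIcc_of_mem _ ht
      have e2 : f (projUnit t, b, u (b, x) (projUnit t)) = G (t • b, u (t • b, x) 1) b := by
        rw [e1, ← hscale b hb x ⟨t, ht⟩]
      rw [← e2]
      refine h5.hasDerivWithinAt.congr (fun r hr => ?_) ?_
      · rw [← hueq b hb x ⟨r, hr⟩]; exact hscale b hb x ⟨r, hr⟩
      · rw [← hueq b hb x ⟨t, ht⟩]; exact hscale b hb x ⟨t, ht⟩
    exact (uniqueDiffOn_Icc_zero_one t ht).eq_deriv _ h2 h4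

end ODE

/-! ### Maps into the sphere and radial projection -/

section SphereValued

/-- Smoothness can be tested in `ℝ³`, because stereographic projection is the restriction of a map
smooth on an open subset of `ℝ³`. -/
lemma contMDiffAt_S2_iff {E H X : Type*} [NormedAddCommGroup E] [NormedSpace ℝ E]
    [TopologicalSpace H] {J : ModelWithCorners ℝ E H} [TopologicalSpace X] [ChartedSpace H X]
    {f : X → S2} {x : X} :
    ContMDiffAt J (𝓡 2) ∞ f x ↔
      ContMDiffAt J 𝓘(ℝ, EuclideanSpace ℝ (Fin 3)) ∞ (fun z => (f z : EuclideanSpace ℝ (Fin 3))) x := by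
  have := finrank_euclideanSpace_three
  refine ⟨fun h => contMDiff_coe_S2.contMDiffAt.comp x h, fun hf => ?_⟩
  rw [contMDiffAt_iff_target]
  refine ⟨Topology.IsInducing.subtypeVal.continuousAt_iff.2 hf.continuousAt, ?_⟩
  set v := f x
  let U : _ ≃ₗᵢ[ℝ] _ :=
    (OrthonormalBasis.fromOrthogonalSpanSingleton
        2 (ne_zero_of_mem_unit_sphere (-v))).repr
  have h : ContDiffOn ℝ ω _ Set.univ := U.contDiff.contDiffOn
  have H₁ := (h.comp_inter contDiffOn_stereoToFun).contMDiffOn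
  have hopen : IsOpen ({x : EuclideanSpace ℝ (Fin 3) |
      innerSL ℝ ((-v : S2) : EuclideanSpace ℝ (Fin 3)) x ≠ 1} ∩
      stereoToFun ((-v : S2) : EuclideanSpace ℝ (Fin 3)) ⁻¹' univ) := by
    rw [preimage_univ, inter_univ]
    exact isOpen_ne.preimage (ContinuousLinearMap.continuous _)
  have hmem : ((f x : S2) : EuclideanSpace ℝ (Fin 3)) ∈
      ({x : EuclideanSpace ℝ (Fin 3) | innerSL ℝ ((-v : S2) : EuclideanSpace ℝ (Fin 3)) x ≠ 1} ∩
      stereoToFun ((-v : S2) : EuclideanSpace ℝ (Fin 3)) ⁻¹' univ) := by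
    refine ⟨?_, mem_univ _⟩
    simp [v]
    norm_num
  have H₂ := ContMDiffAt.comp x ((H₁.of_le le_top).contMDiffAt (hopen.mem_nhds hmem)) hf
  convert! H₂ using 1

/-- The unit vector in the direction of `y` (and some unit vector if `y = 0`). -/
def unitVec (y : EuclideanSpace ℝ (Fin 3)) : S2 :=
  if h : y = 0 then ⟨EuclideanSpace.single 0 1, by simp⟩
  else ⟨‖y‖⁻¹ • y, by simp [norm_smul, h]⟩

lemma coe_unitVec {y : EuclideanSpace ℝ (Fin 3)} (h : y ≠ 0) :
    (unitVec y : EuclideanSpace ℝ (Fin 3)) = ‖y‖⁻¹ • y := by simp [unitVec, h]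

lemma norm_smul_unitVec (y : EuclideanSpace ℝ (Fin 3)) :
    ‖y‖ • (unitVec y : EuclideanSpace ℝ (Fin 3)) = y := by
  by_cases h : y = 0
  · simp [h]
  · simp [coe_unitVec h, smul_smul, h]

lemma unitVec_smul_coe {c : ℝ} (hc : 0 < c) (x : S2) :
    unitVec (c • (x : EuclideanSpace ℝ (Fin 3))) = x := by
  have hx : ‖(x : EuclideanSpace ℝ (Fin 3))‖ = 1 := by simp
  have h0 : c • (x : EuclideanSpace ℝ (Fin 3)) ≠ 0 := by
    rw [← norm_ne_zero_iff, norm_smul, hx]; simp [hc.ne']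
  apply Subtype.ext
  rw [coe_unitVec h0, norm_smul, hx, smul_smul]
  simp [abs_of_pos hc, hc.ne']

lemma contMDiffAt_unitVec {y : EuclideanSpace ℝ (Fin 3)} (h : y ≠ 0) :
    ContMDiffAt 𝓘(ℝ, EuclideanSpace ℝ (Fin 3)) (𝓡 2) ∞ unitVec y := by
  rw [contMDiffAt_S2_iff, contMDiffAt_iff_contDiffAt]
  have h1 : ContDiffAt ℝ ∞ (fun y : EuclideanSpace ℝ (Fin 3) => ‖y‖⁻¹ • y) y :=
    ((contDiffAt_norm ℝ h).inv (norm_ne_zero_iff.2 h)).smul contDiffAt_id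
  refine h1.congr_of_eventuallyEq ?_
  filter_upwards [isOpen_ne.mem_nhds h] with z hz
  exact coe_unitVec hz

lemma chartAt_S2_self (q : S2) : chartAt (EuclideanSpace ℝ (Fin 2)) q q = 0 := by
  have := finrank_euclideanSpace_three
  change (OrthonormalBasis.fromOrthogonalSpanSingleton 2
    (ne_zero_of_mem_unit_sphere (-q))).repr (stereographic (norm_eq_of_mem_sphere (-q)) q) = 0
  rw [stereographic_neg_apply, map_zero]

end SphereValued

/-! ### Coefficients of a pulled back metric -/

section Metric

variable {Z : Type*} [NormedAddCommGroup Z] [NormedSpace ℝ Z]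
  {M : Type*} [TopologicalSpace M] [ChartedSpace (EuclideanSpace ℝ (Fin 4)) M]
  [IsManifold (𝓡 4) ∞ M]

/-- The map `P` need not be an immersion; the cone parametrization, to which this is applied,
collapses rays. -/
lemma contDiffAt_metric_mfderiv (g : SmoothMetric 4 M) {P : Z → M} {q : Z}
    (hP : ContMDiffAt 𝓘(ℝ, Z) (𝓡 4) ∞ P q) (v w : Z) :
    ContDiffAt ℝ ∞ (fun z => g.inner (P z) (mfderiv 𝓘(ℝ, Z) (𝓡 4) P z v)
      (mfderiv 𝓘(ℝ, Z) (𝓡 4) P z w)) q := by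
  have hsec : ∀ v : Z, ContMDiffAt 𝓘(ℝ, Z) ((𝓡 4).prod 𝓘(ℝ, EuclideanSpace ℝ (Fin 4))) ∞
      (fun z => (⟨P z, mfderiv 𝓘(ℝ, Z) (𝓡 4) P z v⟩ : TangentBundle (𝓡 4) M)) q := by
    intro v
    have h1 := ContMDiffAt.mfderiv_const (m := ∞) hP (by simp)
    have h2 : ContMDiffAt 𝓘(ℝ, Z) (𝓘(ℝ, Z).prod 𝓘(ℝ, Z)) ∞
        (fun z => (⟨z, v⟩ : TangentBundle 𝓘(ℝ, Z) Z)) q :=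
      contMDiffAt_vectorSpace_iff_contDiffAt.2 contDiffAt_const
    exact ContMDiffAt.clm_apply_of_inCoordinates h1 h2 hP
  have hg : ContMDiffAt 𝓘(ℝ, Z) ((𝓡 4).prod 𝓘(ℝ, EuclideanSpace ℝ (Fin 4) →L[ℝ]
      EuclideanSpace ℝ (Fin 4) →L[ℝ] ℝ)) ∞
      (fun z => Bundle.TotalSpace.mk' (EuclideanSpace ℝ (Fin 4) →L[ℝ]
        EuclideanSpace ℝ (Fin 4) →L[ℝ] ℝ) (E := fun x : M => TangentSpace (𝓡 4) x →L[ℝ]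
        TangentSpace (𝓡 4) x →L[ℝ] ℝ) (P z) (g.inner (P z))) q :=
    ContMDiffAt.comp q g.contMDiff.contMDiffAt hP
  have : ContMDiffAt 𝓘(ℝ, Z) ((𝓡 4).prod 𝓘(ℝ)) ∞
      (fun z => Bundle.TotalSpace.mk' ℝ (E := Bundle.Trivial M ℝ) (P z)
        (g.inner (P z) (mfderiv 𝓘(ℝ, Z) (𝓡 4) P z v) (mfderiv 𝓘(ℝ, Z) (𝓡 4) P z w))) q := by
    apply ContMDiffAt.clm_bundle_apply₂ (F₁ := EuclideanSpace ℝ (Fin 4))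
      (F₂ := EuclideanSpace ℝ (Fin 4))
    · exact hg
    · exact hsec v
    · exact hsec w
  simp only [Bundle.contMDiffAt_totalSpace] at this
  exact this.2.contDiffAt

end Metric

/-! ### Fibers thickened to punctured three-space -/

section Cone

variable {M : Type*} [TopologicalSpace M] [ChartedSpace (EuclideanSpace ℝ (Fin 4)) M]

/-- `P` parametrizes the part of `M` over a disc by a disc times the punctured space, in such a way
that `S (P (b, y)) = y / ‖y‖`. -/
structure IsConeParam (π : M → S2) (q : S2) (r : ℝ)
    (P : EuclideanSpace ℝ (Fin 2) × EuclideanSpace ℝ (Fin 3) → M) (S : M → S2) : Prop where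
  contMDiffAt : ∀ b ∈ Metric.ball 0 r, ∀ y ≠ 0, ContMDiffAt
    𝓘(ℝ, EuclideanSpace ℝ (Fin 2) × EuclideanSpace ℝ (Fin 3)) (𝓡 4) ∞ P (b, y)
  contMDiffAt_snd : ∀ m, π m ∈ stereoSet q (Metric.ball 0 r) → ContMDiffAt (𝓡 4) (𝓡 2) ∞ S m
  proj : ∀ b ∈ Metric.ball 0 r, ∀ y, π (P (b, y)) = stereoParam q b
  snd : ∀ b ∈ Metric.ball 0 r, ∀ y, S (P (b, y)) = unitVec y
  total : ∀ m, π m ∈ stereoSet q (Metric.ball 0 r) → ∀ c > (0 : ℝ),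
    P (chartAt (EuclideanSpace ℝ (Fin 2)) q (π m), c • (S m : EuclideanSpace ℝ (Fin 3))) = m

variable {π : M → S2}

lemma IsSphereBundle.exists_isConeParam (h : IsSphereBundle π) (q : S2) :
    ∃ r > 0, ∃ P S, IsConeParam π q r P S := by
  obtain ⟨U, hU, hq, T, S, hT⟩ := h.exists_isTrivOn q
  have hcont : Continuous (stereoParam q) := (contMDiff_stereoParam q).continuous
  have h0 : stereoParam q 0 = q := by
    rw [← chartAt_S2_self q]
    exact stereoParam_chartAt (mem_chart_source _ q)
  obtain ⟨r, hr, hrU⟩ := Metric.isOpen_iff.1 (hU.preimage hcont) 0 (by simpa [h0] using hq)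
  have hsub : stereoSet q (Metric.ball 0 r) ⊆ U := by
    rw [stereoSet_eq_image]
    rintro _ ⟨y, hy, rfl⟩
    exact hrU hy
  refine ⟨r, hr, fun p => T (stereoParam q p.1, unitVec p.2), S, ?_, ?_, ?_, ?_, ?_⟩
  · intro b hb y hy
    have h1 : ContMDiffAt ((𝓡 2).prod (𝓡 2)) (𝓡 4) ∞ T (stereoParam q b, unitVec y) :=
      hT.contMDiffOn.contMDiffAt ((hU.prod isOpen_univ).mem_nhds ⟨hrU hb, mem_univ _⟩)
    refine ContMDiffAt.comp (b, y) (g := T)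
      (f := fun p : EuclideanSpace ℝ (Fin 2) × EuclideanSpace ℝ (Fin 3) =>
        (stereoParam q p.1, unitVec p.2)) h1 ?_
    refine ContMDiffAt.prodMk ?_ ?_
    · exact ContMDiffAt.comp (b, y) (contMDiff_stereoParam q).contMDiffAt
        (contDiff_fst.contMDiff.contMDiffAt)
    · exact ContMDiffAt.comp (b, y) (contMDiffAt_unitVec hy)
        (contDiff_snd.contMDiff.contMDiffAt)
  · intro m hm
    exact hT.smooth_snd.contMDiffAt ((hU.preimage h.contMDiff.continuous).mem_nhds (hsub hm))
  · intro b hb y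
    exact hT.proj _ (hrU hb) _
  · intro b hb y
    exact hT.snd _ (hrU hb) _
  · intro m hm c hc
    change T (stereoParam q (chartAt _ q (π m)), unitVec (c • (S m : EuclideanSpace ℝ (Fin 3)))) = m
    rw [stereoParam_chartAt hm.1, unitVec_smul_coe hc, hT.total m (hsub hm)]

/-- The derivative of a parametrization, between the model spaces. -/
def paramDeriv {Z : Type*} [NormedAddCommGroup Z] [NormedSpace ℝ Z] (P : Z → M) (p : Z) :
    Z →L[ℝ] EuclideanSpace ℝ (Fin 4) :=
  mfderiv 𝓘(ℝ, Z) (𝓡 4) P p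

variable {q : S2} {r : ℝ} {P : EuclideanSpace ℝ (Fin 2) × EuclideanSpace ℝ (Fin 3) → M} {S : M → S2}

lemma IsConeParam.mdifferentiableAt (hP : IsConeParam π q r P S) {b : EuclideanSpace ℝ (Fin 2)}
    (hb : b ∈ Metric.ball 0 r) {y : EuclideanSpace ℝ (Fin 3)} (hy : y ≠ 0) :
    MDifferentiableAt 𝓘(ℝ, EuclideanSpace ℝ (Fin 2) × EuclideanSpace ℝ (Fin 3)) (𝓡 4) P (b, y) :=
  (hP.contMDiffAt b hb y hy).mdifferentiableAt (by simp)

/-- The parametrization is constant along rays `t ↦ (b, t y)` with `t > 0`. -/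
lemma IsConeParam.paramDeriv_radial (hP : IsConeParam π q r P S)
    {b : EuclideanSpace ℝ (Fin 2)} (hb : b ∈ Metric.ball 0 r) {y : EuclideanSpace ℝ (Fin 3)}
    (hy : y ≠ 0) : paramDeriv P (b, y) (0, y) = 0 := by
  have h2 : HasMFDerivAt 𝓘(ℝ, ℝ) 𝓘(ℝ, EuclideanSpace ℝ (Fin 2) × EuclideanSpace ℝ (Fin 3))
      (fun t : ℝ => (b, t • y)) 1 (ContinuousLinearMap.toSpanSingleton ℝ ((0 : EuclideanSpace ℝ (Fin 2)), y)) := by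
    have h3 : HasDerivAt (fun t : ℝ => t • y) y 1 := by
      simpa using (hasDerivAt_id (1 : ℝ)).smul_const y
    exact ((hasDerivAt_const (1 : ℝ) b).prodMk h3).hasFDerivAt.hasMFDerivAt
  have h1 : HasMFDerivAt 𝓘(ℝ, EuclideanSpace ℝ (Fin 2) × EuclideanSpace ℝ (Fin 3)) (𝓡 4) P
      (b, (1 : ℝ) • y) (paramDeriv P (b, (1 : ℝ) • y)) :=
    (hP.mdifferentiableAt hb (by simpa using hy)).hasMFDerivAt
  have h3 := HasMFDerivAt.comp (1 : ℝ) h1 h2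
  have h4 : (fun _ => P (b, y)) =ᶠ[𝓝 1] P ∘ (fun t : ℝ => (b, t • y)) := by
    filter_upwards [lt_mem_nhds one_pos] with t ht
    have hπ : π (P (b, y)) = stereoParam q b := hP.proj b hb y
    have := hP.total (P (b, y)) (by rw [hπ]; exact (stereoParam_mem_stereoSet q).2 hb)
      (t * ‖y‖) (mul_pos ht (norm_pos_iff.2 hy))
    rw [hπ, chartAt_stereoParam, hP.snd b hb, mul_smul, norm_smul_unitVec] at this
    exact this.symm
  have h5 := hasMFDerivAt_unique (h3.congr_of_eventuallyEq h4) (hasMFDerivAt_const _ _)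
  have h6 := DFunLike.congr_fun h5 (1 : ℝ)
  have h7 : paramDeriv P (b, (1 : ℝ) • y) ((1 : ℝ) • ((0 : EuclideanSpace ℝ (Fin 2)), y)) = 0 := h6
  simpa using h7

/-- Applying `S` shows that the derivative of `unitVec` at `y` kills `w`. Differentiating `z = ‖z‖ •
unitVec z` in the direction `w` then leaves only a multiple of `unitVec y`. -/
lemma IsConeParam.exists_smul_of_paramDeriv_eq_zero (hP : IsConeParam π q r P S)
    {b : EuclideanSpace ℝ (Fin 2)} (hb : b ∈ Metric.ball 0 r) {y w : EuclideanSpace ℝ (Fin 3)}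
    (hy : y ≠ 0) (hw : paramDeriv P (b, y) (0, w) = 0) : ∃ c : ℝ, w = c • y := by
  have hm : π (P (b, y)) ∈ stereoSet q (Metric.ball 0 r) := by
    rw [hP.proj b hb]; exact (stereoParam_mem_stereoSet q).2 hb
  have h0 : MDifferentiableAt (𝓡 4) 𝓘(ℝ, EuclideanSpace ℝ (Fin 3))
      (fun m => (S m : EuclideanSpace ℝ (Fin 3))) (P (b, y)) :=
    (contMDiffAt_S2_iff.1 (hP.contMDiffAt_snd _ hm)).mdifferentiableAt (by simp)
  have h1 : HasMFDerivAt 𝓘(ℝ, EuclideanSpace ℝ (Fin 2) × EuclideanSpace ℝ (Fin 3)) (𝓡 4) P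
      (b, y) (paramDeriv P (b, y)) := (hP.mdifferentiableAt hb hy).hasMFDerivAt
  have h2 : HasMFDerivAt 𝓘(ℝ, EuclideanSpace ℝ (Fin 3))
      𝓘(ℝ, EuclideanSpace ℝ (Fin 2) × EuclideanSpace ℝ (Fin 3))
      (fun z : EuclideanSpace ℝ (Fin 3) => (b, z)) y (ContinuousLinearMap.inr ℝ _ _) :=
    (hasFDerivAt_prodMk_right b y).hasMFDerivAt
  have h3 := HasMFDerivAt.comp y h0.hasMFDerivAt (HasMFDerivAt.comp y h1 h2)
  have h4 : HasFDerivAt (fun z => (unitVec z : EuclideanSpace ℝ (Fin 3)))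
      (fderiv ℝ (fun z => (unitVec z : EuclideanSpace ℝ (Fin 3))) y) y := by
    have := contMDiffAt_S2_iff.1 (contMDiffAt_unitVec hy)
    exact (this.contDiffAt.differentiableAt (by simp)).hasFDerivAt
  have h5 : (fun m => (S m : EuclideanSpace ℝ (Fin 3))) ∘ P ∘
      (fun z : EuclideanSpace ℝ (Fin 3) => (b, z)) = fun z => (unitVec z : EuclideanSpace ℝ (Fin 3)) := by
    funext z
    exact congrArg _ (hP.snd b hb z)
  rw [h5] at h3
  have h6 : fderiv ℝ (fun z => (unitVec z : EuclideanSpace ℝ (Fin 3))) y w = 0 := by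
    have h7 := DFunLike.congr_fun (hasMFDerivAt_unique h4.hasMFDerivAt h3) w
    refine h7.trans ?_
    change mfderiv (𝓡 4) 𝓘(ℝ, EuclideanSpace ℝ (Fin 3)) (fun m => (S m : EuclideanSpace ℝ (Fin 3)))
      (P (b, y)) (paramDeriv P (b, y) (0, w)) = 0
    rw [hw]
    exact map_zero _
  have hn : HasFDerivAt (fun z : EuclideanSpace ℝ (Fin 3) => ‖z‖)
      (fderiv ℝ (fun z : EuclideanSpace ℝ (Fin 3) => ‖z‖) y) y :=
    ((contDiffAt_norm ℝ hy (n := 1)).differentiableAt (by simp)).hasFDerivAt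
  have h8 := hn.smul h4
  have h9 : (fun z : EuclideanSpace ℝ (Fin 3) => ‖z‖ • (unitVec z : EuclideanSpace ℝ (Fin 3))) =
    fun z => z := by funext z; exact norm_smul_unitVec z
  have h10 := DFunLike.congr_fun ((h8.congr_of_eventuallyEq (Eq.eventuallyEq h9.symm)).unique
    (hasFDerivAt_id y)) w
  simp only [_root_.add_apply, _root_.smul_apply, h6, smul_zero, zero_add,
    ContinuousLinearMap.smulRight_apply, ContinuousLinearMap.id_apply, coe_unitVec hy, smul_smul]
    at h10
  exact ⟨_, h10.symm⟩

/-- The map `m ↦ (φ (π m), ‖y‖ • S m)` is a local right inverse of `P` through `(b, y)`, with `φ`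
the chart around `q`. It sends a vertical vector to one without base component. -/
lemma IsConeParam.exists_paramDeriv_eq (hP : IsConeParam π q r P S)
    (hπ : ContMDiff (𝓡 4) (𝓡 2) ∞ π)
    {b : EuclideanSpace ℝ (Fin 2)} (hb : b ∈ Metric.ball 0 r) {y : EuclideanSpace ℝ (Fin 3)}
    (hy : y ≠ 0) {v : EuclideanSpace ℝ (Fin 4)}
    (hv : mfderiv (𝓡 4) (𝓡 2) π (P (b, y)) v = 0) : ∃ w, paramDeriv P (b, y) (0, w) = v := by
  have hπm : π (P (b, y)) = stereoParam q b := hP.proj b hb y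
  have hm : π (P (b, y)) ∈ stereoSet q (Metric.ball 0 r) := by
    rw [hπm]; exact (stereoParam_mem_stereoSet q).2 hb
  let f₁ : M → EuclideanSpace ℝ (Fin 2) := fun m => chartAt (EuclideanSpace ℝ (Fin 2)) q (π m)
  let f₂ : M → EuclideanSpace ℝ (Fin 3) := fun m => ‖y‖ • (S m : EuclideanSpace ℝ (Fin 3))
  have hc : MDifferentiableAt (𝓡 2) (𝓡 2) (chartAt (EuclideanSpace ℝ (Fin 2)) q) (π (P (b, y))) :=
    ((contMDiffOn_chartAt_S2 q).contMDiffAt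
      ((chartAt _ q).open_source.mem_nhds hm.1)).mdifferentiableAt (by simp)
  have hf₁ : HasMFDerivAt (𝓡 4) (𝓡 2) f₁ (P (b, y)) _ :=
    hc.hasMFDerivAt.comp _ (hπ.mdifferentiable (by simp) _).hasMFDerivAt
  have h0 : ContMDiffAt (𝓡 4) 𝓘(ℝ, EuclideanSpace ℝ (Fin 3)) ∞
      (fun m => (S m : EuclideanSpace ℝ (Fin 3))) (P (b, y)) :=
    contMDiffAt_S2_iff.1 (hP.contMDiffAt_snd _ hm)
  have hc' : ContMDiffAt (𝓡 4) (𝓡 2) ∞ f₁ (P (b, y)) :=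
    ((contMDiffOn_chartAt_S2 q).contMDiffAt ((chartAt _ q).open_source.mem_nhds hm.1)).comp _
      hπ.contMDiffAt
  have hf₂ : ContMDiffAt (𝓡 4) 𝓘(ℝ, EuclideanSpace ℝ (Fin 3)) ∞ f₂ (P (b, y)) :=
    ContMDiffAt.comp (P (b, y)) (contDiff_const_smul (‖y‖ : ℝ)).contMDiff.contMDiffAt h0
  have hH := ((hc'.prodMk_space hf₂).mdifferentiableAt (by simp)).hasMFDerivAt
  have hfst : HasMFDerivAt 𝓘(ℝ, EuclideanSpace ℝ (Fin 2) × EuclideanSpace ℝ (Fin 3)) (𝓡 2) Prod.fst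
      (f₁ (P (b, y)), f₂ (P (b, y)))
      (ContinuousLinearMap.fst ℝ (EuclideanSpace ℝ (Fin 2)) (EuclideanSpace ℝ (Fin 3))) :=
    hasFDerivAt_fst.hasMFDerivAt
  have hH₁ := hasMFDerivAt_unique (HasMFDerivAt.comp (P (b, y)) hfst hH) hf₁
  have hHq : (f₁ (P (b, y)), f₂ (P (b, y))) = (b, y) := by
    simp only [f₁, f₂, hπm, chartAt_stereoParam, hP.snd b hb, norm_smul_unitVec]
  have h1 : HasMFDerivAt 𝓘(ℝ, EuclideanSpace ℝ (Fin 2) × EuclideanSpace ℝ (Fin 3)) (𝓡 4) P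
      (f₁ (P (b, y)), f₂ (P (b, y))) (paramDeriv P (f₁ (P (b, y)), f₂ (P (b, y)))) := by
    rw [hHq]
    exact (hP.mdifferentiableAt hb hy).hasMFDerivAt
  have h2 := HasMFDerivAt.comp (P (b, y)) h1 hH
  have h3 : (fun m => m) =ᶠ[𝓝 (P (b, y))] P ∘ fun m => (f₁ m, f₂ m) := by
    filter_upwards [((isOpen_stereoSet q Metric.isOpen_ball).preimage hπ.continuous).mem_nhds hm]
      with m hm
    exact (hP.total m hm _ (norm_pos_iff.2 hy)).symm
  have h4 := DFunLike.congr_fun (hasMFDerivAt_unique (h2.congr_of_eventuallyEq h3)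
    (hasMFDerivAt_id _)) v
  let u : EuclideanSpace ℝ (Fin 2) × EuclideanSpace ℝ (Fin 3) :=
    mfderiv (𝓡 4) 𝓘(ℝ, EuclideanSpace ℝ (Fin 2) × EuclideanSpace ℝ (Fin 3))
      (fun m => (f₁ m, f₂ m)) (P (b, y)) v
  have hu : u.1 = 0 := by
    refine (DFunLike.congr_fun hH₁ v).trans ?_
    change mfderiv (𝓡 2) (𝓡 2) (chartAt (EuclideanSpace ℝ (Fin 2)) q) (π (P (b, y)))
      (mfderiv (𝓡 4) (𝓡 2) π (P (b, y)) v) = 0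
    rw [hv]
    exact map_zero _
  refine ⟨u.2, ?_⟩
  rw [← hHq, ← hu]
  exact h4

end Cone

/-! ### The orthogonal connection on the thickened bundle -/

section Connection

lemma isInvertible_of_posDef {E : Type*} [NormedAddCommGroup E] [InnerProductSpace ℝ E]
    [FiniteDimensional ℝ E] {L : E →L[ℝ] E →L[ℝ] ℝ} (hL : ∀ w, L w w = 0 → w = 0) :
    L.IsInvertible := by
  have hinj : Function.Injective (L : E →ₗ[ℝ] E →L[ℝ] ℝ) := by
    rw [← LinearMap.ker_eq_bot, LinearMap.ker_eq_bot']
    intro w hw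
    refine hL w ?_
    have : L w = 0 := hw
    rw [this]; rfl
  have : FiniteDimensional ℝ (E →L[ℝ] ℝ) := Module.Finite.equiv (InnerProductSpace.toDual ℝ E).toLinearEquiv
  have hdim : Module.finrank ℝ E = Module.finrank ℝ (E →L[ℝ] ℝ) :=
    (InnerProductSpace.toDual ℝ E).toLinearEquiv.finrank_eq
  exact ⟨((L : E →ₗ[ℝ] E →L[ℝ] ℝ).linearEquivOfInjective hinj hdim).toContinuousLinearEquiv, by
    ext; rfl⟩

variable {M : Type*} [TopologicalSpace M] [ChartedSpace (EuclideanSpace ℝ (Fin 4)) M]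
  [IsManifold (𝓡 4) ∞ M] {π : M → S2} {q : S2} {r : ℝ}
  {P : EuclideanSpace ℝ (Fin 2) × EuclideanSpace ℝ (Fin 3) → M} {S : M → S2}

/-- The pullback of the metric along a parametrization. -/
def pullbackMetric (g : SmoothMetric 4 M) {Z : Type*} [NormedAddCommGroup Z] [NormedSpace ℝ Z]
    (P : Z → M) (p : Z) : Z →L[ℝ] Z →L[ℝ] ℝ :=
  let G : EuclideanSpace ℝ (Fin 4) →L[ℝ] EuclideanSpace ℝ (Fin 4) →L[ℝ] ℝ := g.inner (P p)
  G.bilinearComp (paramDeriv P p) (paramDeriv P p)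

/-- There is a connection which is tangent to the spheres and whose horizontal lifts are orthogonal
to the fibers. -/
lemma IsConeParam.exists_connection (hP : IsConeParam π q r P S) (hπ : ContMDiff (𝓡 4) (𝓡 2) ∞ π)
    (g : SmoothMetric 4 M) :
    ∃ A : EuclideanSpace ℝ (Fin 2) × EuclideanSpace ℝ (Fin 3) →
        EuclideanSpace ℝ (Fin 2) →L[ℝ] EuclideanSpace ℝ (Fin 3),
      ∀ b ∈ Metric.ball 0 r, ∀ y ≠ 0, ContDiffAt ℝ ∞ A (b, y) ∧
        ∀ v, inner ℝ y (A (b, y) v) = 0 ∧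
          IsHorizontal g π (P (b, y)) (paramDeriv P (b, y) (v, A (b, y) v)) := by
  let B := pullbackMetric g P
  have hB : ∀ p v w, B p v w = g.inner (P p) (paramDeriv P p v) (paramDeriv P p w) :=
    fun _ _ _ => rfl
  let inr := ContinuousLinearMap.inr ℝ (EuclideanSpace ℝ (Fin 2)) (EuclideanSpace ℝ (Fin 3))
  let inl := ContinuousLinearMap.inl ℝ (EuclideanSpace ℝ (Fin 2)) (EuclideanSpace ℝ (Fin 3))
  -- The vertical block of the pulled back metric is degenerate exactly in the radial direction;
  -- adding the square of `⟨y, ·⟩` makes it positive definite. The connection is minus its inverse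
  -- applied to the mixed block `C`.
  let L : EuclideanSpace ℝ (Fin 2) × EuclideanSpace ℝ (Fin 3) →
      EuclideanSpace ℝ (Fin 3) →L[ℝ] EuclideanSpace ℝ (Fin 3) →L[ℝ] ℝ := fun p =>
    (B p).bilinearComp inr inr + (innerSL ℝ p.2).smulRight (innerSL ℝ p.2)
  let C : EuclideanSpace ℝ (Fin 2) × EuclideanSpace ℝ (Fin 3) →
      EuclideanSpace ℝ (Fin 2) →L[ℝ] EuclideanSpace ℝ (Fin 3) →L[ℝ] ℝ := fun p =>
    (B p).bilinearComp inl inr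
  let O : Set (EuclideanSpace ℝ (Fin 2) × EuclideanSpace ℝ (Fin 3)) := Metric.ball 0 r ×ˢ {0}ᶜ
  have hO : IsOpen O := Metric.isOpen_ball.prod isOpen_compl_singleton
  have hBs : ∀ v w, ContDiffOn ℝ ∞ (fun p => B p v w) O := fun v w p hp =>
    (contDiffAt_metric_mfderiv g (hP.contMDiffAt p.1 hp.1 p.2 hp.2) v w).contDiffWithinAt
  have hLs : ContDiffOn ℝ ∞ L O := by
    refine contDiffOn_clm_apply.2 fun w => contDiffOn_clm_apply.2 fun w' => ?_
    have h1 : ∀ w : EuclideanSpace ℝ (Fin 3), ContDiff ℝ ∞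
        (fun p : EuclideanSpace ℝ (Fin 2) × EuclideanSpace ℝ (Fin 3) => inner ℝ p.2 w) :=
      fun w => contDiff_snd.inner ℝ contDiff_const
    exact (hBs (inr w) (inr w')).add (((h1 w).mul (h1 w')).contDiffOn)
  have hCs : ContDiffOn ℝ ∞ C O :=
    contDiffOn_clm_apply.2 fun w => contDiffOn_clm_apply.2 fun w' => hBs (inl w) (inr w')
  refine ⟨fun p => -((L p).inverse ∘L C p), fun b hb y hy => ?_⟩
  have hmem : (b, y) ∈ O := ⟨hb, hy⟩
  have hinv : (L (b, y)).IsInvertible := by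
    refine isInvertible_of_posDef fun w hw => ?_
    have h1 : 0 ≤ B (b, y) (inr w) (inr w) := by
      rw [hB]
      by_cases h0 : paramDeriv P (b, y) (inr w) = 0
      · rw [h0]; exact (map_zero _).ge
      · exact (g.pos _ _ h0).le
    have h2 : B (b, y) (inr w) (inr w) + inner ℝ y w * inner ℝ y w = 0 := hw
    have h3 : inner ℝ y w = 0 := by nlinarith [mul_self_nonneg (inner ℝ y w)]
    have h4 : paramDeriv P (b, y) (0, w) = 0 := by
      by_contra h0
      have := g.pos (P (b, y)) _ h0
      rw [h3] at h2
      have h5 : B (b, y) (inr w) (inr w) =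
        g.inner (P (b, y)) (paramDeriv P (b, y) (0, w)) (paramDeriv P (b, y) (0, w)) := rfl
      linarith
    obtain ⟨c, rfl⟩ := hP.exists_smul_of_paramDeriv_eq_zero hb hy h4
    rw [inner_smul_right, real_inner_self_eq_norm_sq] at h3
    have h5 : c = 0 := by simpa [hy] using h3
    rw [h5, zero_smul]
  have hAL : ∀ v w, L (b, y) ((-((L (b, y)).inverse ∘L C (b, y))) v) w = -C (b, y) v w := by
    intro v w
    have : L (b, y) ((-((L (b, y)).inverse ∘L C (b, y))) v) = -C (b, y) v := by
      rw [neg_apply, map_neg, ContinuousLinearMap.comp_apply, hinv.self_apply_inverse]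
    rw [this]; rfl
  refine ⟨?_, fun v => ?_⟩
  · have h1 : ContDiffAt ℝ ∞ L (b, y) := hLs.contDiffAt (hO.mem_nhds hmem)
    have h2 : ContDiffAt ℝ ∞ C (b, y) := hCs.contDiffAt (hO.mem_nhds hmem)
    have h3 : ContDiffAt ℝ ∞ (fun p => (L p).inverse) (b, y) :=
      hinv.contDiffAt_map_inverse.comp (b, y) h1
    exact (h3.clm_comp h2).neg
  · set a := (-((L (b, y)).inverse ∘L C (b, y))) v
    have hA : ∀ w, B (b, y) (inr a) (inr w) + inner ℝ y a * inner ℝ y w =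
        -B (b, y) (inl v) (inr w) := fun w => hAL v w
    have hrad : ∀ u, B (b, y) u (inr y) = 0 := fun u => by
      rw [hB, show paramDeriv P (b, y) (inr y) = 0 from hP.paramDeriv_radial hb hy]
      exact map_zero _
    have hy2 : inner ℝ y y ≠ 0 := by simpa using hy
    -- Testing with `y` kills all metric terms, leaving `⟨y, a⟩ ‖y‖² = 0`. So the connection is
    -- tangent to the spheres, and the added term drops out of the orthogonality relation.
    have h0 : inner ℝ y a = 0 := by
      have := hA y
      rw [hrad, hrad, zero_add, neg_zero] at this
      exact (mul_eq_zero.1 this).resolve_right hy2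
    refine ⟨h0, fun u hu => ?_⟩
    obtain ⟨w, rfl⟩ := hP.exists_paramDeriv_eq hπ hb hy hu
    have h1 := hA w
    rw [h0, zero_mul, add_zero] at h1
    have h2 : (v, a) = inl v + inr a := by simp [inl, inr]
    change B (b, y) (v, a) (inr w) = 0
    rw [h2, map_add, _root_.add_apply, h1]
    ring

/-- The connection, cut off to a compactly supported one. -/
lemma IsConeParam.exists_cutoff_connection (hP : IsConeParam π q r P S)
    (hπ : ContMDiff (𝓡 4) (𝓡 2) ∞ π) (hr : 0 < r) (g : SmoothMetric 4 M) :
    ∃ (G : EuclideanSpace ℝ (Fin 2) × EuclideanSpace ℝ (Fin 3) →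
        EuclideanSpace ℝ (Fin 2) →L[ℝ] EuclideanSpace ℝ (Fin 3)) (K : NNReal),
      ContDiff ℝ ∞ G ∧ LipschitzWith K G ∧ (∀ p v, inner ℝ p.2 (G p v) = 0) ∧
      ∀ b ∈ Metric.ball 0 (r / 2), ∀ y, |‖y‖ ^ 2 - 1| < 1 / 2 → ∀ v,
          IsHorizontal g π (P (b, y)) (paramDeriv P (b, y) (v, G (b, y) v)) := by
  obtain ⟨A, hA⟩ := hP.exists_connection hπ g
  -- The cutoffs equal `1` where `‖b‖ ≤ r/2` and `|‖y‖² - 1| ≤ 1/2`, and vanish before `‖b‖ = r` and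
  -- `y = 0` are reached. Compact support gives a global Lipschitz constant, and scaling keeps the
  -- connection tangent to the spheres.
  let χ : ContDiffBump (0 : EuclideanSpace ℝ (Fin 2)) := ⟨r / 2, 3 * r / 4, by linarith, by linarith⟩
  let κ : ContDiffBump (1 : ℝ) := ⟨1 / 2, 3 / 4, by norm_num, by norm_num⟩
  let θ : EuclideanSpace ℝ (Fin 2) × EuclideanSpace ℝ (Fin 3) → ℝ := fun p =>
    χ p.1 * κ (‖p.2‖ ^ 2)
  have hθ : ContDiff ℝ ∞ θ :=
    (χ.contDiff.comp contDiff_fst).mul (κ.contDiff.comp (contDiff_snd.norm_sq ℝ))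
  have hθ₁ : ∀ p, 3 * r / 4 ≤ ‖p.1‖ → θ p = 0 := fun p hp => by
    simp only [θ]
    rw [χ.zero_of_le_dist (by simpa using hp), zero_mul]
  have hθ₂ : ∀ p, 3 / 4 ≤ |‖p.2‖ ^ 2 - 1| → θ p = 0 := fun p hp => by
    simp only [θ]
    rw [κ.zero_of_le_dist (by simpa [Real.dist_eq] using hp), mul_zero]
  let G : EuclideanSpace ℝ (Fin 2) × EuclideanSpace ℝ (Fin 3) →
        EuclideanSpace ℝ (Fin 2) →L[ℝ] EuclideanSpace ℝ (Fin 3) := fun p => θ p • A p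
  have hG0 : ∀ p, θ p = 0 → G p = 0 := fun p hp => by
    ext v : 1
    change θ p • A p v = 0
    rw [hp, zero_smul]
  have hne : ∀ y : EuclideanSpace ℝ (Fin 3), |‖y‖ ^ 2 - 1| < 1 → y ≠ 0 := by
    rintro _ h rfl
    simp at h
  have hG : ContDiff ℝ ∞ G := by
    rw [contDiff_iff_contDiffAt]
    rintro ⟨b, y⟩
    by_cases h1 : 3 * r / 4 < ‖b‖
    · refine (contDiffAt_const (c := (0 : EuclideanSpace ℝ (Fin 2) →L[ℝ] EuclideanSpace ℝ (Fin 3)))).congr_of_eventuallyEq ?_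
      filter_upwards [(isOpen_lt continuous_const (continuous_fst.norm)).mem_nhds
        (show (b, y) ∈ {p : EuclideanSpace ℝ (Fin 2) × EuclideanSpace ℝ (Fin 3) |
          3 * r / 4 < ‖p.1‖} from h1)] with p hp
      exact hG0 p (hθ₁ p (le_of_lt hp))
    by_cases h2 : 3 / 4 < |‖y‖ ^ 2 - 1|
    · refine (contDiffAt_const (c := (0 : EuclideanSpace ℝ (Fin 2) →L[ℝ] EuclideanSpace ℝ (Fin 3)))).congr_of_eventuallyEq ?_
      filter_upwards [(isOpen_lt continuous_const (by fun_prop)).mem_nhds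
        (show (b, y) ∈ {p : EuclideanSpace ℝ (Fin 2) × EuclideanSpace ℝ (Fin 3) |
          3 / 4 < |‖p.2‖ ^ 2 - 1|} from h2)] with p hp
      exact hG0 p (hθ₂ p (le_of_lt hp))
    · exact hθ.contDiffAt.smul (hA b (by rw [mem_ball_zero_iff]; linarith) y
        (hne y (by linarith))).1
  have hGc : HasCompactSupport G := by
    refine HasCompactSupport.intro ((isCompact_closedBall (0 : EuclideanSpace ℝ (Fin 2)) r).prod
      (isCompact_closedBall (0 : EuclideanSpace ℝ (Fin 3)) 2)) fun p hp => ?_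
    have : θ p = 0 := by
      by_cases h1 : 3 * r / 4 ≤ ‖p.1‖
      · exact hθ₁ p h1
      · refine hθ₂ p ?_
        by_contra h2
        refine hp ⟨by rw [mem_closedBall_zero_iff]; linarith, ?_⟩
        rw [mem_closedBall_zero_iff]
        rw [not_le, abs_lt] at h2
        nlinarith [norm_nonneg p.2]
    exact hG0 p (this)
  obtain ⟨K, hK⟩ := hG.lipschitzWith_of_hasCompactSupport hGc (by simp)
  refine ⟨G, K, hG, hK, fun p v => ?_, fun b hb y hy v => ?_⟩
  · by_cases h1 : 3 * r / 4 ≤ ‖p.1‖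
    · simp [G, hθ₁ p h1]
    by_cases h2 : 3 / 4 ≤ |‖p.2‖ ^ 2 - 1|
    · simp [G, hθ₂ p h2]
    · have := ((hA p.1 (by rw [mem_ball_zero_iff]; linarith) p.2 (hne _ (by linarith))).2 v).1
      simp only [G, _root_.smul_apply, inner_smul_right]
      rw [this, mul_zero]
  · have hb' : ‖b‖ < r / 2 := by simpa using hb
    have h1 : θ (b, y) = 1 := by
      simp only [θ]
      rw [χ.one_of_mem_closedBall (by rw [mem_closedBall_zero_iff]; exact hb'.le),
        κ.one_of_mem_closedBall (by rw [Metric.mem_closedBall, Real.dist_eq]; exact hy.le), one_mul]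
    have := ((hA b (by rw [mem_ball_zero_iff]; linarith) y (hne _ (by linarith))).2 v).2
    simpa only [G, h1, one_smul] using this

end Connection

/-! ### Invariance of closed forms and properties of radial transport -/

section Flatness

/-- Cartan's formula for the constant field `e`: its Lie derivative of `η` is `ι_e dη + d ι_e η`,
and both terms vanish. -/
lemma fderiv_apply_eq_zero_of_extDeriv_eq_zero {E : Type*} [NormedAddCommGroup E] [NormedSpace ℝ E]
    {η : E → E [⋀^Fin 2]→L[ℝ] ℝ} {p : E} (hη : DifferentiableAt ℝ η p) (hd : extDeriv η p = 0)
    {e : E} (he : ∀ᶠ z in 𝓝 p, ∀ u, η z ![e, u] = 0) (u v : E) :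
    fderiv ℝ (fun z => η z ![u, v]) p e = 0 := by
  have h := extDeriv_apply hη ![e, u, v]
  rw [hd] at h
  have h0 : ∀ u, fderiv ℝ (fun z => η z ![e, u]) p = 0 := fun u => by
    have : (fun z => η z ![e, u]) =ᶠ[𝓝 p] fun _ => 0 := he.mono fun z hz => hz u
    rw [this.fderiv_eq]
    simp
  have e0 : Fin.removeNth (0 : Fin 3) ![e, u, v] = ![u, v] := by
    ext i; fin_cases i <;> rfl
  have e1 : Fin.removeNth (1 : Fin 3) ![e, u, v] = ![e, v] := by
    ext i; fin_cases i <;> rfl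
  have e2 : Fin.removeNth (2 : Fin 3) ![e, u, v] = ![e, u] := by
    ext i; fin_cases i <;> rfl
  rw [Fin.sum_univ_three, e0, e1, e2, h0, h0] at h
  simpa using h.symm

section Transport

variable {B E : Type*} [NormedAddCommGroup B] [NormedSpace ℝ B] [NormedAddCommGroup E]
  {δ : ℝ} {s : B × E → E}

lemma isOpen_setOf_smul_mem_ball (b : B) (δ : ℝ) : IsOpen {t : ℝ | t • b ∈ Metric.ball 0 δ} :=
  Metric.isOpen_ball.preimage (by fun_prop)

lemma isPreconnected_setOf_smul_mem_ball (b : B) (δ : ℝ) :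
    IsPreconnected {t : ℝ | t • b ∈ Metric.ball 0 δ} :=
  (Convex.is_linear_preimage (convex_ball (0 : B) δ)
    (LinearMap.toSpanSingleton ℝ B b).isLinear).isPreconnected

/-- Homogeneity in the direction extends the transport equation to every `t • v` in the ball. For `t
≠ 0` it is used for `t • v` at time `1` and divided by `t`; for `t = 0` the vector `v` is first
shrunk into the ball. -/
lemma fderiv_radial [NormedSpace ℝ E] {G : B × E → B →L[ℝ] E}
    (hs : ∀ p ∈ Metric.ball 0 δ ×ˢ univ, ContDiffAt ℝ ∞ s p)
    (hG : ∀ b ∈ Metric.ball 0 δ, ∀ x, ∀ t ∈ Icc (0 : ℝ) 1,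
        fderiv ℝ (fun b' => s (b', x)) (t • b) b = G (t • b, s (t • b, x)) b)
    (v : B) (t : ℝ) (ht : t • v ∈ Metric.ball 0 δ) (x : E) :
    fderiv ℝ s (t • v, x) (v, 0) = G (t • v, s (t • v, x)) v := by
  have hpart : fderiv ℝ s (t • v, x) (v, 0) = fderiv ℝ (fun b' => s (b', x)) (t • v) v := by
    have h1 : HasFDerivAt s (fderiv ℝ s (t • v, x)) (t • v, x) :=
      ((hs (t • v, x) ⟨ht, mem_univ _⟩).differentiableAt (by simp)).hasFDerivAt
    have h2 := HasFDerivAt.comp (g := s) (f := fun b' => (b', x)) (t • v) h1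
      (hasFDerivAt_prodMk_left (𝕜 := ℝ) (t • v) x)
    have h3 := h2.fderiv
    exact (DFunLike.congr_fun h3 v).symm
  rw [hpart]
  by_cases h0 : t = 0
  · subst h0
    have hδ : 0 < δ := by
      have := norm_nonneg ((0 : ℝ) • v)
      rw [mem_ball_zero_iff] at ht
      linarith
    obtain ⟨c, hc, hcv⟩ : ∃ c : ℝ, 0 < c ∧ c • v ∈ Metric.ball 0 δ := by
      refine ⟨δ / (2 * (‖v‖ + 1)), by positivity, ?_⟩
      rw [mem_ball_zero_iff, norm_smul, Real.norm_eq_abs, abs_of_pos (by positivity),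
        div_mul_eq_mul_div, div_lt_iff₀ (by positivity)]
      nlinarith [norm_nonneg v]
    have := hG _ hcv x 0 ⟨le_rfl, zero_le_one⟩
    simp only [zero_smul, map_smul] at this ⊢
    exact smul_right_injective _ hc.ne' this
  · have := hG _ ht x 1 ⟨zero_le_one, le_rfl⟩
    simp only [one_smul, map_smul] at this
    exact smul_right_injective _ h0 this

/-- Along a ray the derivative of `‖s‖²` is `2 ⟨s, G b⟩ = 0`. -/
lemma norm_transport {E : Type*} [NormedAddCommGroup E] [InnerProductSpace ℝ E] {s : B × E → E}
    {G : B × E → B →L[ℝ] E}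
    (hs : ∀ p ∈ Metric.ball 0 δ ×ˢ univ, ContDiffAt ℝ ∞ s p)
    (hG : ∀ v, ∀ t : ℝ, t • v ∈ Metric.ball 0 δ → ∀ x,
      fderiv ℝ s (t • v, x) (v, 0) = G (t • v, s (t • v, x)) v)
    (hs0 : ∀ x, s (0, x) = x) (hGo : ∀ p v, inner ℝ p.2 (G p v) = 0) {b : B}
    (hb : b ∈ Metric.ball 0 δ) (x : E) : ‖s (b, x)‖ = ‖x‖ := by
  have hd : ∀ t ∈ {t : ℝ | t • b ∈ Metric.ball 0 δ},
      HasDerivAt (fun t : ℝ => ‖s (t • b, x)‖ ^ 2) 0 t := by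
    intro t ht
    have h1 : HasFDerivAt s (fderiv ℝ s (t • b, x)) (t • b, x) :=
      ((hs (t • b, x) ⟨ht, mem_univ _⟩).differentiableAt (by simp)).hasFDerivAt
    have h2 : HasDerivAt (fun t : ℝ => (t • b, x)) (b, 0) t := by
      refine HasDerivAt.prodMk ?_ (hasDerivAt_const _ _)
      simpa using (hasDerivAt_id t).smul_const b
    have h3 := (h1.comp_hasDerivAt t h2).norm_sq
    rw [hG b t ht x] at h3
    simpa [hGo (t • b, s (t • b, x)) b] using h3
  have hmem0 : (0 : ℝ) ∈ {t : ℝ | t • b ∈ Metric.ball 0 δ} := by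
    have : 0 < δ := (norm_nonneg b).trans_lt (by simpa using hb)
    simpa using this
  have hmem1 : (1 : ℝ) ∈ {t : ℝ | t • b ∈ Metric.ball 0 δ} := by simpa using hb
  have h := (isOpen_setOf_smul_mem_ball b δ).is_const_of_deriv_eq_zero
    (isPreconnected_setOf_smul_mem_ball b δ)
    (fun t ht => (hd t ht).differentiableAt.differentiableWithinAt)
    (fun t ht => (hd t ht).deriv) hmem1 hmem0
  simp only [one_smul, zero_smul, hs0] at h
  exact (sq_eq_sq₀ (norm_nonneg _) (norm_nonneg _)).1 h

/-- The inverse transport `s'` is differentiable, so its derivative provides the preimage. -/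
lemma exists_fderiv_transport_eq [NormedSpace ℝ E] {s' : B × E → E}
    (hs : ∀ p ∈ Metric.ball 0 δ ×ˢ univ, ContDiffAt ℝ ∞ s p)
    (hs' : ∀ p ∈ Metric.ball 0 δ ×ˢ univ, ContDiffAt ℝ ∞ s' p)
    (hinv : ∀ b ∈ Metric.ball 0 δ, ∀ x, s' (b, s (b, x)) = x ∧ s (b, s' (b, x)) = x)
    {b : B} (hb : b ∈ Metric.ball 0 δ) (x w : E) : ∃ u, fderiv ℝ s (b, x) (0, u) = w := by
  have h1 : HasFDerivAt s (fderiv ℝ s (b, x)) (b, s' (b, s (b, x))) := by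
    rw [(hinv b hb x).1]
    exact ((hs (b, x) ⟨hb, mem_univ _⟩).differentiableAt (by simp)).hasFDerivAt
  have h2 : HasFDerivAt s' (fderiv ℝ s' (b, s (b, x))) (b, s (b, x)) :=
    ((hs' (b, s (b, x)) ⟨hb, mem_univ _⟩).differentiableAt (by simp)).hasFDerivAt
  have h3 := h2.comp (s (b, x)) (hasFDerivAt_prodMk_right b (s (b, x)))
  have h4 := h1.comp (s (b, x)) ((hasFDerivAt_const b _).prodMk h3)
  have h5 : (s ∘ fun y => (b, (s' ∘ fun z => (b, z)) y)) = id := by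
    funext y; exact (hinv b hb y).2
  rw [h5] at h4
  have h6 := DFunLike.congr_fun (h4.unique (hasFDerivAt_id _)) w
  exact ⟨_, h6⟩

end Transport

end Flatness

/-! ### Integrability of the horizontal distribution along rays -/

section Flatness

variable {M : Type*} [TopologicalSpace M] [ChartedSpace (EuclideanSpace ℝ (Fin 4)) M]
  [IsManifold (𝓡 4) ∞ M] {π : M → S2}

/-- Near each point there is a closed `2`-form vanishing on horizontal vectors, such that vectors
which pair to zero with all vertical vectors are horizontal. -/
def HasClosedHorizontalForms (g : SmoothMetric 4 M) (π : M → S2) : Prop :=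
  ∀ x₀ : M, ∃ (W : Set M) (ψ : DForm 4 2 M), IsOpen W ∧ x₀ ∈ W ∧ ψ.IsClosedOn W ∧ ∀ x ∈ W,
      (∀ v, IsHorizontal g π x v → ∀ w : EuclideanSpace ℝ (Fin 4), ψ x ![v, w] = 0) ∧
      ∀ v, (∀ w : EuclideanSpace ℝ (Fin 4), mfderiv (𝓡 4) (𝓡 2) π x w = 0 → ψ x ![v, w] = 0) →
        IsHorizontal g π x v

variable {q : S2} {r δ : ℝ}
  {P : EuclideanSpace ℝ (Fin 2) × EuclideanSpace ℝ (Fin 3) → M} {S : M → S2}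
  {s : EuclideanSpace ℝ (Fin 2) × EuclideanSpace ℝ (Fin 3) → EuclideanSpace ℝ (Fin 3)}

/-- The family of radial transports `(t, a, c) ↦ s (t (b + a v), x + c w)`. -/
def transportFamily
    (s : EuclideanSpace ℝ (Fin 2) × EuclideanSpace ℝ (Fin 3) → EuclideanSpace ℝ (Fin 3))
    (b v : EuclideanSpace ℝ (Fin 2)) (x w : EuclideanSpace ℝ (Fin 3))
    (z : EuclideanSpace ℝ (Fin 3)) : EuclideanSpace ℝ (Fin 2) × EuclideanSpace ℝ (Fin 3) :=
  (z 0 • (b + z 1 • v), s (z 0 • (b + z 1 • v), x + z 2 • w))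

lemma hasFDerivAt_transportFamily
    (hs : ∀ p ∈ Metric.ball 0 δ ×ˢ univ, ContDiffAt ℝ ∞ s p)
    (b v : EuclideanSpace ℝ (Fin 2)) (x w : EuclideanSpace ℝ (Fin 3))
    (z : EuclideanSpace ℝ (Fin 3)) (hz : z 0 • (b + z 1 • v) ∈ Metric.ball 0 δ) :
    ContDiffAt ℝ ∞ (transportFamily s b v x w) z ∧
    ∀ u : EuclideanSpace ℝ (Fin 3), fderiv ℝ (transportFamily s b v x w) z u =
      (u 0 • (b + z 1 • v) + (z 0 * u 1) • v,
        fderiv ℝ s (z 0 • (b + z 1 • v), x + z 2 • w)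
          (u 0 • (b + z 1 • v) + (z 0 * u 1) • v, u 2 • w)) := by
  have hs' := hs (z 0 • (b + z 1 • v), x + z 2 • w) ⟨hz, mem_univ _⟩
  have hβ : ContDiff ℝ ∞ fun z : EuclideanSpace ℝ (Fin 3) =>
      (z 0 • (b + z 1 • v), x + z 2 • w) := by fun_prop
  have hsm : ContDiffAt ℝ ∞ (fun z : EuclideanSpace ℝ (Fin 3) =>
      s (z 0 • (b + z 1 • v), x + z 2 • w)) z := ContDiffAt.comp z hs' hβ.contDiffAt
  have hβ₁ : ContDiff ℝ ∞ fun z : EuclideanSpace ℝ (Fin 3) => z 0 • (b + z 1 • v) := by fun_prop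
  refine ⟨hβ₁.contDiffAt.prodMk hsm, fun u => ?_⟩
  have hp : ∀ i : Fin 3, HasFDerivAt (fun z : EuclideanSpace ℝ (Fin 3) => z i)
      (EuclideanSpace.proj i : EuclideanSpace ℝ (Fin 3) →L[ℝ] ℝ) z := fun i =>
    (EuclideanSpace.proj i : EuclideanSpace ℝ (Fin 3) →L[ℝ] ℝ).hasFDerivAt
  have h1 := (hp 0).smul (((hp 1).smul_const v).const_add b)
  have h2 := ((hp 2).smul_const w).const_add x
  have h3 := (hs'.differentiableAt (by simp)).hasFDerivAt.comp z (h1.prodMk h2)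
  have h4 := (h1.prodMk h3).fderiv
  have h5 := DFunLike.congr_fun h4 u
  refine h5.trans ?_
  have e : z 0 • u 1 • v + u 0 • (b + z 1 • v) = u 0 • (b + z 1 • v) + (z 0 * u 1) • v := by
    rw [add_comm, smul_smul]
  rw [← e]
  rfl

/-- The radial transport of a connection with closed horizontal forms is horizontal. -/
lemma IsConeParam.isHorizontal_transport (hP : IsConeParam π q r P S)
    (hπ : ContMDiff (𝓡 4) (𝓡 2) ∞ π) {g : SmoothMetric 4 M}
    (hg : HasClosedHorizontalForms g π) (hδr : δ ≤ r)
    {s' : EuclideanSpace ℝ (Fin 2) × EuclideanSpace ℝ (Fin 3) → EuclideanSpace ℝ (Fin 3)}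
    (hs : ∀ p ∈ Metric.ball 0 δ ×ˢ univ, ContDiffAt ℝ ∞ s p)
    (hs' : ∀ p ∈ Metric.ball 0 δ ×ˢ univ, ContDiffAt ℝ ∞ s' p)
    (hinv : ∀ b ∈ Metric.ball 0 δ, ∀ x, s' (b, s (b, x)) = x ∧ s (b, s' (b, x)) = x)
    (hnorm : ∀ b ∈ Metric.ball 0 δ, ∀ x, ‖s (b, x)‖ = ‖x‖)
    (hrad : ∀ v, ∀ t : ℝ, t • v ∈ Metric.ball 0 δ → ∀ y, |‖y‖ ^ 2 - 1| < 1 / 2 →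
      IsHorizontal g π (P (t • v, s (t • v, y))) (paramDeriv P (t • v, s (t • v, y))
        (v, fderiv ℝ s (t • v, y) (v, 0))))
    {b : EuclideanSpace ℝ (Fin 2)} (hb : b ∈ Metric.ball 0 δ) (x : S2)
    (v : EuclideanSpace ℝ (Fin 2)) :
    IsHorizontal g π (P (b, s (b, x))) (paramDeriv P (b, s (b, x))
        (v, fderiv ℝ s (b, x) (v, 0))) := by
  have hx : ‖(x : EuclideanSpace ℝ (Fin 3))‖ = 1 := by simp
  have hne : ∀ b ∈ Metric.ball 0 δ, ∀ y, |‖y‖ ^ 2 - 1| < 1 / 2 → s (b, y) ≠ 0 := by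
    intro b hb y hy h0
    have := hnorm b hb y
    rw [h0, norm_zero] at this
    rw [← this] at hy
    norm_num at hy
  have hx' : |‖(x : EuclideanSpace ℝ (Fin 3))‖ ^ 2 - 1| < 1 / 2 := by rw [hx]; norm_num
  let D : Set ℝ := {t : ℝ | t • b ∈ Metric.ball 0 δ}
  have hD : IsOpen D := isOpen_setOf_smul_mem_ball b δ
  let m : ℝ → M := fun t => P (t • b, s (t • b, x))
  -- `Z` and `V w` are the images of `∂_a` and `∂_c` under the family at `a = c = 0`. The factor `t`
  -- in `Z` comes from differentiating `t (b + a v)` and makes `Z` vanish at the centre.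
  let Z : ℝ → EuclideanSpace ℝ (Fin 4) := fun t => paramDeriv P (t • b, s (t • b, x))
    (t • v, fderiv ℝ s (t • b, x) (t • v, 0))
  let V : EuclideanSpace ℝ (Fin 3) → ℝ → EuclideanSpace ℝ (Fin 4) := fun w t =>
    paramDeriv P (t • b, s (t • b, x)) (0, fderiv ℝ s (t • b, x) (0, w))
  have hPm : ∀ b ∈ Metric.ball 0 δ, ∀ y, |‖y‖ ^ 2 - 1| < 1 / 2 → ContMDiffAt
      𝓘(ℝ, EuclideanSpace ℝ (Fin 2) × EuclideanSpace ℝ (Fin 3)) (𝓡 4) ∞ P (b, s (b, y)) :=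
    fun b hb y hy => hP.contMDiffAt b (Metric.ball_subset_ball hδr hb) _ (hne b hb y hy)
  have hm : ContinuousOn m D := by
    intro t ht
    have h1 : ContinuousAt (fun t : ℝ => (t • b, (x : EuclideanSpace ℝ (Fin 3)))) t := by fun_prop
    have h2 : ContinuousAt (fun t : ℝ => s (t • b, x)) t :=
      ContinuousAt.comp (g := s) (hs (t • b, x) ⟨ht, mem_univ _⟩).continuousAt h1
    have h3 : ContinuousAt (fun t : ℝ => t • b) t := by fun_prop
    exact (ContinuousAt.comp (g := P) (f := fun t : ℝ => (t • b, s (t • b, x))) (hPm _ ht _ hx').continuousAt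
      (h3.prodMk h2)).continuousWithinAt
  have hvert : ∀ t ∈ D, ∀ u : EuclideanSpace ℝ (Fin 4), mfderiv (𝓡 4) (𝓡 2) π (m t) u = 0 →
      ∃ w, u = V w t := by
    intro t ht u hu
    obtain ⟨w', hw'⟩ := hP.exists_paramDeriv_eq hπ (Metric.ball_subset_ball hδr ht)
      (hne _ ht _ hx') hu
    obtain ⟨w, hw⟩ := exists_fderiv_transport_eq hs hs' hinv ht x w'
    exact ⟨w, by simp only [V]; rw [hw, hw']⟩
  have hderiv : ∀ (W : Set M) (ψ : DForm 4 2 M), IsOpen W → ψ.IsClosedOn W →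
      (∀ y ∈ W, ∀ v, IsHorizontal g π y v → ∀ w : EuclideanSpace ℝ (Fin 4), ψ y ![v, w] = 0) →
      ∀ t ∈ D, m t ∈ W → ∀ w, HasDerivAt (fun t => ψ (m t) ![Z t, V w t]) 0 t := by
    intro W ψ hW hψ hψ0 t₁ ht₁ hmt₁ w
    let κ := transportFamily s b v x w
    -- The variation `x + c w` leaves the unit sphere; this is why radial horizontality is assumed
    -- on a whole shell around it.
    let O : Set (EuclideanSpace ℝ (Fin 3)) := {z | z 0 • (b + z 1 • v) ∈ Metric.ball 0 δ ∧
      |‖(x : EuclideanSpace ℝ (Fin 3)) + z 2 • w‖ ^ 2 - 1| < 1 / 2}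
    have hO : IsOpen O := by
      refine IsOpen.inter (t := {z : EuclideanSpace ℝ (Fin 3) |
        |‖(x : EuclideanSpace ℝ (Fin 3)) + z 2 • w‖ ^ 2 - 1| < 1 / 2}) (Metric.isOpen_ball.preimage (f := fun z : EuclideanSpace ℝ (Fin 3) =>
        z 0 • (b + z 1 • v)) (by fun_prop)) (isOpen_lt (f := fun z : EuclideanSpace ℝ (Fin 3) =>
        |‖(x : EuclideanSpace ℝ (Fin 3)) + z 2 • w‖ ^ 2 - 1|) (by fun_prop) continuous_const)
    have hκ : ∀ z ∈ O, ContDiffAt ℝ ∞ κ z := fun z hz =>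
      (hasFDerivAt_transportFamily hs b v x w z hz.1).1
    have hRO : ∀ z ∈ O, ContMDiffAt (𝓡 3) (𝓡 4) ∞ (fun z => P (κ z)) z := fun z hz =>
      ContMDiffAt.comp z (hPm _ hz.1 _ hz.2) (hκ z hz).contMDiffAt
    let N : Set (EuclideanSpace ℝ (Fin 3)) := O ∩ (fun z => P (κ z)) ⁻¹' W
    have hN : IsOpen N := ContinuousOn.isOpen_inter_preimage
      (fun z hz => (hRO z hz).continuousAt.continuousWithinAt) hO hW
    let Θ : DForm 3 2 (EuclideanSpace ℝ (Fin 3)) := DForm.pullback (m := 3) (fun z => P (κ z)) ψ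
    have hΘcl : Θ.IsClosedOn N := hψ.pullback hN
      (fun z hz => (hRO z hz.1).contMDiffWithinAt) (fun z hz => hz.2)
    let η : EuclideanSpace ℝ (Fin 3) → EuclideanSpace ℝ (Fin 3) [⋀^Fin 2]→L[ℝ] ℝ := Θ
    have hηd : ∀ z ∈ N, DifferentiableAt ℝ η z ∧ extDeriv η z = 0 := by
      intro z hz
      have h1 := hΘcl.1 z z (mem_extChartAt_target z) hz
      have h2 := hΘcl.2 z z (mem_extChartAt_target z) hz
      rw [Θ.inChart_euclideanSpace] at h1 h2
      exact ⟨h1.differentiableAt (by simp), h2⟩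
    have hη : ∀ z ∈ N, ∀ u u', η z ![u, u'] = ψ (P (κ z))
        ![paramDeriv P (κ z) (fderiv ℝ κ z u), paramDeriv P (κ z) (fderiv ℝ κ z u')] := by
      intro z hz u u'
      have h1 : HasMFDerivAt (𝓡 3) (𝓡 4) (fun z => P (κ z)) z
          ((paramDeriv P (κ z)).comp (fderiv ℝ κ z)) :=
        HasMFDerivAt.comp z ((hPm _ hz.1.1 _ hz.1.2).mdifferentiableAt (by simp)).hasMFDerivAt
          ((hκ z hz.1).differentiableAt (by simp)).hasFDerivAt.hasMFDerivAt
      have h2 : mfderiv (𝓡 3) (𝓡 4) (fun z => P (κ z)) z =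
        (paramDeriv P (κ z)).comp (fderiv ℝ κ z) := h1.mfderiv
      change ψ (P (κ z)) (fun i => mfderiv (𝓡 3) (𝓡 4) (fun z => P (κ z)) z (![u, u'] i)) = _
      rw [h2]
      congr 1
      ext i
      fin_cases i <;> rfl
    let ε : Fin 3 → EuclideanSpace ℝ (Fin 3) := fun i => EuclideanSpace.single i 1
    have hη0 : ∀ z ∈ N, ∀ u, η z ![ε 0, u] = 0 := by
      intro z hz u
      rw [hη z hz]
      refine hψ0 _ hz.2 _ ?_ _
      rw [(hasFDerivAt_transportFamily hs b v x w z hz.1.1).2]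
      have := hrad (b + z 1 • v) (z 0) hz.1.1 _ hz.1.2
      simpa [ε, κ, transportFamily] using this
    have hline : ∀ t : ℝ, κ (t • ε 0) = (t • b, s (t • b, x)) := by
      intro t; simp [κ, transportFamily, ε]
    have hηline : ∀ t : ℝ, t • ε 0 ∈ N → η (t • ε 0) ![ε 1, ε 2] = ψ (m t) ![Z t, V w t] := by
      intro t ht
      rw [hη _ ht, hline]
      have := (hasFDerivAt_transportFamily hs b v x w (t • ε 0) ht.1.1).2
      rw [this, this]
      simp [ε, m, Z, V]
    have hmem : t₁ • ε 0 ∈ N := by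
      refine ⟨⟨by simpa [ε, D] using ht₁, by simpa [ε] using hx'⟩, ?_⟩
      change P (κ (t₁ • ε 0)) ∈ W
      rw [hline]
      exact hmt₁
    have hc : ContinuousAt (fun t : ℝ => t • ε 0) t₁ := by fun_prop
    -- The radial field `∂ₜ` maps to horizontal vectors, so it lies in the kernel of the pulled back
    -- closed form; hence the pairing of `∂_a` and `∂_c` does not depend on `t`.
    have h1 := fderiv_apply_eq_zero_of_extDeriv_eq_zero (hηd _ hmem).1 (hηd _ hmem).2
      (eventually_of_mem (hN.mem_nhds hmem) hη0) (ε 1) (ε 2)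
    have h2 : DifferentiableAt ℝ (fun z => η z ![ε 1, ε 2]) (t₁ • ε 0) :=
      (ContinuousAlternatingMap.apply ℝ (EuclideanSpace ℝ (Fin 3)) ℝ ![ε 1, ε 2]).differentiableAt.comp _ (hηd _ hmem).1
    have h3 : HasDerivAt (fun t : ℝ => t • ε 0) (ε 0) t₁ := by
      simpa using (hasDerivAt_id t₁).smul_const (ε 0)
    have h4 := h2.hasFDerivAt.comp_hasDerivAt t₁ h3
    rw [h1] at h4
    refine h4.congr_of_eventuallyEq ?_
    filter_upwards [hc.preimage_mem_nhds (hN.mem_nhds hmem)] with t ht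
    exact (hηline t ht).symm
  -- Different neighbourhoods have unrelated forms `ψ`. Vanishing of the pairing with all vertical
  -- vectors, however, means horizontality of `Z`, which does not refer to `ψ` and so propagates
  -- along the ray.
  have hloc : ∀ t₀ ∈ D, ∀ᶠ t in 𝓝[D] t₀,
      (IsHorizontal g π (m t₀) (Z t₀) → IsHorizontal g π (m t) (Z t)) ∧
      (IsHorizontal g π (m t) (Z t) → IsHorizontal g π (m t₀) (Z t₀)) := by
    intro t₀ ht₀
    obtain ⟨W, ψ, hW, hmW, hψ, hψW⟩ := hg (m t₀)
    have hopen : IsOpen (D ∩ m ⁻¹' W) := hm.isOpen_inter_preimage hD hW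
    obtain ⟨ε, hε, hεD⟩ := Metric.isOpen_iff.1 hopen t₀ ⟨ht₀, hmW⟩
    have hpre : IsPreconnected (Metric.ball t₀ ε) := (convex_ball t₀ ε).isPreconnected
    have hd : ∀ w, ∀ t ∈ Metric.ball t₀ ε, HasDerivAt (fun t => ψ (m t) ![Z t, V w t]) 0 t :=
      fun w t ht => hderiv W ψ hW hψ (fun y hy => (hψW y hy).1) t (hεD ht).1 (hεD ht).2 w
    have hiff : ∀ t ∈ Metric.ball t₀ ε, (IsHorizontal g π (m t) (Z t) ↔
        ∀ w, ψ (m t) ![Z t, V w t] = 0) := by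
      intro t ht
      refine ⟨fun h w => (hψW _ (hεD ht).2).1 _ h _, fun h => (hψW _ (hεD ht).2).2 _ ?_⟩
      intro u hu
      obtain ⟨w, rfl⟩ := hvert t (hεD ht).1 u hu
      exact h w
    have hconst : ∀ t ∈ Metric.ball t₀ ε, ∀ w,
        ψ (m t) ![Z t, V w t] = ψ (m t₀) ![Z t₀, V w t₀] := fun t ht w =>
      Metric.isOpen_ball.is_const_of_deriv_eq_zero hpre
        (fun t ht => (hd w t ht).differentiableAt.differentiableWithinAt)
        (fun t ht => (hd w t ht).deriv) ht (Metric.mem_ball_self hε)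
    filter_upwards [mem_nhdsWithin_of_mem_nhds (Metric.ball_mem_nhds t₀ hε)] with t ht
    have h0 : IsHorizontal g π (m t₀) (Z t₀) ↔ IsHorizontal g π (m t) (Z t) := by
      rw [hiff t ht, hiff t₀ (Metric.mem_ball_self hε)]
      exact forall_congr' fun w => by rw [hconst t ht w]
    exact ⟨h0.1, h0.2⟩
  have hmem0 : (0 : ℝ) ∈ D := by
    have : 0 < δ := (norm_nonneg b).trans_lt (by simpa using hb)
    simpa [D] using this
  have hmem1 : (1 : ℝ) ∈ D := by simpa [D] using hb
  have h01 := (isPreconnected_setOf_smul_mem_ball b δ).induction₂'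
    (fun t t' => IsHorizontal g π (m t) (Z t) → IsHorizontal g π (m t') (Z t')) hloc
    (fun _ _ _ _ _ _ h h' => h' ∘ h) hmem0 hmem1
  have h0 : IsHorizontal g π (m 0) (Z 0) := by
    have : Z 0 = 0 := by 
      simp only [Z, zero_smul]
      rw [show ((0 : EuclideanSpace ℝ (Fin 2)), (0 : EuclideanSpace ℝ (Fin 3))) = 0 from rfl,
        map_zero, show ((0 : EuclideanSpace ℝ (Fin 2)), (0 : EuclideanSpace ℝ (Fin 3))) = 0 from rfl,
        map_zero]
    rw [this]
    intro w _
    exact DFunLike.congr_fun (map_zero (g.inner (m 0))) w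
  have h1 := h01 h0
  simpa only [m, Z, one_smul] using h1

end Flatness

/-! ### Flat trivializations, their gluing and non-harmonicity -/

section FlatTrivialization

variable {M : Type*} [TopologicalSpace M] [ChartedSpace (EuclideanSpace ℝ (Fin 4)) M]
  [IsManifold (𝓡 4) ∞ M] {π : M → S2}

/-- The trivialization `T` over `U` has horizontal constant sections. -/
def IsFlatOn (g : SmoothMetric 4 M) (π : M → S2) (U : Set S2) (T : S2 × S2 → M) : Prop :=
  ∀ b ∈ U, ∀ x, ∀ v : EuclideanSpace ℝ (Fin 2),
    IsHorizontal g π (T (b, x)) (mfderiv (𝓡 2) (𝓡 4) (fun b => T (b, x)) b v)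

variable {g : SmoothMetric 4 M}

lemma IsFlatOn.mono {U V : Set S2} {T : S2 × S2 → M} (h : IsFlatOn g π U T) (hVU : V ⊆ U) :
    IsFlatOn g π V T := fun b hb => h b (hVU hb)

lemma IsTrivOn.contMDiffAt_section {U : Set S2} {T : S2 × S2 → M} {S : M → S2}
    (hT : IsTrivOn π U T S) (hU : IsOpen U) {b : S2} (hb : b ∈ U) (x : S2) :
    ContMDiffAt (𝓡 2) (𝓡 4) ∞ (fun b => T (b, x)) b :=
  ContMDiffAt.comp (g := T) b
    (hT.contMDiffOn.contMDiffAt ((hU.prod isOpen_univ).mem_nhds ⟨hb, mem_univ _⟩))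
    (contMDiffAt_id.prodMk contMDiffAt_const)

lemma unitVec_coe (x : S2) : unitVec (x : EuclideanSpace ℝ (Fin 3)) = x := by
  simpa using unitVec_smul_coe one_pos x

lemma coe_unitVec_of_norm {y : EuclideanSpace ℝ (Fin 3)} (hy : ‖y‖ = 1) :
    (unitVec y : EuclideanSpace ℝ (Fin 3)) = y := by
  simpa [hy] using norm_smul_unitVec y

/-- Local existence of flat trivializations. -/
lemma IsSphereBundle.exists_isFlatOn (h : IsSphereBundle π) (hg : HasClosedHorizontalForms g π)
    (q : S2) : ∃ U, IsOpen U ∧ q ∈ U ∧ ∃ T S, IsTrivOn π U T S ∧ IsFlatOn g π U T := by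
  have hπ := h.contMDiff
  obtain ⟨r, hr, P, S, hP⟩ := h.exists_isConeParam q
  obtain ⟨G, K, hG, hK, hGo, hGh⟩ := hP.exists_cutoff_connection hπ hr g
  obtain ⟨δ₀, hδ₀, s, s', hs, hs', hinv, hs0, hsG⟩ := exists_radial_transport hG hK
  have hGr := fderiv_radial hs hsG
  -- Below `δ₀` the transport is defined; below `r / 2`, and near the unit sphere, the cut off
  -- connection still has horizontal lifts.
  set δ := min δ₀ (r / 2) with hδ
  have hδpos : 0 < δ := lt_min hδ₀ (by linarith)
  have hsub₀ : Metric.ball (0 : EuclideanSpace ℝ (Fin 2)) δ ⊆ Metric.ball 0 δ₀ :=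
    Metric.ball_subset_ball (min_le_left _ _)
  have hsub₁ : Metric.ball (0 : EuclideanSpace ℝ (Fin 2)) δ ⊆ Metric.ball 0 (r / 2) :=
    Metric.ball_subset_ball (min_le_right _ _)
  have hδr : δ ≤ r := (min_le_right _ _).trans (by linarith)
  have hsubr : Metric.ball (0 : EuclideanSpace ℝ (Fin 2)) δ ⊆ Metric.ball 0 r :=
    Metric.ball_subset_ball hδr
  have hnorm : ∀ b ∈ Metric.ball 0 δ, ∀ x, ‖s (b, x)‖ = ‖x‖ := fun b hb x =>
    norm_transport hs hGr hs0 hGo (hsub₀ hb) x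
  have hnorm' : ∀ b ∈ Metric.ball 0 δ, ∀ x, ‖s' (b, x)‖ = ‖x‖ := fun b hb x => by
    rw [← hnorm b hb, (hinv b (hsub₀ hb) x).2]
  have hs₁ : ∀ p ∈ Metric.ball 0 δ ×ˢ univ, ContDiffAt ℝ ∞ s p := fun p hp =>
    hs p ⟨hsub₀ hp.1, hp.2⟩
  have hs₁' : ∀ p ∈ Metric.ball 0 δ ×ˢ univ, ContDiffAt ℝ ∞ s' p := fun p hp =>
    hs' p ⟨hsub₀ hp.1, hp.2⟩
  have hrad : ∀ v, ∀ t : ℝ, t • v ∈ Metric.ball 0 δ → ∀ y, |‖y‖ ^ 2 - 1| < 1 / 2 →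
      IsHorizontal g π (P (t • v, s (t • v, y))) (paramDeriv P (t • v, s (t • v, y))
        (v, fderiv ℝ s (t • v, y) (v, 0))) := by
    intro v t ht y hy
    rw [hGr v t (hsub₀ ht) y]
    exact hGh _ (hsub₁ ht) _ (by rwa [hnorm _ ht]) v
  have hflat : ∀ b ∈ Metric.ball 0 δ, ∀ (x : S2) v, IsHorizontal g π (P (b, s (b, x)))
      (paramDeriv P (b, s (b, x)) (v, fderiv ℝ s (b, x) (v, 0))) := fun b hb x v =>
    hP.isHorizontal_transport hπ hg hδr hs₁ hs₁' (fun b hb => hinv b (hsub₀ hb)) hnorm hrad hb x v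
  have hn1 : ∀ b ∈ Metric.ball 0 δ, ∀ x : S2, ‖s (b, x)‖ = 1 := fun b hb x => by
    rw [hnorm b hb]; simp
  have hn1' : ∀ b ∈ Metric.ball 0 δ, ∀ x : S2, ‖s' (b, x)‖ = 1 := fun b hb x => by
    rw [hnorm' b hb]; simp
  have hne : ∀ b ∈ Metric.ball 0 δ, ∀ x : S2, s (b, x) ≠ 0 := fun b hb x h0 => by
    have := hn1 b hb x
    rw [h0, norm_zero] at this
    exact zero_ne_one this
  have hne' : ∀ b ∈ Metric.ball 0 δ, ∀ x : S2, s' (b, x) ≠ 0 := fun b hb x h0 => by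
    have := hn1' b hb x
    rw [h0, norm_zero] at this
    exact zero_ne_one this
  let φ := chartAt (EuclideanSpace ℝ (Fin 2)) q
  let U := stereoSet q (Metric.ball 0 δ)
  have hU : IsOpen U := isOpen_stereoSet q Metric.isOpen_ball
  have hUr : U ⊆ stereoSet q (Metric.ball 0 r) := inter_subset_inter_right _ (preimage_mono hsubr)
  have hφ : ∀ b ∈ U, ContMDiffAt (𝓡 2) (𝓡 2) ∞ φ b := fun b hb =>
    (contMDiffOn_chartAt_S2 q).contMDiffAt (φ.open_source.mem_nhds hb.1)
  -- Transport preserves norms and therefore restricts to the unit spheres, where `P` is injective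
  -- on fibers; backward transport gives the inverse.
  let T : S2 × S2 → M := fun p => P (φ p.1, s (φ p.1, p.2))
  refine ⟨U, hU, ⟨mem_chart_source _ q, ?_⟩, T, fun m => unitVec (s' (φ (π m), S m)),
    ⟨?_, ?_, ?_, ?_, ?_⟩, ?_⟩
  · rw [mem_preimage, chartAt_S2_self]
    exact Metric.mem_ball_self hδpos
  · rintro ⟨b, x⟩ ⟨hb, -⟩
    have h1 : ContMDiffAt ((𝓡 2).prod (𝓡 2)) (𝓡 2) ∞ (fun p : S2 × S2 => φ p.1) (b, x) :=
      ContMDiffAt.comp (b, x) (hφ b hb) contMDiffAt_fst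
    have h2 : ContMDiffAt ((𝓡 2).prod (𝓡 2)) 𝓘(ℝ, EuclideanSpace ℝ (Fin 3)) ∞
        (fun p : S2 × S2 => (p.2 : EuclideanSpace ℝ (Fin 3))) (b, x) :=
      contMDiff_coe_S2.contMDiffAt.comp (b, x) contMDiffAt_snd
    have h3 : ContMDiffAt ((𝓡 2).prod (𝓡 2)) 𝓘(ℝ, EuclideanSpace ℝ (Fin 3)) ∞
        (fun p : S2 × S2 => s (φ p.1, p.2)) (b, x) :=
      ContMDiffAt.comp (g := s) (b, x) (hs₁ (φ b, x) ⟨hb.2, mem_univ _⟩).contMDiffAt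
        (h1.prodMk_space h2)
    exact (ContMDiffAt.comp (g := P) (b, x) (hP.contMDiffAt _ (hsubr hb.2) _ (hne _ hb.2 x))
      (h1.prodMk_space h3)).contMDiffWithinAt
  · intro m hm
    have h1 : ContMDiffAt (𝓡 4) (𝓡 2) ∞ (fun m => φ (π m)) m :=
      ContMDiffAt.comp m (hφ _ hm) hπ.contMDiffAt
    have h2 : ContMDiffAt (𝓡 4) 𝓘(ℝ, EuclideanSpace ℝ (Fin 3)) ∞
        (fun m => (S m : EuclideanSpace ℝ (Fin 3))) m :=
      contMDiffAt_S2_iff.1 (hP.contMDiffAt_snd m (hUr hm))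
    have h3 : ContMDiffAt (𝓡 4) 𝓘(ℝ, EuclideanSpace ℝ (Fin 3)) ∞
        (fun m => s' (φ (π m), S m)) m :=
      ContMDiffAt.comp (g := s') m (hs₁' (φ (π m), S m) ⟨hm.2, mem_univ _⟩).contMDiffAt
        (h1.prodMk_space h2)
    exact (ContMDiffAt.comp m (contMDiffAt_unitVec (hne' _ hm.2 _)) h3).contMDiffWithinAt
  · intro b hb x
    simp only [T]
    rw [hP.proj _ (hsubr hb.2)]
    exact stereoParam_chartAt hb.1
  · intro b hb x
    simp only [T]
    rw [hP.proj _ (hsubr hb.2), hP.snd _ (hsubr hb.2), stereoParam_chartAt hb.1,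
      coe_unitVec_of_norm (hn1 _ hb.2 x), (hinv _ (hsub₀ hb.2) _).1, unitVec_coe]
  · intro m hm
    simp only [T]
    rw [coe_unitVec_of_norm (hn1' _ hm.2 _), (hinv _ (hsub₀ hm.2) _).2]
    simpa using hP.total m (hUr hm) 1 one_pos
  · intro b hb x v
    have h1 : HasMFDerivAt (𝓡 2) (𝓡 2) φ b (mfderiv (𝓡 2) (𝓡 2) φ b) :=
      ((hφ b hb).mdifferentiableAt (by simp)).hasMFDerivAt
    have h2 : HasFDerivAt s (fderiv ℝ s (φ b, x)) (φ b, x) :=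
      ((hs₁ (φ b, x) ⟨hb.2, mem_univ _⟩).differentiableAt (by simp)).hasFDerivAt
    have h3 : HasFDerivAt (fun c : EuclideanSpace ℝ (Fin 2) => (c, s (c, x)))
        ((ContinuousLinearMap.id ℝ _).prod ((fderiv ℝ s (φ b, x)).comp
          (ContinuousLinearMap.inl ℝ _ _))) (φ b) :=
      (hasFDerivAt_id _).prodMk (HasFDerivAt.comp (g := s) (φ b) h2
        (hasFDerivAt_prodMk_left (φ b) (x : EuclideanSpace ℝ (Fin 3))))
    have h4 : HasMFDerivAt 𝓘(ℝ, EuclideanSpace ℝ (Fin 2) × EuclideanSpace ℝ (Fin 3)) (𝓡 4) P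
        (φ b, s (φ b, x)) (paramDeriv P (φ b, s (φ b, x))) :=
      (hP.mdifferentiableAt (hsubr hb.2) (hne _ hb.2 x)).hasMFDerivAt
    have h5 : HasMFDerivAt (𝓡 2) (𝓡 4) (fun b => T (b, x)) b _ :=
      HasMFDerivAt.comp (g := fun c => P (c, s (c, x))) b
        (HasMFDerivAt.comp (φ b) h4 h3.hasMFDerivAt) h1
    rw [h5.mfderiv]
    exact hflat (φ b) hb.2 x (mfderiv (𝓡 2) (𝓡 2) φ b v)

/-- The transition map between flat trivializations has zero derivative. -/
lemma IsFlatOn.mfderiv_transition (hπ : ContMDiff (𝓡 4) (𝓡 2) ∞ π) {U V : Set S2}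
    {T₁ T₂ : S2 × S2 → M} {S₁ S₂ : M → S2} (h₁ : IsTrivOn π U T₁ S₁) (h₂ : IsTrivOn π V T₂ S₂)
    (hf₁ : IsFlatOn g π U T₁) (hf₂ : IsFlatOn g π V T₂) (hU : IsOpen U) (hV : IsOpen V) {b : S2}
    (hb : b ∈ U ∩ V) (x : S2) :
    HasMFDerivAt (𝓡 2) (𝓡 2) (fun b => S₂ (T₁ (b, x))) b
      (0 : EuclideanSpace ℝ (Fin 2) →L[ℝ] EuclideanSpace ℝ (Fin 2)) := by
  set y := S₂ (T₁ (b, x)) with hy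
  have hm : T₂ (b, y) = T₁ (b, x) := by
    have := h₂.total (T₁ (b, x)) (by rw [h₁.proj b hb.1]; exact hb.2)
    rwa [h₁.proj b hb.1] at this
  have hS : HasMFDerivAt (𝓡 4) (𝓡 2) S₂ (T₁ (b, x)) (mfderiv (𝓡 4) (𝓡 2) S₂ (T₁ (b, x))) :=
    ((h₂.smooth_snd.contMDiffAt ((hV.preimage hπ.continuous).mem_nhds
      (by rw [mem_preimage, h₁.proj b hb.1]; exact hb.2))).mdifferentiableAt (by simp)).hasMFDerivAt
  have hd₁ := ((h₁.contMDiffAt_section hU hb.1 x).mdifferentiableAt (by simp)).hasMFDerivAt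
  have hd₂ := ((h₂.contMDiffAt_section hV hb.2 y).mdifferentiableAt (by simp)).hasMFDerivAt
  have hp₁ := HasMFDerivAt.comp b (hπ.mdifferentiable (by simp) (T₁ (b, x))).hasMFDerivAt hd₁
  have hid : HasMFDerivAt (𝓡 2) (𝓡 2) (fun b : S2 => b) b _ := hasMFDerivAt_id b
  have he₁ := hasMFDerivAt_unique (hp₁.congr_of_eventuallyEq (f₁ := fun b : S2 => b)
    (eventually_of_mem (hU.mem_nhds hb.1) fun c hc => (h₁.proj c hc x).symm)) hid
  have hπ' : HasMFDerivAt (𝓡 4) (𝓡 2) π (T₂ (b, y)) (mfderiv (𝓡 4) (𝓡 2) π (T₁ (b, x))) := by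
    rw [hm]; exact (hπ.mdifferentiable (by simp) _).hasMFDerivAt
  have hp₂ := HasMFDerivAt.comp b hπ' hd₂
  have he₂ := hasMFDerivAt_unique (hp₂.congr_of_eventuallyEq (f₁ := fun b : S2 => b)
    (eventually_of_mem (hV.mem_nhds hb.2) fun c hc => (h₂.proj c hc y).symm)) hid
  have hs₁ := HasMFDerivAt.comp b hS hd₁
  have hS' : HasMFDerivAt (𝓡 4) (𝓡 2) S₂ (T₂ (b, y)) (mfderiv (𝓡 4) (𝓡 2) S₂ (T₁ (b, x))) := by
    rw [hm]; exact hS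
  have hs₂ := HasMFDerivAt.comp b hS' hd₂
  have he₃ := hasMFDerivAt_unique (hs₂.congr_of_eventuallyEq (f₁ := fun _ : S2 => y)
    (eventually_of_mem (hV.mem_nhds hb.2) fun c hc => (h₂.snd c hc y).symm))
    (hasMFDerivAt_const y b)
  let D₁ : EuclideanSpace ℝ (Fin 2) →L[ℝ] EuclideanSpace ℝ (Fin 4) :=
    mfderiv (𝓡 2) (𝓡 4) (fun b => T₁ (b, x)) b
  let D₂ : EuclideanSpace ℝ (Fin 2) →L[ℝ] EuclideanSpace ℝ (Fin 4) :=
    mfderiv (𝓡 2) (𝓡 4) (fun b => T₂ (b, y)) b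
  let L : EuclideanSpace ℝ (Fin 4) →L[ℝ] EuclideanSpace ℝ (Fin 2) :=
    mfderiv (𝓡 4) (𝓡 2) π (T₁ (b, x))
  let L' : EuclideanSpace ℝ (Fin 4) →L[ℝ] EuclideanSpace ℝ (Fin 2) :=
    mfderiv (𝓡 4) (𝓡 2) S₂ (T₁ (b, x))
  let G : EuclideanSpace ℝ (Fin 4) →L[ℝ] EuclideanSpace ℝ (Fin 4) →L[ℝ] ℝ :=
    g.inner (T₁ (b, x))
  have hLD₁ : ∀ v, L (D₁ v) = v := fun v => DFunLike.congr_fun he₁ v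
  have hLD₂ : ∀ v, L (D₂ v) = v := fun v => DFunLike.congr_fun he₂ v
  have hL'D₂ : ∀ v, L' (D₂ v) = 0 := fun v => DFunLike.congr_fun he₃ v
  have hh₁ : ∀ v w, L w = 0 → G (D₁ v) w = 0 := fun v w hw => hf₁ b hb.1 x v w hw
  have hh₂ : ∀ v w, L w = 0 → G (D₂ v) w = 0 := by
    intro v w hw
    have h := hf₂ b hb.2 y v
    rw [hm] at h
    exact h w hw
  -- Both vectors are horizontal lifts of `v` at the same point. Their difference is vertical and
  -- horizontal, hence zero by positivity of the metric.
  have hD : ∀ v, D₁ v = D₂ v := by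
    intro v
    by_contra hne
    have hsub : D₁ v - D₂ v ≠ 0 := sub_ne_zero.2 hne
    have hpos : 0 < G (D₁ v - D₂ v) (D₁ v - D₂ v) := g.pos _ _ hsub
    have hL0 : L (D₁ v - D₂ v) = 0 := by rw [map_sub, hLD₁, hLD₂, sub_self]
    have : G (D₁ v - D₂ v) (D₁ v - D₂ v) = 0 := by
      rw [map_sub G, _root_.sub_apply, hh₁ _ _ hL0, hh₂ _ _ hL0, sub_self]
    exact hpos.ne' this
  have hzero : L'.comp D₁ = 0 := by
    ext1 v
    change L' (D₁ v) = 0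
    rw [hD, hL'D₂]
  rw [← hzero]
  exact hs₁

/-- The transition map has zero derivative, so as a map into `ℝ³` it is constant on a connected open
set of the plane. -/
lemma IsFlatOn.transition_eq (hπ : ContMDiff (𝓡 4) (𝓡 2) ∞ π) {U V : Set S2}
    {T₁ T₂ : S2 × S2 → M} {S₁ S₂ : M → S2} (h₁ : IsTrivOn π U T₁ S₁) (h₂ : IsTrivOn π V T₂ S₂)
    (hf₁ : IsFlatOn g π U T₁) (hf₂ : IsFlatOn g π V T₂) (hU : IsOpen U) (hV : IsOpen V) {q : S2}
    {O : Set (EuclideanSpace ℝ (Fin 2))} (hO : IsOpen O) (hOc : IsPreconnected O)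
    (hOU : ∀ z ∈ O, stereoParam q z ∈ U ∩ V) {z z' : EuclideanSpace ℝ (Fin 2)} (hz : z ∈ O)
    (hz' : z' ∈ O) (x : S2) :
    S₂ (T₁ (stereoParam q z, x)) = S₂ (T₁ (stereoParam q z', x)) := by
  have hd : ∀ z ∈ O, HasFDerivAt
      (fun z => (S₂ (T₁ (stereoParam q z, x)) : EuclideanSpace ℝ (Fin 3)))
      (0 : EuclideanSpace ℝ (Fin 2) →L[ℝ] EuclideanSpace ℝ (Fin 3)) z := by
    intro z hz
    have h1 := IsFlatOn.mfderiv_transition hπ h₁ h₂ hf₁ hf₂ hU hV (hOU z hz) x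
    have h2 := ((contMDiff_stereoParam q).mdifferentiable (by simp) z).hasMFDerivAt
    have h3 := (contMDiff_coe_S2.mdifferentiable (by simp)
      (S₂ (T₁ (stereoParam q z, x)))).hasMFDerivAt
    have h4 := HasMFDerivAt.comp z h3 (HasMFDerivAt.comp z h1 h2)
    have h5 := h4.hasFDerivAt
    refine h5.congr_fderiv ?_
    let A : EuclideanSpace ℝ (Fin 2) →L[ℝ] EuclideanSpace ℝ (Fin 3) :=
      mfderiv (𝓡 2) 𝓘(ℝ, EuclideanSpace ℝ (Fin 3)) (fun x : S2 => (x : EuclideanSpace ℝ (Fin 3)))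
        (S₂ (T₁ (stereoParam q z, x)))
    ext1 v
    change A 0 = 0
    exact map_zero A
  exact Subtype.ext (hO.is_const_of_fderiv_eq_zero hOc
    (fun z hz => (hd z hz).differentiableAt.differentiableWithinAt)
    (fun z hz => (hd z hz).fderiv) hz hz')

/-- Flat trivializations over sets with connected intersection can be glued. -/
lemma IsFlatOn.glue (hπ : ContMDiff (𝓡 4) (𝓡 2) ∞ π) {U V : Set S2}
    {T₁ T₂ : S2 × S2 → M} {S₁ S₂ : M → S2} (h₁ : IsTrivOn π U T₁ S₁) (h₂ : IsTrivOn π V T₂ S₂)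
    (hf₁ : IsFlatOn g π U T₁) (hf₂ : IsFlatOn g π V T₂) (hU : IsOpen U) (hV : IsOpen V) {q : S2}
    {O : Set (EuclideanSpace ℝ (Fin 2))} (hO : IsOpen O) (hOc : IsPreconnected O)
    (hOU : U ∩ V = stereoSet q O) {z : EuclideanSpace ℝ (Fin 2)} (hz : z ∈ O) :
    ∃ T S, IsTrivOn π (U ∪ V) T S ∧ IsFlatOn g π (U ∪ V) T := by
  have hmem : ∀ z ∈ O, stereoParam q z ∈ U ∩ V := fun z hz => by
    rw [hOU]; exact (stereoParam_mem_stereoSet q).2 hz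
  -- On the overlap the transition map is independent of the base point, so `ρ` may be constant. The
  -- corrected trivialization is then `T₂` with a fixed change of fiber coordinate and stays flat.
  obtain ⟨T, S, hT, hTU, hTV⟩ := h₁.glue hπ h₂ hU hV subset_rfl (ρ := fun _ => stereoParam q z)
    contMDiffOn_const (fun _ _ => hmem z hz) (fun b hb x => by
      have hb' : b ∈ stereoSet q O := hOU ▸ hb
      rw [← stereoParam_chartAt hb'.1]
      exact IsFlatOn.transition_eq hπ h₁ h₂ hf₁ hf₂ hU hV hO hOc hmem hz hb'.2 x)
  refine ⟨T, S, hT, ?_⟩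
  rintro b (hb | hb) x
  · have : (fun b => T (b, x)) =ᶠ[𝓝 b] fun b => T₁ (b, x) :=
      eventually_of_mem (hU.mem_nhds hb) fun c hc => hTU c hc x
    rw [this.mfderiv_eq, hTU b hb]
    exact hf₁ b hb x
  · have : (fun b => T (b, x)) =ᶠ[𝓝 b] fun b => T₂ (b, S₂ (T₁ (stereoParam q z, x))) :=
      eventually_of_mem (hV.mem_nhds hb) fun c hc => hTV c hc x
    rw [this.mfderiv_eq, hTV b hb]
    exact hf₂ b hb _

/-- The image of an interval times the unit circle under scaling. As `r` may be negative, the origin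
is excluded separately. -/
lemma isPreconnected_annulus {r R : ℝ} :
    IsPreconnected {y : EuclideanSpace ℝ (Fin 2) | r < ‖y‖ ∧ ‖y‖ < R ∧ 0 < ‖y‖} := by
  have hrank : 1 < Module.rank ℝ (EuclideanSpace ℝ (Fin 2)) := by
    rw [← Module.finrank_eq_rank]
    simp
  have h1 : IsPreconnected ((Ioo (max r 0) R) ×ˢ Metric.sphere (0 : EuclideanSpace ℝ (Fin 2)) 1) :=
    isPreconnected_Ioo.prod (isPreconnected_sphere hrank 0 1)
  have h2 := h1.image (fun p : ℝ × EuclideanSpace ℝ (Fin 2) => p.1 • p.2) (by fun_prop)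
  convert h2 using 1
  ext y
  constructor
  · rintro ⟨h3, h4, h5⟩
    refine ⟨(‖y‖, ‖y‖⁻¹ • y), ⟨⟨max_lt h3 h5, h4⟩, ?_⟩, ?_⟩
    · simp [norm_smul, h5.ne']
    · simp [smul_smul, h5.ne']
  · rintro ⟨⟨t, u⟩, ⟨⟨h3, h4⟩, hu⟩, rfl⟩
    have ht : 0 < t := (le_max_right _ _).trans_lt h3
    have hu' : ‖u‖ = 1 := by simpa using hu
    simp only [mem_ofPred_eq, norm_smul, hu', mul_one, Real.norm_eq_abs, abs_of_pos ht]
    exact ⟨(le_max_left _ _).trans_lt h3, h4, ht⟩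

lemma IsTrivOn.isTrivialSphereBundle (hπ : ContMDiff (𝓡 4) (𝓡 2) ∞ π) {T : S2 × S2 → M}
    {S : M → S2} (hT : IsTrivOn π univ T S) : IsTrivialSphereBundle π := by
  have h1 := hT.contMDiffOn
  rw [univ_prod_univ, contMDiffOn_univ] at h1
  have h2 := hT.smooth_snd
  rw [preimage_univ, contMDiffOn_univ] at h2
  exact ⟨{ toFun := fun m => (π m, S m)
           invFun := T
           left_inv := fun m => hT.total m (mem_univ _)
           right_inv := fun p => Prod.ext (hT.proj _ (mem_univ _) _) (hT.snd _ (mem_univ _) _)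
           contMDiff_toFun := hπ.prodMk h2
           contMDiff_invFun := h1 }, fun _ => rfl⟩

/-- A sphere bundle over the sphere with integrable horizontal distribution is trivial. -/
lemma IsSphereBundle.isTrivial_of_hasClosedHorizontalForms (h : IsSphereBundle π)
    (hg : HasClosedHorizontalForms g π) : IsTrivialSphereBundle π := by
  have hπ := h.contMDiff
  let q : S2 := ⟨EuclideanSpace.single 0 1, by simp⟩
  obtain ⟨V₀, hV₀, hqV₀, T₂, S₂, hT₂, hf₂⟩ := h.exists_isFlatOn hg (-q)
  obtain ⟨r, hr, hrV⟩ := exists_stereoParam_mem_of_norm_ge q hV₀ hqV₀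
  -- Simple connectivity of the disc enters here, through the convexity of the overlaps in the box
  -- induction.
  have hbox : ∃ T S, IsTrivOn π (stereoSet q (box (-(2 * r)) (2 * r) (-(2 * r)) (2 * r))) T S ∧
      IsFlatOn g π (stereoSet q (box (-(2 * r)) (2 * r) (-(2 * r)) (2 * r))) T := by
    refine box_induction (P := fun s => ∃ T S, IsTrivOn π (stereoSet q s) T S ∧
      IsFlatOn g π (stereoSet q s) T) ?_ ?_ ?_ _ _ _ _
    · rintro s t hst ⟨T, S, hT, hf⟩
      have hsub : stereoSet q s ⊆ stereoSet q t := inter_subset_inter_right _ (preimage_mono hst)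
      exact ⟨T, S, hT.mono hsub, hf.mono hsub⟩
    · intro y
      obtain ⟨U, hU, hy, T, S, hT, hf⟩ := h.exists_isFlatOn hg (stereoParam q y)
      have hsub : stereoSet q (stereoParam q ⁻¹' U) ⊆ U := by
        rintro b ⟨hb, hb'⟩
        simpa [stereoParam_chartAt hb] using hb'
      exact ⟨stereoParam q ⁻¹' U, (hU.preimage (contMDiff_stereoParam q).continuous).mem_nhds hy,
        T, S, hT.mono hsub, hf.mono hsub⟩
    · rintro i K a a' b b' hK hKc hKi h1 h2 h3 ⟨T₁, S₁, hT₁, hf₁⟩ ⟨T₂, S₂, hT₂, hf₂⟩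
      by_cases hne : (K ∩ {y | a' < y i ∧ y i < b}).Nonempty
      · obtain ⟨z, hz⟩ := hne
        obtain ⟨T, S, hT, hf⟩ := IsFlatOn.glue hπ hT₁ hT₂ hf₁ hf₂
          (isOpen_stereoSet q (hK.inter (isOpen_slab _ _ _)))
          (isOpen_stereoSet q (hK.inter (isOpen_slab _ _ _)))
          (hK.inter (isOpen_slab i a' b)) (hKc.inter (convex_slab i a' b)).isPreconnected
          (q := q) (by
            ext x
            constructor
            · rintro ⟨⟨hx, hxK, hx1, hx2⟩, -, -, hx3, hx4⟩
              exact ⟨hx, hxK, hx3, hx2⟩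
            · rintro ⟨hx, hxK, hx1, hx2⟩
              exact ⟨⟨hx, hxK, h1.trans hx1, hx2⟩, hx, hxK, hx1, hx2.trans h3⟩) hz
        have hsub : stereoSet q (K ∩ {y | a < y i ∧ y i < b'}) ⊆
            stereoSet q (K ∩ {y | a < y i ∧ y i < b}) ∪
              stereoSet q (K ∩ {y | a' < y i ∧ y i < b'}) := by
          rintro x ⟨hx, hxK, hx1, hx2⟩
          by_cases hxm : (chartAt (EuclideanSpace ℝ (Fin 2)) q x) i < b
          · exact Or.inl ⟨hx, hxK, hx1, hxm⟩
          · exact Or.inr ⟨hx, hxK, by linarith, hx2⟩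
        exact ⟨T, S, hT.mono hsub, hf.mono hsub⟩
      -- `K` is a cylinder in the `i`-th direction, so any point of it could be moved into the
      -- overlap; an empty overlap therefore means `K = ∅`.
      · have hKe : K = ∅ := by
          rw [eq_empty_iff_forall_notMem]
          intro y hy
          refine hne ⟨coordMap i (fun _ => (a' + b) / 2) y,
            hKi y hy _ (fun j hj => coordMap_ne hj _ _), ?_⟩
          rw [mem_ofPred_eq, coordMap_self]
          constructor <;> linarith
        have hsub : stereoSet q (K ∩ {y | a < y i ∧ y i < b'}) ⊆
            stereoSet q (K ∩ {y | a < y i ∧ y i < b}) := by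
          rw [hKe, empty_inter, empty_inter]
        exact ⟨T₁, S₁, hT₁.mono hsub, hf₁.mono hsub⟩
  obtain ⟨T₁, S₁, hT₁, hf₁⟩ := hbox
  let U := stereoSet q (Metric.ball 0 (2 * r))
  have hUb : U ⊆ stereoSet q (box (-(2 * r)) (2 * r) (-(2 * r)) (2 * r)) := by
    refine inter_subset_inter_right _ (preimage_mono ?_)
    intro y hy
    have hy : ‖y‖ < 2 * r := by simpa using hy
    exact ⟨abs_lt.1 ((PiLp.norm_apply_le y 0).trans_lt hy),
      abs_lt.1 ((PiLp.norm_apply_le y 1).trans_lt hy)⟩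
  let V : Set S2 := (stereoParam q '' Metric.closedBall 0 r)ᶜ
  have hV : IsOpen V := ((isCompact_closedBall _ _).image
    (contMDiff_stereoParam q).continuous).isClosed.isOpen_compl
  have hVV₀ : V ⊆ V₀ := by
    intro b hb
    by_cases hbq : b ∈ (chartAt (EuclideanSpace ℝ (Fin 2)) q).source
    · rw [← stereoParam_chartAt hbq]
      refine hrV _ ?_
      by_contra hlt
      refine hb ⟨_, ?_, stereoParam_chartAt hbq⟩
      rw [mem_closedBall_zero_iff]
      linarith
    · rw [chartAt_S2_source] at hbq
      simp only [mem_compl_iff, mem_singleton_iff, not_not] at hbq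
      rwa [hbq]
  have hinter : U ∩ V = stereoSet q {y | r < ‖y‖ ∧ ‖y‖ < 2 * r ∧ 0 < ‖y‖} := by
    ext b
    constructor
    · rintro ⟨⟨hb, hb2⟩, hbV⟩
      have hb3 : r < ‖chartAt (EuclideanSpace ℝ (Fin 2)) q b‖ := by
        by_contra hlt
        exact hbV ⟨_, mem_closedBall_zero_iff.2 (not_lt.1 hlt), stereoParam_chartAt hb⟩
      exact ⟨hb, hb3, mem_ball_zero_iff.1 hb2, hr.trans hb3⟩
    · rintro ⟨hb, hb3, hb2, -⟩
      refine ⟨⟨hb, mem_ball_zero_iff.2 hb2⟩, ?_⟩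
      rintro ⟨y, hy, rfl⟩
      rw [chartAt_stereoParam] at hb3
      rw [mem_closedBall_zero_iff] at hy
      linarith
  have hO : IsOpen {y : EuclideanSpace ℝ (Fin 2) | r < ‖y‖ ∧ ‖y‖ < 2 * r ∧ 0 < ‖y‖} :=
    (isOpen_lt continuous_const continuous_norm).inter
      ((isOpen_lt continuous_norm continuous_const).inter
        (isOpen_lt continuous_const continuous_norm))
  have hz : EuclideanSpace.single 0 (3 / 2 * r) ∈
      {y : EuclideanSpace ℝ (Fin 2) | r < ‖y‖ ∧ ‖y‖ < 2 * r ∧ 0 < ‖y‖} := by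
    simp only [mem_ofPred_eq, PiLp.norm_single, Real.norm_eq_abs,
      abs_of_pos (show 0 < 3 / 2 * r by linarith)]
    refine ⟨?_, ?_, ?_⟩ <;> linarith
  -- The disc and the complement of a smaller closed disc meet in an annulus, which is connected, so
  -- the two flat trivializations combine to a global one.
  obtain ⟨T, S, hT, -⟩ := IsFlatOn.glue hπ (hT₁.mono hUb) (hT₂.mono hVV₀) (hf₁.mono hUb)
    (hf₂.mono hVV₀) (isOpen_stereoSet q Metric.isOpen_ball) hV hO isPreconnected_annulus hinter hz
  have huniv : U ∪ V = univ := by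
    rw [eq_univ_iff_forall]
    intro b
    by_cases hbV : b ∈ V
    · exact Or.inr hbV
    · left
      rw [notMem_compl_iff] at hbV
      obtain ⟨y, hy, rfl⟩ := hbV
      refine (stereoParam_mem_stereoSet q).2 ?_
      rw [mem_closedBall_zero_iff] at hy
      rw [mem_ball_zero_iff]
      linarith
  change IsTrivOn π (U ∪ V) T S at hT
  rw [huniv] at hT
  exact hT.isTrivialSphereBundle hπ

/-- The pullback of a volume form of the base of a nontrivial sphere bundle is not intrinsically
harmonic. -/
lemma IsSphereBundle.not_isIntrinsicallyHarmonic (h : IsSphereBundle π)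
    (hn : ¬ IsTrivialSphereBundle π) {dvol : DForm 2 2 S2} (hd : dvol.IsVolumeForm) :
    ¬ IsIntrinsicallyHarmonic (k := 2) (l := 2) (DForm.pullback π dvol : DForm 4 2 M) := by
  rintro ⟨-, g, hg⟩
  exact hn (h.isTrivial_of_hasClosedHorizontalForms (g := g)
    (h.exists_closed_form_of_hodgeDualIsClosed hd hg))

end FlatTrivialization

/-! ### The smooth structure on the total space of a bundle -/

section TotalSpace

variable {M ι : Type*} [TopologicalSpace M] {π : M → S2} (e : ι → Bundle.Trivialization S2 π)

/-- The smooth structure of `S² × S²`, with model space `ℝ⁴`. -/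
def sphereProdChart (p : S2 × S2) : OpenPartialHomeomorph (S2 × S2) (EuclideanSpace ℝ (Fin 4)) :=
  (chartAt (ModelProd (EuclideanSpace ℝ (Fin 2)) (EuclideanSpace ℝ (Fin 2))) p).trans
    prodPlaneEquiv.toHomeomorph.toOpenPartialHomeomorph

lemma sphereProdChart_source (p : S2 × S2) : (sphereProdChart p).source =
    (chartAt (ModelProd (EuclideanSpace ℝ (Fin 2)) (EuclideanSpace ℝ (Fin 2))) p).source := by
  simp [sphereProdChart]

lemma mem_sphereProdChart_source (p : S2 × S2) : p ∈ (sphereProdChart p).source := by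
  rw [sphereProdChart_source]
  exact mem_chart_source _ _

lemma contMDiffOn_sphereProdChart (p : S2 × S2) :
    ContMDiffOn ((𝓡 2).prod (𝓡 2)) (𝓡 4) ∞ (sphereProdChart p) (sphereProdChart p).source := by
  rw [sphereProdChart_source, prodChartedSpace_chartAt]
  have h1 := (contMDiffOn_chartAt_S2 p.1).comp
    (contMDiffOn_fst (I := 𝓡 2) (J := 𝓡 2) (n := ∞) (N := S2)
      (s := (chartAt (EuclideanSpace ℝ (Fin 2)) p.1).source ×ˢ
        (chartAt (EuclideanSpace ℝ (Fin 2)) p.2).source)) fun x hx => hx.1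
  have h2 := (contMDiffOn_chartAt_S2 p.2).comp
    (contMDiffOn_snd (I := 𝓡 2) (J := 𝓡 2) (n := ∞) (M := S2)
      (s := (chartAt (EuclideanSpace ℝ (Fin 2)) p.1).source ×ˢ
        (chartAt (EuclideanSpace ℝ (Fin 2)) p.2).source)) fun x hx => hx.2
  exact prodPlaneEquiv.contDiff.contMDiff.comp_contMDiffOn (h1.prodMk_space h2)

lemma contMDiffOn_sphereProdChart_symm (p : S2 × S2) :
    ContMDiffOn (𝓡 4) ((𝓡 2).prod (𝓡 2)) ∞ (sphereProdChart p).symm (sphereProdChart p).target := by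
  have hκ := prodPlaneEquiv.symm.contDiff (n := ∞)
  have h1 := (contMDiff_stereoParam p.1).comp (contDiff_fst.comp hκ).contMDiff
  have h2 := (contMDiff_stereoParam p.2).comp (contDiff_snd.comp hκ).contMDiff
  exact (h1.prodMk h2).contMDiffOn

/-- The atlas of the total space of a bundle defined by a bundle atlas. -/
@[reducible]
def totalSpaceCharts (idx : S2 → ι) (hidx : ∀ b, b ∈ (e (idx b)).baseSet) :
    ChartedSpace (EuclideanSpace ℝ (Fin 4)) M where
  atlas := {φ | ∃ i p, φ = (e i).toOpenPartialHomeomorph.trans (sphereProdChart p)}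
  chartAt m := (e (idx (π m))).toOpenPartialHomeomorph.trans
    (sphereProdChart (e (idx (π m)) m))
  mem_chart_source m := by
    have h : m ∈ (e (idx (π m))).source := (e _).mem_source.2 (hidx _)
    refine ⟨h, ?_⟩
    exact mem_sphereProdChart_source _
  chart_mem_atlas m := ⟨_, _, rfl⟩

variable (he : ∀ i j, ContMDiffOn ((𝓡 2).prod (𝓡 2)) ((𝓡 2).prod (𝓡 2)) ∞
    (fun p => e j ((e i).toOpenPartialHomeomorph.symm p))
    (((e i).baseSet ∩ (e j).baseSet) ×ˢ univ))

include he in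
lemma isManifold_totalSpaceCharts (idx : S2 → ι) (hidx : ∀ b, b ∈ (e (idx b)).baseSet) :
    letI := totalSpaceCharts e idx hidx
    IsManifold (𝓡 4) ∞ M := by
  letI := totalSpaceCharts e idx hidx
  refine isManifold_of_contDiffOn _ _ _ ?_
  rintro _ _ ⟨i, p, rfl⟩ ⟨j, q, rfl⟩
  rw [← contMDiffOn_iff_contDiffOn]
  have h := (contMDiffOn_sphereProdChart q).comp' ((he i j).comp'
    (contMDiffOn_sphereProdChart_symm p))
  refine h.mono ?_
  rintro y ⟨hy, -⟩
  simp only [OpenPartialHomeomorph.trans_symm_eq_symm_trans_symm, OpenPartialHomeomorph.trans_source,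
    OpenPartialHomeomorph.symm_source, mem_inter_iff, mem_preimage, modelWithCornersSelf_coe_symm,
    id_eq, OpenPartialHomeomorph.coe_trans, Function.comp_apply] at hy
  obtain ⟨⟨h1, h2⟩, h3, h4⟩ := hy
  have h2' := (e i).mem_target.1 h2
  have h3' := (e j).mem_source.1 h3
  rw [(e i).proj_symm_apply h2] at h3'
  exact ⟨⟨h1, ⟨h2', h3'⟩, trivial⟩, h4⟩

-- Near a point, `e k` differs from the trivialization that defines the preferred chart by a
-- transition map, which is smooth by `he`.
include he in
lemma contMDiffOn_trivialization_totalSpaceCharts (idx : S2 → ι) (hidx : ∀ b, b ∈ (e (idx b)).baseSet) :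
    letI := totalSpaceCharts e idx hidx
    ∀ k, ContMDiffOn (𝓡 4) ((𝓡 2).prod (𝓡 2)) ∞ (e k) (e k).source ∧
      ContMDiffOn ((𝓡 2).prod (𝓡 2)) (𝓡 4) ∞ (e k).toOpenPartialHomeomorph.symm (e k).target := by
  letI := totalSpaceCharts e idx hidx
  have := isManifold_totalSpaceCharts e he idx hidx
  intro k
  refine ⟨?_, ?_⟩
  · intro m hm
    have h1 := contMDiffAt_of_mem_maximalAtlas (I := 𝓡 4) (n := ∞)
      (IsManifold.chart_mem_maximalAtlas m) (mem_chart_source (EuclideanSpace ℝ (Fin 4)) m)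
    set φ := chartAt (EuclideanSpace ℝ (Fin 4)) m with hφ
    have hms : m ∈ (e (idx (π m))).source := (e _).mem_source.2 (hidx _)
    have h2 : ContMDiffAt (𝓡 4) ((𝓡 2).prod (𝓡 2)) ∞
        (sphereProdChart (e (idx (π m)) m)).symm (φ m) := by
      refine (contMDiffOn_sphereProdChart_symm _).contMDiffAt
        ((sphereProdChart _).open_target.mem_nhds ?_)
      exact (sphereProdChart _).map_source (mem_sphereProdChart_source _)
    have hv : (sphereProdChart (e (idx (π m)) m)).symm (φ m) = e (idx (π m)) m :=
      (sphereProdChart _).left_inv (mem_sphereProdChart_source _)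
    have h3 := (he (idx (π m)) k).contMDiffAt
      (x := e (idx (π m)) m) (((((e _).open_baseSet.inter (e _).open_baseSet).prod
        isOpen_univ)).mem_nhds ⟨⟨?_, ?_⟩, trivial⟩)
    · rw [← hv] at h3
      have h4 := h3.comp m (h2.comp m h1)
      refine (h4.congr_of_eventuallyEq ?_).contMDiffWithinAt
      filter_upwards [φ.open_source.mem_nhds (mem_chart_source _ m)] with m' hm'
      have h5 : (sphereProdChart (e (idx (π m)) m)).symm (φ m') = e (idx (π m)) m' :=
        (sphereProdChart _).left_inv hm'.2
      simp only [Function.comp_apply]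
      rw [h5]
      congr 1
      exact ((e (idx (π m))).left_inv hm'.1).symm
    · rw [(e _).coe_fst hms]; exact hidx _
    · rw [(e _).coe_fst hms]; exact (e _).mem_source.1 hm
  · intro p hp
    let m := (e k).toOpenPartialHomeomorph.symm p
    have hmb : m ∈ (e k).source := (e k).map_target hp
    have hmp : e k m = p := (e k).right_inv hp
    have hpm : π m = p.1 := (e k).proj_symm_apply hp
    have hms : m ∈ (e (idx (π m))).source := (e _).mem_source.2 (hidx _)
    have hpc : e (idx (π m)) m ∈ (sphereProdChart (e (idx (π m)) m)).source := mem_sphereProdChart_source _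
    have h1 := contMDiffOn_chart_symm (I := 𝓡 4) (n := ∞) (x := m)
    set φ := chartAt (EuclideanSpace ℝ (Fin 4)) m with hφ
    have h1 := h1.contMDiffAt (φ.open_target.mem_nhds (φ.map_source (mem_chart_source _ m)))
    have h2 := (contMDiffOn_sphereProdChart (e (idx (π m)) m)).contMDiffAt
      ((sphereProdChart _).open_source.mem_nhds hpc)
    have h3 := (he k (idx (π m))).contMDiffAt
      (x := p) (((((e _).open_baseSet.inter (e _).open_baseSet).prod
        isOpen_univ)).mem_nhds ⟨⟨(e _).mem_target.1 hp, by rw [← hpm]; exact hidx _⟩, trivial⟩)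
    have h4 := ContMDiffAt.comp p
      (f := fun p => e (idx (π m)) ((e k).toOpenPartialHomeomorph.symm p)) h2 h3
    have h5 := ContMDiffAt.comp p h1 h4
    refine (h5.congr_of_eventuallyEq ?_).contMDiffWithinAt
    have hcont : ContinuousAt (e k).toOpenPartialHomeomorph.symm p :=
      (e k).toOpenPartialHomeomorph.symm.continuousAt hp
    filter_upwards [hcont.preimage_mem_nhds (φ.open_source.mem_nhds (mem_chart_source _ m))]
      with p' hp'
    exact (φ.left_inv hp').symm

include he in
lemma isSphereBundle_totalSpaceCharts (idx : S2 → ι) (hidx : ∀ b, b ∈ (e (idx b)).baseSet) :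
    letI := totalSpaceCharts e idx hidx
    IsSphereBundle π :=
  fun b => ⟨e (idx b), hidx b, contMDiffOn_trivialization_totalSpaceCharts e he idx hidx (idx b)⟩

lemma t2Space_of_trivialization (he' : ∀ b, ∃ e : Bundle.Trivialization S2 π, b ∈ e.baseSet)
    (hπ : Continuous π) : T2Space M := by
  refine ⟨fun x y hxy => ?_⟩
  by_cases h : π x = π y
  · obtain ⟨e, he⟩ := he' (π x)
    have hx : x ∈ e.source := e.mem_source.2 he
    have hy : y ∈ e.source := e.mem_source.2 (h ▸ he)
    obtain ⟨U, V, hU, hV, hxU, hyV, hUV⟩ := t2_separation (e.injOn.ne hx hy hxy)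
    refine ⟨e.source ∩ e ⁻¹' U, e.source ∩ e ⁻¹' V,
      e.toOpenPartialHomeomorph.isOpen_inter_preimage hU,
      e.toOpenPartialHomeomorph.isOpen_inter_preimage hV, ⟨hx, hxU⟩, ⟨hy, hyV⟩, ?_⟩
    exact Disjoint.mono inter_subset_right inter_subset_right (hUV.preimage _)
  · obtain ⟨U, V, hU, hV, hxU, hyV, hUV⟩ := t2_separation h
    exact ⟨π ⁻¹' U, π ⁻¹' V, hU.preimage hπ, hV.preimage hπ, hxU, hyV, hUV.preimage _⟩

/-- The part of `M` over a compact set in a trivializing neighbourhood is the image of that set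
times `S²`; finitely many such sets cover the base. -/
lemma compactSpace_of_trivialization
    (he' : ∀ b, ∃ e : Bundle.Trivialization S2 π, b ∈ e.baseSet) : CompactSpace M := by
  have key : ∃ K : Set M, IsCompact K ∧ π ⁻¹' univ ⊆ K := by
    refine (isCompact_univ (X := S2)).induction_on (p := fun s => ∃ K : Set M, IsCompact K ∧ π ⁻¹' s ⊆ K)
      ⟨∅, isCompact_empty, by simp⟩ ?_ ?_ ?_
    · rintro s t hst ⟨K, hK, h⟩
      exact ⟨K, hK, (preimage_mono hst).trans h⟩
    · rintro s t ⟨K, hK, h⟩ ⟨K', hK', h'⟩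
      exact ⟨K ∪ K', hK.union hK', by rw [preimage_union]; exact union_subset_union h h'⟩
    · intro b _
      obtain ⟨e, he⟩ := he' b
      obtain ⟨C, hCn, hCs, hC⟩ := local_compact_nhds (e.open_baseSet.mem_nhds he)
      refine ⟨C, nhdsWithin_le_nhds hCn, e.toOpenPartialHomeomorph.symm '' (C ×ˢ univ), ?_, ?_⟩
      · refine (hC.prod isCompact_univ).image_of_continuousOn
          (e.toOpenPartialHomeomorph.symm.continuousOn.mono ?_)
        rintro p ⟨hp, -⟩
        exact e.mem_target.2 (hCs hp)
      · intro m hm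
        have hms : m ∈ e.source := e.mem_source.2 (hCs hm)
        refine ⟨e m, ⟨?_, trivial⟩, e.left_inv hms⟩
        rw [e.coe_fst hms]
        exact hm
  obtain ⟨K, hK, h⟩ := key
  exact ⟨by rwa [← univ_subset_iff.1 h]⟩

end TotalSpace

/-! ### The bundle glued by one full rotation -/

section Clutching

/-- The rotation with matrix `(c, -s; s, c)` in the horizontal plane. -/
def rotVec (c s : ℝ) (y : EuclideanSpace ℝ (Fin 3)) : EuclideanSpace ℝ (Fin 3) :=
  !₂[c * y 0 - s * y 1, s * y 0 + c * y 1, y 2]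

lemma sum_sq_S2 (y : S2) : (y : EuclideanSpace ℝ (Fin 3)) 0 ^ 2 +
    (y : EuclideanSpace ℝ (Fin 3)) 1 ^ 2 + (y : EuclideanSpace ℝ (Fin 3)) 2 ^ 2 = 1 := by
  have h := norm_eq_of_mem_sphere y
  rw [EuclideanSpace.norm_eq, Real.sqrt_eq_one, Fin.sum_univ_three] at h
  simpa using h

lemma norm_rotVec {c s : ℝ} (h : c ^ 2 + s ^ 2 = 1) (y : S2) : ‖rotVec c s y‖ = 1 := by
  have h' := sum_sq_S2 y
  rw [EuclideanSpace.norm_eq, Real.sqrt_eq_one, Fin.sum_univ_three]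
  simp only [rotVec, Real.norm_eq_abs, sq_abs]
  simp
  linear_combination h' + ((y : EuclideanSpace ℝ (Fin 3)) 0 ^ 2 +
    (y : EuclideanSpace ℝ (Fin 3)) 1 ^ 2) * h

/-- The distance to the vertical axis. -/
def axisDist (b : S2) : ℝ :=
  √((b : EuclideanSpace ℝ (Fin 3)) 0 ^ 2 + (b : EuclideanSpace ℝ (Fin 3)) 1 ^ 2)

/-- The point `y` rotated by the longitude of `b`, or by its opposite. -/
def clutch (σ : ℝ) (b y : S2) : S2 :=
  unitVec (rotVec ((b : EuclideanSpace ℝ (Fin 3)) 0 / axisDist b)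
    (σ * ((b : EuclideanSpace ℝ (Fin 3)) 1 / axisDist b)) y)

/-- The sphere without the poles. -/
def punctured : Set S2 :=
  {b | (b : EuclideanSpace ℝ (Fin 3)) 0 ^ 2 + (b : EuclideanSpace ℝ (Fin 3)) 1 ^ 2 ≠ 0}

lemma sq_div_axisDist {b : S2} (hb : b ∈ punctured) {σ : ℝ} (hσ : σ ^ 2 = 1) :
    ((b : EuclideanSpace ℝ (Fin 3)) 0 / axisDist b) ^ 2 +
      (σ * ((b : EuclideanSpace ℝ (Fin 3)) 1 / axisDist b)) ^ 2 = 1 := by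
  have h : axisDist b ^ 2 = _ := Real.sq_sqrt (by positivity)
  have h' : axisDist b ^ 2 ≠ 0 := by rw [h]; exact hb
  rw [mul_pow, div_pow, div_pow, hσ, one_mul, ← add_div, div_eq_one_iff_eq h', h]

lemma coe_clutch {b : S2} (hb : b ∈ punctured) {σ : ℝ} (hσ : σ ^ 2 = 1) (y : S2) :
    (clutch σ b y : EuclideanSpace ℝ (Fin 3)) =
      rotVec ((b : EuclideanSpace ℝ (Fin 3)) 0 / axisDist b)
        (σ * ((b : EuclideanSpace ℝ (Fin 3)) 1 / axisDist b)) y :=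
  coe_unitVec_of_norm (norm_rotVec (sq_div_axisDist hb hσ) y)

lemma clutch_neg_clutch {b : S2} (hb : b ∈ punctured) {σ : ℝ} (hσ : σ ^ 2 = 1) (y : S2) :
    clutch (-σ) b (clutch σ b y) = y := by
  refine Subtype.ext ?_
  have h := sq_div_axisDist hb hσ
  rw [coe_clutch hb (by simpa using hσ), coe_clutch hb hσ]
  ext i
  fin_cases i
  · simp [rotVec]
    linear_combination (y : EuclideanSpace ℝ (Fin 3)) 0 * h
  · simp [rotVec]
    linear_combination (y : EuclideanSpace ℝ (Fin 3)) 1 * h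
  · simp [rotVec]

lemma contMDiffOn_clutch {σ : ℝ} (hσ : σ ^ 2 = 1) :
    ContMDiffOn ((𝓡 2).prod (𝓡 2)) (𝓡 2) ∞ (fun p : S2 × S2 => clutch σ p.1 p.2)
      (punctured ×ˢ univ) := by
  rintro ⟨b, y⟩ ⟨hb, -⟩
  refine ContMDiffAt.contMDiffWithinAt ?_
  have h1 : ContMDiff ((𝓡 2).prod (𝓡 2)) 𝓘(ℝ, EuclideanSpace ℝ (Fin 3)) ∞
      (fun p : S2 × S2 => (p.1 : EuclideanSpace ℝ (Fin 3))) :=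
    contMDiff_coe_S2.comp contMDiff_fst
  have h2 : ContMDiff ((𝓡 2).prod (𝓡 2)) 𝓘(ℝ, EuclideanSpace ℝ (Fin 3)) ∞
      (fun p : S2 × S2 => (p.2 : EuclideanSpace ℝ (Fin 3))) :=
    contMDiff_coe_S2.comp contMDiff_snd
  let r : EuclideanSpace ℝ (Fin 3) → ℝ := fun b => √(b 0 ^ 2 + b 1 ^ 2)
  have hr0 : r b ≠ 0 := fun h => hb ((Real.sqrt_eq_zero (by positivity)).1 h)
  have hr : ContDiffAt ℝ ∞ r b := ContDiffAt.sqrt (by fun_prop) hb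
  have h3 : ContDiffAt ℝ ∞ (fun q : EuclideanSpace ℝ (Fin 3) × EuclideanSpace ℝ (Fin 3) =>
      rotVec (q.1 0 / r q.1) (σ * (q.1 1 / r q.1)) q.2)
      ((b : EuclideanSpace ℝ (Fin 3)), (y : EuclideanSpace ℝ (Fin 3))) := by
    have hr' : ContDiffAt ℝ ∞ (fun q : EuclideanSpace ℝ (Fin 3) × EuclideanSpace ℝ (Fin 3) => r q.1)
      ((b : EuclideanSpace ℝ (Fin 3)), (y : EuclideanSpace ℝ (Fin 3))) :=
      ContDiffAt.comp (g := r) (f := Prod.fst) _ hr contDiffAt_fst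
    rw [contDiffAt_euclidean]
    intro i
    fin_cases i
    · simp only [rotVec, Fin.zero_eta, PiLp.toLp_apply, Matrix.cons_val_zero]
      fun_prop (disch := exact hr0)
    · simp only [rotVec, Fin.mk_one, PiLp.toLp_apply, Matrix.cons_val_one, Matrix.cons_val_zero]
      fun_prop (disch := exact hr0)
    · simp only [rotVec, Fin.reduceFinMk, PiLp.toLp_apply, Matrix.cons_val]
      fun_prop
  have h4 := ContMDiffAt.comp (b, y) (g := fun q : EuclideanSpace ℝ (Fin 3) × EuclideanSpace ℝ (Fin 3) =>
      rotVec (q.1 0 / r q.1) (σ * (q.1 1 / r q.1)) q.2)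
      (f := fun p : S2 × S2 => ((p.1 : EuclideanSpace ℝ (Fin 3)), (p.2 : EuclideanSpace ℝ (Fin 3))))
      h3.contMDiffAt (h1.prodMk_space h2 (b, y))
  refine ContMDiffAt.comp (b, y) (contMDiffAt_unitVec ?_) h4
  have := norm_rotVec (sq_div_axisDist hb hσ) y
  intro h
  change rotVec _ _ _ = 0 at h
  rw [show rotVec (_ / axisDist b) (σ * (_ / axisDist b)) y = 0 from h, norm_zero] at this
  exact zero_ne_one this

/-- The complement of the south pole (for `false`) or of the north pole (for `true`). -/
def poleCompl (i : Bool) : Set S2 := {b | (b : EuclideanSpace ℝ (Fin 3)) 2 ≠ if i then 1 else -1}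

lemma isOpen_poleCompl (i : Bool) : IsOpen (poleCompl i) :=
  isOpen_ne.preimage (f := fun b : S2 => (b : EuclideanSpace ℝ (Fin 3)) 2) (by fun_prop)

lemma mem_punctured {b : S2} {i j : Bool} (hij : i ≠ j) (hi : b ∈ poleCompl i)
    (hj : b ∈ poleCompl j) : b ∈ punctured := by
  have h := sum_sq_S2 b
  intro h0
  have h2 : (b : EuclideanSpace ℝ (Fin 3)) 2 ^ 2 = 1 := by linarith
  rcases eq_or_eq_neg_of_sq_eq_sq _ 1 (h2.trans (one_pow 2).symm) with h3 | h3 <;> cases i <;> cases j <;>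
    simp_all [poleCompl]

/-- The change of trivialization of the bundle with clutching map of degree one. -/
def clutchChange (i j : Bool) (b y : S2) : S2 :=
  if i = j then y else clutch (if i then -1 else 1) b y

lemma contMDiffOn_clutchChange (i j : Bool) :
    ContMDiffOn ((𝓡 2).prod (𝓡 2)) (𝓡 2) ∞ (fun p : S2 × S2 => clutchChange i j p.1 p.2)
      ((poleCompl i ∩ poleCompl j) ×ˢ univ) := by
  by_cases hij : i = j
  · simp only [clutchChange, hij, if_true]
    exact contMDiffOn_snd
  · simp only [clutchChange, hij, if_false]
    refine (contMDiffOn_clutch (by split_ifs <;> norm_num)).mono ?_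
    exact prod_mono (fun b hb => mem_punctured hij hb.1 hb.2) subset_rfl

/-- The nontrivial sphere bundle over the sphere. -/
def clutchCore : FiberBundleCore Bool S2 S2 where
  baseSet := poleCompl
  isOpen_baseSet := isOpen_poleCompl
  indexAt b := if (b : EuclideanSpace ℝ (Fin 3)) 2 = -1 then true else false
  mem_baseSet_at b := by
    by_cases h : (b : EuclideanSpace ℝ (Fin 3)) 2 = -1
    · simp [h, poleCompl]; norm_num
    · simp [h, poleCompl]
  coordChange := clutchChange
  coordChange_self i b _ y := if_pos rfl
  continuousOn_coordChange i j := (contMDiffOn_clutchChange i j).continuousOn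
  coordChange_comp i j k b hb y := by
    by_cases hij : i = j
    · subst hij
      simp [clutchChange]
    by_cases hjk : j = k
    · subst hjk
      simp [clutchChange]
    -- There are only two indices, so two genuine changes return to the start, and the cocycle
    -- condition reduces to a rotation followed by its inverse.
    have hik : i = k := by cases i <;> cases j <;> cases k <;> simp_all
    subst hik
    have hp := mem_punctured hij hb.1.1 hb.1.2
    simp only [clutchChange, hij, hjk, if_false, if_true]
    convert clutch_neg_clutch hp (σ := if i then -1 else 1) (by split_ifs <;> norm_num) y using 2
    cases i <;> cases j <;> simp_all

/-- The total space of the nontrivial sphere bundle over the sphere. -/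
abbrev ClutchSpace : Type := clutchCore.TotalSpace

lemma localTriv_clutchCore_symm (i j : Bool) {p : S2 × S2} (hp : p.1 ∈ poleCompl i ∩ poleCompl j) :
    clutchCore.localTriv j ((clutchCore.localTriv i).toOpenPartialHomeomorph.symm p) =
      (p.1, clutchChange i j p.1 p.2) :=
  Prod.ext rfl (clutchCore.coordChange_comp i (clutchCore.indexAt p.1) j p.1
    ⟨⟨hp.1, clutchCore.mem_baseSet_at _⟩, hp.2⟩ p.2)

lemma contMDiffOn_localTriv_clutchCore (i j : Bool) :
    ContMDiffOn ((𝓡 2).prod (𝓡 2)) ((𝓡 2).prod (𝓡 2)) ∞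
      (fun p => clutchCore.localTriv j ((clutchCore.localTriv i).toOpenPartialHomeomorph.symm p))
      (((clutchCore.localTriv i).baseSet ∩ (clutchCore.localTriv j).baseSet) ×ˢ univ) :=
  (contMDiffOn_fst.prodMk (contMDiffOn_clutchChange i j)).congr
    fun _ hp => localTriv_clutchCore_symm i j hp.1

instance : ChartedSpace (EuclideanSpace ℝ (Fin 4)) ClutchSpace :=
  totalSpaceCharts clutchCore.localTriv clutchCore.indexAt clutchCore.mem_baseSet_at

instance : IsManifold (𝓡 4) ∞ ClutchSpace :=
  isManifold_totalSpaceCharts _ contMDiffOn_localTriv_clutchCore _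
    clutchCore.mem_baseSet_at

lemma isSphereBundle_clutchCore : IsSphereBundle clutchCore.proj :=
  isSphereBundle_totalSpaceCharts _ contMDiffOn_localTriv_clutchCore _
    clutchCore.mem_baseSet_at

instance : T2Space ClutchSpace :=
  t2Space_of_trivialization
    (fun b => ⟨clutchCore.localTriv (clutchCore.indexAt b), clutchCore.mem_baseSet_at b⟩)
    clutchCore.continuous_proj

instance : CompactSpace ClutchSpace :=
  compactSpace_of_trivialization
    (fun b => ⟨clutchCore.localTriv (clutchCore.indexAt b), clutchCore.mem_baseSet_at b⟩)

end Clutching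

/-! ### Lifting isotropic vectors to spinors -/

section Spinors

/-- The squares fix `a` and `c` up to separate signs, and the product `a c` excludes mixed signs
unless one entry vanishes. -/
lemma spinor_eq_or_eq_neg {a c a' c' : ℂ} (h1 : a ^ 2 = a' ^ 2) (h2 : a * c = a' * c')
    (h3 : c ^ 2 = c' ^ 2) : (a = a' ∧ c = c') ∨ (a = -a' ∧ c = -c') := by
  rcases eq_or_eq_neg_of_sq_eq_sq _ _ h1 with ha | ha <;>
    rcases eq_or_eq_neg_of_sq_eq_sq _ _ h3 with hc | hc <;> subst ha <;> subst hc
  · simp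
  · have : a * c' = 0 := by linear_combination (-1 / 2 : ℂ) * h2
    rcases mul_eq_zero.1 this with h | h <;> simp [h]
  · have : a' * c = 0 := by linear_combination (-1 / 2 : ℂ) * h2
    rcases mul_eq_zero.1 this with h | h <;> simp [h]
  · simp

/-- Two continuous families of spinors with the same square agree up to a global sign. -/
lemma IsPreconnected.spinor_eq_or_eq_neg {X : Type*} [TopologicalSpace X] {S : Set X}
    (hS : IsPreconnected S) {a c a' c' : X → ℂ} (ha : ContinuousOn a S) (hc : ContinuousOn c S)
    (ha' : ContinuousOn a' S) (hc' : ContinuousOn c' S) (h0 : ∀ s ∈ S, a' s ≠ 0 ∨ c' s ≠ 0)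
    (h1 : ∀ s ∈ S, a s ^ 2 = a' s ^ 2) (h2 : ∀ s ∈ S, a s * c s = a' s * c' s)
    (h3 : ∀ s ∈ S, c s ^ 2 = c' s ^ 2) :
    (∀ s ∈ S, a s = a' s ∧ c s = c' s) ∨ (∀ s ∈ S, a s = -a' s ∧ c s = -c' s) := by
  -- `f` is the Hermitian product of the two spinors and `g` the squared norm of the second.
  -- Pointwise `f = ± g` and `g ≠ 0`, so by connectedness the sign is constant.
  let f : X → ℂ := fun s => a s * star (a' s) + c s * star (c' s)
  let g : X → ℂ := fun s => a' s * star (a' s) + c' s * star (c' s)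
  have hg : ∀ s ∈ S, g s ≠ 0 := by
    intro s hs h
    have h4 : g s = ((‖a' s‖ ^ 2 + ‖c' s‖ ^ 2 : ℝ) : ℂ) := by
      simp only [g, Complex.star_def, Complex.mul_conj']
      push_cast
      rfl
    rw [h4, Complex.ofReal_eq_zero] at h
    rcases h0 s hs with h5 | h5
    · have := norm_pos_iff.2 h5
      exact absurd h (ne_of_gt (by positivity))
    · have := norm_pos_iff.2 h5
      exact absurd h (ne_of_gt (by positivity))
  have hd := fun s hs => HarmonicForms.spinor_eq_or_eq_neg (h1 s hs) (h2 s hs) (h3 s hs)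
  have hsq : EqOn (f ^ 2) (g ^ 2) S := by
    intro s hs
    simp only [Pi.pow_apply, f, g]
    rcases hd s hs with ⟨h4, h5⟩ | ⟨h4, h5⟩ <;> rw [h4, h5]
    ring
  have hf : ContinuousOn f S := (ha.mul ha'.star).add (hc.mul hc'.star)
  have hgc : ContinuousOn g S := (ha'.mul ha'.star).add (hc'.mul hc'.star)
  rcases hS.eq_or_eq_neg_of_sq_eq hf hgc hsq (fun hs => hg _ hs) with h | h
  · left
    intro s hs
    refine (hd s hs).resolve_right fun h4 => ?_
    have h5 := h hs
    have h6 : f s = -g s := by simp only [f, g, h4.1, h4.2]; ring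
    exact hg s hs (by linear_combination (1 / 2 : ℂ) * (h6 - h5))
  · right
    intro s hs
    refine (hd s hs).resolve_left fun h4 => ?_
    have h5 : f s = -g s := h hs
    have h6 : f s = g s := by simp only [f, g, h4.1, h4.2]
    exact hg s hs (by linear_combination (1 / 2 : ℂ) * (h5 - h6))

/-- `(a, c)` is a continuous family of spinors over `s` with square `(x, y, z)`. -/
def IsSpinorLift (s : Set (EuclideanSpace ℝ (Fin 2))) (x y z a c : EuclideanSpace ℝ (Fin 2) → ℂ) :
    Prop :=
  ContinuousOn a s ∧ ContinuousOn c s ∧ ∀ p ∈ s, a p ^ 2 = x p ∧ a p * c p = y p ∧ c p ^ 2 = z p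

/-- Near a point with `x p ≠ 0` take for `a` a branch of the square root of `x`; then `c = y / a` is
forced, and `c² = z` follows from `x z = y²`. -/
lemma exists_isSpinorLift_nhds {x y z : EuclideanSpace ℝ (Fin 2) → ℂ} (hx : Continuous x)
    (hy : Continuous y) (h : ∀ p, x p * z p = y p ^ 2)
    {p : EuclideanSpace ℝ (Fin 2)} (hp : x p ≠ 0) :
    ∃ s ∈ 𝓝 p, ∃ a c, IsSpinorLift s x y z a c := by
  obtain ⟨w, hw⟩ := IsAlgClosed.exists_pow_nat_eq (x p) two_pos
  have hw0 : w ≠ 0 := by rintro rfl; exact hp (by rw [← hw]; simp)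
  let s : Set (EuclideanSpace ℝ (Fin 2)) := {q | x q / x p ∈ Complex.slitPlane}
  let a : EuclideanSpace ℝ (Fin 2) → ℂ := fun q => w * (x q / x p) ^ ((2 : ℕ) : ℂ)⁻¹
  have hs : IsOpen s := Complex.isOpen_slitPlane.preimage (hx.div_const _)
  have ha : ContinuousOn a s :=
    continuousOn_const.mul ((hx.div_const _).continuousOn.cpow_const fun q hq => hq)
  have ha2 : ∀ q, a q ^ 2 = x q := by
    intro q
    simp only [a, mul_pow]
    rw [Complex.cpow_nat_inv_pow _ two_ne_zero, hw, mul_div_cancel₀ _ hp]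
  have hx0 : ∀ q ∈ s, x q ≠ 0 := by
    intro q hq h0
    have := Complex.slitPlane_ne_zero hq
    simp [h0] at this
  have ha0 : ∀ q ∈ s, a q ≠ 0 := fun q hq h0 => hx0 q hq (by rw [← ha2, h0]; simp)
  refine ⟨s, hs.mem_nhds (by simp [s, div_self hp, Complex.one_mem_slitPlane]), a,
    fun q => y q / a q, ha, hy.continuousOn.div ha ha0, fun q hq => ⟨ha2 q, ?_, ?_⟩⟩
  · exact mul_div_cancel₀ _ (ha0 q hq)
  · rw [div_pow, ha2, ← h, mul_comm, mul_div_assoc, div_self (hx0 q hq), mul_one]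

/-- Families of isotropic vectors parametrized by a box lift to spinors. -/
lemma exists_isSpinorLift_box {x y z : EuclideanSpace ℝ (Fin 2) → ℂ} (hx : Continuous x)
    (hy : Continuous y) (hz : Continuous z) (h : ∀ p, x p * z p = y p ^ 2)
    (h0 : ∀ p, x p ≠ 0 ∨ z p ≠ 0) (α β γ δ : ℝ) :
    ∃ a c, IsSpinorLift (box α β γ δ) x y z a c := by
  refine box_induction (P := fun s => ∃ a c, IsSpinorLift s x y z a c) ?_ ?_ ?_ α β γ δ
  · rintro s t hst ⟨a, c, ha, hc, hac⟩
    exact ⟨a, c, ha.mono hst, hc.mono hst, fun p hp => hac p (hst hp)⟩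
  · intro p
    rcases h0 p with hp | hp
    · exact exists_isSpinorLift_nhds hx hy h hp
    -- Where only `z` is known to be nonzero, the roles of `x` and `z` are exchanged.
    · obtain ⟨s, hs, a, c, ha, hc, hac⟩ :=
        exists_isSpinorLift_nhds hz hy (fun p => by rw [mul_comm, h]) hp
      exact ⟨s, hs, c, a, hc, ha, fun q hq =>
        ⟨(hac q hq).2.2, by rw [mul_comm]; exact (hac q hq).2.1, (hac q hq).1⟩⟩
  · rintro i K t₁ t₁' t₂ t₂' hK hKc - h1 h2 h3 ⟨a, c, ha, hc, hac⟩ ⟨a', c', ha', hc', hac'⟩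
    -- On the convex overlap the two lifts agree up to a global sign, and the second lift may be
    -- replaced by its negative.
    have key : ∃ a' c', IsSpinorLift (K ∩ {y | t₁' < y i ∧ y i < t₂'}) x y z a' c' ∧
        ∀ p ∈ K ∩ {y | t₁' < y i ∧ y i < t₂}, a p = a' p ∧ c p = c' p := by
      have hsub1 : K ∩ {y | t₁' < y i ∧ y i < t₂} ⊆ K ∩ {y | t₁ < y i ∧ y i < t₂} :=
        inter_subset_inter_right _ fun p hp => ⟨h1.trans hp.1, hp.2⟩
      have hsub2 : K ∩ {y | t₁' < y i ∧ y i < t₂} ⊆ K ∩ {y | t₁' < y i ∧ y i < t₂'} :=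
        inter_subset_inter_right _ fun p hp => ⟨hp.1, hp.2.trans h3⟩
      have hor := IsPreconnected.spinor_eq_or_eq_neg
        (hKc.inter (convex_slab i t₁' t₂)).isPreconnected
        (ha.mono hsub1) (hc.mono hsub1) (ha'.mono hsub2) (hc'.mono hsub2) ?_ ?_ ?_ ?_
      · rcases hor with h4 | h4
        · exact ⟨a', c', ⟨ha', hc', hac'⟩, h4⟩
        · refine ⟨fun p => -a' p, fun p => -c' p, ⟨ha'.neg, hc'.neg, ?_⟩, h4⟩
          simpa using hac'
      · intro p hp
        have h5 := hac' p (hsub2 hp)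
        refine (h0 p).imp ?_ ?_
        · rw [← h5.1]; exact fun h => by simpa using h
        · rw [← h5.2.2]; exact fun h => by simpa using h
      · intro p hp; rw [(hac p (hsub1 hp)).1, (hac' p (hsub2 hp)).1]
      · intro p hp; rw [(hac p (hsub1 hp)).2.1, (hac' p (hsub2 hp)).2.1]
      · intro p hp; rw [(hac p (hsub1 hp)).2.2, (hac' p (hsub2 hp)).2.2]
    obtain ⟨a', c', ⟨ha', hc', hac'⟩, heq⟩ := key
    classical
    let A : EuclideanSpace ℝ (Fin 2) → ℂ := fun p => if p i < t₂ then a p else a' p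
    let C : EuclideanSpace ℝ (Fin 2) → ℂ := fun p => if p i < t₂ then c p else c' p
    have e1 : ∀ p ∈ K ∩ {y | t₁ < y i ∧ y i < t₂}, A p = a p ∧ C p = c p := by
      rintro p ⟨-, -, hp⟩
      simp [A, C, hp]
    have e2 : ∀ p ∈ K ∩ {y | t₁' < y i ∧ y i < t₂'}, A p = a' p ∧ C p = c' p := by
      rintro p ⟨hpK, hp, -⟩
      by_cases hp' : p i < t₂
      · have := heq p ⟨hpK, hp, hp'⟩
        simp [A, C, hp', this]
      · simp [A, C, hp']
    have hun : K ∩ {y | t₁ < y i ∧ y i < t₂'} ⊆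
        K ∩ {y | t₁ < y i ∧ y i < t₂} ∪ K ∩ {y | t₁' < y i ∧ y i < t₂'} := by
      rintro p ⟨hpK, hp1, hp2⟩
      by_cases hp' : p i < t₂
      · exact Or.inl ⟨hpK, hp1, hp'⟩
      · exact Or.inr ⟨hpK, by linarith, hp2⟩
    have o1 := hK.inter (isOpen_slab i t₁ t₂)
    have o2 := hK.inter (isOpen_slab i t₁' t₂')
    refine ⟨A, C, ?_, ?_, ?_⟩
    · exact (ContinuousOn.union_of_isOpen (ha.congr fun p hp => (e1 p hp).1)
        (ha'.congr fun p hp => (e2 p hp).1) o1 o2).mono hun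
    · exact (ContinuousOn.union_of_isOpen (hc.congr fun p hp => (e1 p hp).2)
        (hc'.congr fun p hp => (e2 p hp).2) o1 o2).mono hun
    · intro p hp
      rcases hun hp with hp | hp
      · rw [(e1 p hp).1, (e1 p hp).2]; exact hac p hp
      · rw [(e2 p hp).1, (e2 p hp).2]; exact hac' p hp

/-- Two families of isotropic vectors over a disc cannot differ by a full turn on the boundary. -/
lemma not_full_turn {x y z x' y' z' : EuclideanSpace ℝ (Fin 2) → ℂ} (hx : Continuous x)
    (hy : Continuous y) (hz : Continuous z) (hx' : Continuous x') (hy' : Continuous y')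
    (hz' : Continuous z') (h : ∀ p, x p * z p = y p ^ 2) (h' : ∀ p, x' p * z' p = y' p ^ 2)
    (h0 : ∀ p, x p ≠ 0 ∨ z p ≠ 0) (h0' : ∀ p, x' p ≠ 0 ∨ z' p ≠ 0)
    (hturn : ∀ t : ℝ, x !₂[Real.cos t, Real.sin t] =
        Complex.exp (t * Complex.I) * x' !₂[Real.cos t, Real.sin t] ∧
      y !₂[Real.cos t, Real.sin t] =
        Complex.exp (t * Complex.I) * y' !₂[Real.cos t, Real.sin t] ∧
      z !₂[Real.cos t, Real.sin t] =
        Complex.exp (t * Complex.I) * z' !₂[Real.cos t, Real.sin t]) : False := by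
  obtain ⟨a, c, ha, hc, hac⟩ := exists_isSpinorLift_box hx hy hz h h0 (-2) 2 (-2) 2
  obtain ⟨a', c', ha', hc', hac'⟩ := exists_isSpinorLift_box hx' hy' hz' h' h0' (-2) 2 (-2) 2
  let κ : ℝ → EuclideanSpace ℝ (Fin 2) := fun t => !₂[Real.cos t, Real.sin t]
  have hκ : Continuous κ := by fun_prop
  have hb : ∀ t, κ t ∈ box (-2) 2 (-2) 2 := by
    intro t
    have h1 := Real.neg_one_le_cos t
    have h2 := Real.cos_le_one t
    have h3 := Real.neg_one_le_sin t
    have h4 := Real.sin_le_one t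
    change (_ < Real.cos t ∧ Real.cos t < _) ∧ (_ < Real.sin t ∧ Real.sin t < _)
    exact ⟨⟨by linarith, by linarith⟩, by linarith, by linarith⟩
  -- The half-angle factor is a square root of the full turn. The first lift is `± η` times the
  -- second with a constant sign; both lifts close up after `2π`, whereas `η` passes from `1` to
  -- `-1`.
  let η : ℝ → ℂ := fun t => Complex.exp (t / 2 * Complex.I)
  have hη : Continuous η := by fun_prop
  have hη2 : ∀ t : ℝ, η t ^ 2 = Complex.exp (t * Complex.I) := by
    intro t
    simp only [η]
    rw [← Complex.exp_nat_mul]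
    congr 1
    push_cast
    ring
  have c1 := ha.comp_continuous hκ hb
  have c2 := hc.comp_continuous hκ hb
  have c3 := ha'.comp_continuous hκ hb
  have c4 := hc'.comp_continuous hκ hb
  have hnz : ∀ t, η t * a' (κ t) ≠ 0 ∨ η t * c' (κ t) ≠ 0 := by
    intro t
    have h5 := hac' _ (hb t)
    refine (h0' (κ t)).imp (fun hx => mul_ne_zero (Complex.exp_ne_zero _) ?_)
      (fun hx => mul_ne_zero (Complex.exp_ne_zero _) ?_)
    · rintro h6; rw [← h5.1, h6] at hx; simp at hx
    · rintro h6; rw [← h5.2.2, h6] at hx; simp at hx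
  have e0 : κ 0 = κ (2 * Real.pi) := by simp [κ]
  have eη0 : η 0 = 1 := by simp [η]
  have eη1 : η (2 * Real.pi) = -1 := by
    simp only [η]
    push_cast
    rw [mul_div_cancel_left₀ _ two_ne_zero, Complex.exp_pi_mul_I]
  have n0 := hnz 0
  rw [eη0, one_mul, one_mul] at n0
  have hor : (∀ t, a (κ t) = η t * a' (κ t) ∧ c (κ t) = η t * c' (κ t)) ∨
      (∀ t, a (κ t) = -(η t * a' (κ t)) ∧ c (κ t) = -(η t * c' (κ t))) := by
    have := IsPreconnected.spinor_eq_or_eq_neg isPreconnected_univ (a := fun t => a (κ t))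
      (c := fun t => c (κ t)) (a' := fun t => η t * a' (κ t)) (c' := fun t => η t * c' (κ t))
      c1.continuousOn c2.continuousOn (hη.mul c3).continuousOn (hη.mul c4).continuousOn
      (fun t _ => hnz t) ?_ ?_ ?_
    · simpa only [mem_univ, forall_true_left] using this
    · intro t _
      rw [mul_pow, hη2, (hac _ (hb t)).1, (hac' _ (hb t)).1]
      exact (hturn t).1
    · intro t _
      have : η t * a' (κ t) * (η t * c' (κ t)) = η t ^ 2 * (a' (κ t) * c' (κ t)) := by ring
      rw [this, hη2, (hac _ (hb t)).2.1, (hac' _ (hb t)).2.1]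
      exact (hturn t).2.1
    · intro t _
      rw [mul_pow, hη2, (hac _ (hb t)).2.2, (hac' _ (hb t)).2.2]
      exact (hturn t).2.2
  rcases hor with h5 | h5
  · have h6 := h5 0
    have h7 := h5 (2 * Real.pi)
    rw [← e0, eη1] at h7
    rw [eη0] at h6
    rcases n0 with n0 | n0
    · exact n0 (by linear_combination (1 / 2 : ℂ) * (h7.1 - h6.1))
    · exact n0 (by linear_combination (1 / 2 : ℂ) * (h7.2 - h6.2))
  · have h6 := h5 0
    have h7 := h5 (2 * Real.pi)
    rw [← e0, eη1] at h7
    rw [eη0] at h6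
    rcases n0 with n0 | n0
    · exact n0 (by linear_combination (1 / 2 : ℂ) * (h6.1 - h7.1))
    · exact n0 (by linear_combination (1 / 2 : ℂ) * (h6.2 - h7.2))

end Spinors

/-! ### Isotropic vectors of frames in three-space -/

section IsotropicVectors

/-- The cross product `u × v`. -/
def crossVec (u v : EuclideanSpace ℝ (Fin 3)) : EuclideanSpace ℝ (Fin 3) :=
  !₂[u 1 * v 2 - u 2 * v 1, u 2 * v 0 - u 0 * v 2, u 0 * v 1 - u 1 * v 0]

/-- The length of the cross product `u × v`. -/
def crossNorm (u v : EuclideanSpace ℝ (Fin 3)) : ℝ :=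
  √(crossVec u v 0 ^ 2 + crossVec u v 1 ^ 2 + crossVec u v 2 ^ 2)

/-- The complex vector `u - iv`. -/
def cplxVec (u v : EuclideanSpace ℝ (Fin 3)) (i : Fin 3) : ℂ := u i - Complex.I * v i

/-- The isotropic vector `|n| m - i n × m` associated with `m = u - iv` and `n = u × v`. -/
def isoVec (u v : EuclideanSpace ℝ (Fin 3)) : Fin 3 → ℂ :=
  ![crossNorm u v * cplxVec u v 0 -
      Complex.I * (crossVec u v 1 * cplxVec u v 2 - crossVec u v 2 * cplxVec u v 1),
    crossNorm u v * cplxVec u v 1 -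
      Complex.I * (crossVec u v 2 * cplxVec u v 0 - crossVec u v 0 * cplxVec u v 2),
    crossNorm u v * cplxVec u v 2 -
      Complex.I * (crossVec u v 0 * cplxVec u v 1 - crossVec u v 1 * cplxVec u v 0)]

lemma crossNorm_sq (u v : EuclideanSpace ℝ (Fin 3)) : crossNorm u v ^ 2 =
    crossVec u v 0 ^ 2 + crossVec u v 1 ^ 2 + crossVec u v 2 ^ 2 := Real.sq_sqrt (by positivity)

lemma crossVec_cplxVec (u v : EuclideanSpace ℝ (Fin 3)) :
    crossVec u v 0 * cplxVec u v 0 + crossVec u v 1 * cplxVec u v 1 +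
      crossVec u v 2 * cplxVec u v 2 = 0 := by
  simp [crossVec, cplxVec]
  ring

/-- Here `n · m = 0`, so `(n × m)² = |n|² m²` by Lagrange's identity; moreover `m` and `n × m` are
orthogonal. -/
lemma isoVec_isotropic (u v : EuclideanSpace ℝ (Fin 3)) :
    isoVec u v 0 ^ 2 + isoVec u v 1 ^ 2 + isoVec u v 2 ^ 2 = 0 := by
  have h1 : (crossNorm u v : ℂ) ^ 2 = (crossVec u v 0 : ℂ) ^ 2 + (crossVec u v 1 : ℂ) ^ 2 +
      (crossVec u v 2 : ℂ) ^ 2 := by exact_mod_cast congrArg (Complex.ofReal) (crossNorm_sq u v)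
  have h2 := crossVec_cplxVec u v
  simp only [isoVec, Matrix.cons_val_zero, Matrix.cons_val_one, Matrix.cons_val]
  linear_combination (exp := 1) (cplxVec u v 0 ^ 2 + cplxVec u v 1 ^ 2 + cplxVec u v 2 ^ 2) * h1 +
    ((crossVec u v 0 * cplxVec u v 0 + crossVec u v 1 * cplxVec u v 1 +
      crossVec u v 2 * cplxVec u v 2)) * h2 + ((crossVec u v 1 * cplxVec u v 2 - crossVec u v 2 * cplxVec u v 1) ^ 2 +
      (crossVec u v 2 * cplxVec u v 0 - crossVec u v 0 * cplxVec u v 2) ^ 2 +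
      (crossVec u v 0 * cplxVec u v 1 - crossVec u v 1 * cplxVec u v 0) ^ 2) * Complex.I_sq

/-- The real part is `|n| u - n × v`, whose product with `u` is `|n| |u|² + |n|² > 0`. -/
lemma isoVec_ne_zero {u v : EuclideanSpace ℝ (Fin 3)} (h : crossVec u v ≠ 0) : isoVec u v ≠ 0 := by
  intro h0
  have hn := crossNorm_sq u v
  have hpos : 0 < crossNorm u v := by
    refine lt_of_le_of_ne (Real.sqrt_nonneg _) fun h1 => h ?_
    rw [← h1] at hn
    ext i
    fin_cases i <;> simp <;> nlinarith [sq_nonneg (crossVec u v 0), sq_nonneg (crossVec u v 1),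
      sq_nonneg (crossVec u v 2)]
  have e0 := congrArg Complex.re (congrFun h0 0)
  have e1 := congrArg Complex.re (congrFun h0 1)
  have e2 := congrArg Complex.re (congrFun h0 2)
  simp [isoVec, cplxVec] at e0 e1 e2
  have h3 : crossNorm u v * (u 0 ^ 2 + u 1 ^ 2 + u 2 ^ 2) = - crossNorm u v ^ 2 := by
    rw [hn]
    simp only [crossVec, PiLp.toLp_apply, Matrix.cons_val_zero, Matrix.cons_val_one,
      Matrix.cons_val] at e0 e1 e2 ⊢
    linear_combination u 0 * e0 + u 1 * e1 + u 2 * e2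
  nlinarith [sq_nonneg (u 0), sq_nonneg (u 1), sq_nonneg (u 2)]

lemma crossVec_rotate {c s : ℝ} (h : c ^ 2 + s ^ 2 = 1) (u v : EuclideanSpace ℝ (Fin 3)) :
    crossVec (c • u + s • v) (-s • u + c • v) = crossVec u v := by
  ext i
  fin_cases i
  · simp [crossVec]
    linear_combination (u 1 * v 2 - u 2 * v 1) * h
  · simp [crossVec]
    linear_combination (u 2 * v 0 - u 0 * v 2) * h
  · simp [crossVec]
    linear_combination (u 0 * v 1 - u 1 * v 0) * h

/-- A rotation of the frame fixes `n = u × v` and multiplies `m = u - iv` by `c + is`. Hence a full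
turn of frames becomes the factor `exp(it)`. -/
lemma isoVec_rotate {c s : ℝ} (h : c ^ 2 + s ^ 2 = 1) (u v : EuclideanSpace ℝ (Fin 3)) :
    isoVec (c • u + s • v) (-s • u + c • v) = (c + s * Complex.I) • isoVec u v := by
  have h1 : ∀ i, cplxVec (c • u + s • v) (-s • u + c • v) i =
      (c + s * Complex.I) * cplxVec u v i := by
    intro i
    simp [cplxVec]
    linear_combination (s * v i : ℂ) * Complex.I_sq
  ext i
  fin_cases i <;> simp only [isoVec, h1, crossNorm, crossVec_rotate h, Pi.smul_apply, smul_eq_mul,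
    Fin.zero_eta, Fin.mk_one, Fin.reduceFinMk, Matrix.cons_val_zero, Matrix.cons_val_one,
    Matrix.cons_val] <;> ring

lemma continuous_isoVec {X : Type*} [TopologicalSpace X] {u v : X → EuclideanSpace ℝ (Fin 3)}
    (hu : Continuous u) (hv : Continuous v) (i : Fin 3) :
    Continuous fun p => isoVec (u p) (v p) i := by
  have h : Continuous fun p => crossVec (u p) (v p) := by
    unfold crossVec
    fun_prop
  have h' : Continuous fun p => crossNorm (u p) (v p) := by
    unfold crossNorm
    fun_prop
  fin_cases i <;> simp [isoVec, cplxVec] <;> fun_prop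

/-- There is no pair of frames over a disc that differ by a full turn on the boundary. -/
lemma frames_not_full_turn {u v u' v' : EuclideanSpace ℝ (Fin 2) → EuclideanSpace ℝ (Fin 3)}
    (hu : Continuous u) (hv : Continuous v) (hu' : Continuous u') (hv' : Continuous v')
    (h : ∀ p, crossVec (u p) (v p) ≠ 0) (h' : ∀ p, crossVec (u' p) (v' p) ≠ 0)
    (hturn : ∀ t : ℝ, let p : EuclideanSpace ℝ (Fin 2) := !₂[Real.cos t, Real.sin t]
      u p = Real.cos t • u' p + Real.sin t • v' p ∧
      v p = -Real.sin t • u' p + Real.cos t • v' p) : False := by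
  have hi : ∀ {a b : EuclideanSpace ℝ (Fin 3)}, crossVec a b ≠ 0 →
      isoVec a b 0 + Complex.I * isoVec a b 1 ≠ 0 ∨
        -(isoVec a b 0 - Complex.I * isoVec a b 1) ≠ 0 := by
    intro a b hab
    by_contra! hn
    have h3 := isoVec_isotropic a b
    have e0 : isoVec a b 0 = 0 := by linear_combination (1 / 2 : ℂ) * (hn.1 - hn.2)
    have e1 : Complex.I * isoVec a b 1 = 0 := by linear_combination (1 / 2 : ℂ) * (hn.1 + hn.2)
    have e1' : isoVec a b 1 = 0 := (mul_eq_zero.1 e1).resolve_left Complex.I_ne_zero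
    rw [e0, e1'] at h3
    have e2 : isoVec a b 2 = 0 := by simpa using h3
    refine isoVec_ne_zero hab ?_
    ext i
    fin_cases i
    exacts [e0, e1', e2]
  -- The coordinates `X + iY`, `Z`, `-(X - iY)` turn the null quadric `X² + Y² + Z² = 0` into `x z =
  -- y²`, the image of the spinor map `(a, c) ↦ (a², ac, c²)`.
  have hq : ∀ a b : EuclideanSpace ℝ (Fin 3), (isoVec a b 0 + Complex.I * isoVec a b 1) *
      -(isoVec a b 0 - Complex.I * isoVec a b 1) = isoVec a b 2 ^ 2 := by
    intro a b
    linear_combination (isoVec a b 1) ^ 2 * Complex.I_sq - isoVec_isotropic a b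
  have h0 := continuous_isoVec hu hv 0
  have h1 := continuous_isoVec hu hv 1
  have h2 := continuous_isoVec hu hv 2
  have h0' := continuous_isoVec hu' hv' 0
  have h1' := continuous_isoVec hu' hv' 1
  have h2' := continuous_isoVec hu' hv' 2
  refine not_full_turn (h0.add (continuous_const.mul h1)) h2 (h0.sub (continuous_const.mul h1)).neg
    (h0'.add (continuous_const.mul h1')) h2' (h0'.sub (continuous_const.mul h1')).neg
    (fun p => hq _ _) (fun p => hq _ _) (fun p => hi (h p)) (fun p => hi (h' p)) fun t => ?_
  have h3 := isoVec_rotate (Real.cos_sq_add_sin_sq t) (u' !₂[Real.cos t, Real.sin t])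
    (v' !₂[Real.cos t, Real.sin t])
  rw [← (hturn t).1, ← (hturn t).2] at h3
  have h4 : Complex.exp (t * Complex.I) = (Real.cos t : ℂ) + (Real.sin t : ℂ) * Complex.I := by
    rw [Complex.exp_mul_I, Complex.ofReal_cos, Complex.ofReal_sin]
  simp only [h3, h4, Pi.add_apply, Pi.mul_apply, Pi.neg_apply, Pi.sub_apply, Pi.smul_apply,
    smul_eq_mul]
  refine ⟨by ring, trivial, by ring⟩

end IsotropicVectors

/-! ### Nontriviality of the clutched bundle -/

section Nontrivial

lemma unitVec_smul {c : ℝ} (hc : 0 < c) (y : EuclideanSpace ℝ (Fin 3)) :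
    unitVec (c • y) = unitVec y := by
  by_cases hy : y = 0
  · simp [hy]
  · rw [← norm_smul_unitVec y, smul_smul, unitVec_smul_coe (mul_pos hc (norm_pos_iff.2 hy)),
      unitVec_smul_coe (norm_pos_iff.2 hy)]

/-- The central projection of the plane `z = 1` to the sphere. -/
def centralProj (w : EuclideanSpace ℝ (Fin 2)) : S2 := unitVec !₂[w 0, w 1, 1]

lemma contMDiff_centralProj : ContMDiff (𝓡 2) (𝓡 2) ∞ centralProj := by
  intro w
  have h : ContDiff ℝ ∞ fun w : EuclideanSpace ℝ (Fin 2) =>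
      (!₂[w 0, w 1, 1] : EuclideanSpace ℝ (Fin 3)) := by
    rw [contDiff_euclidean]
    intro i
    fin_cases i <;> simp <;> fun_prop
  refine ContMDiffAt.comp w (contMDiffAt_unitVec ?_) h.contMDiff.contMDiffAt
  intro h0
  simpa using congrArg (fun v : EuclideanSpace ℝ (Fin 3) => v 2) h0

/-- The left inverse of the central projection. -/
def centralCoord (y : EuclideanSpace ℝ (Fin 3)) : EuclideanSpace ℝ (Fin 2) :=
  !₂[y 0 / y 2, y 1 / y 2]

lemma coe_centralProj (w : EuclideanSpace ℝ (Fin 2)) :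
    ∃ r : ℝ, 0 < r ∧ (centralProj w : EuclideanSpace ℝ (Fin 3)) = r • !₂[w 0, w 1, 1] := by
  have h : (!₂[w 0, w 1, 1] : EuclideanSpace ℝ (Fin 3)) ≠ 0 := fun h0 => by
    simpa using congrArg (fun v : EuclideanSpace ℝ (Fin 3) => v 2) h0
  exact ⟨_, inv_pos.2 (norm_pos_iff.2 h), coe_unitVec h⟩

lemma centralCoord_centralProj (w : EuclideanSpace ℝ (Fin 2)) :
    centralCoord (centralProj w) = w := by
  obtain ⟨r, hr, h⟩ := coe_centralProj w
  rw [h]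
  ext i
  fin_cases i <;> simp [centralCoord, hr.ne']

/-- The rotation of the plane with matrix `(c, -s; s, c)`. -/
def planeRot (c s : ℝ) : EuclideanSpace ℝ (Fin 2) →L[ℝ] EuclideanSpace ℝ (Fin 2) :=
  LinearMap.toContinuousLinearMap
    { toFun := fun w => !₂[c * w 0 - s * w 1, s * w 0 + c * w 1]
      map_add' := fun v w => by
        ext i
        fin_cases i <;> simp <;> ring
      map_smul' := fun a w => by
        ext i
        fin_cases i <;> simp <;> ring }

lemma planeRot_apply (c s : ℝ) (w : EuclideanSpace ℝ (Fin 2)) :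
    planeRot c s w = !₂[c * w 0 - s * w 1, s * w 0 + c * w 1] := rfl

/-- A disc in the sphere centred at a pole, with boundary on the equator. -/
def polarDisc (σ : ℝ) (z : EuclideanSpace ℝ (Fin 2)) : EuclideanSpace ℝ (Fin 3) :=
  !₂[z 0, z 1, σ * (1 - z 0 ^ 2 - z 1 ^ 2)]

lemma polarDisc_ne_zero {σ : ℝ} (hσ : σ ≠ 0) (z : EuclideanSpace ℝ (Fin 2)) :
    polarDisc σ z ≠ 0 := by
  intro h
  have h0 : z 0 = 0 := by
    simpa [polarDisc] using congrArg (fun v : EuclideanSpace ℝ (Fin 3) => v 0) h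
  have h1 : z 1 = 0 := by
    simpa [polarDisc] using congrArg (fun v : EuclideanSpace ℝ (Fin 3) => v 1) h
  have h2 := congrArg (fun v : EuclideanSpace ℝ (Fin 3) => v 2) h
  simp [polarDisc, h0, h1, hσ] at h2

/-- The sign of the pole in the given trivializing set. -/
def poleSign (i : Bool) : ℝ := if i then -1 else 1

lemma poleSign_ne_zero (i : Bool) : poleSign i ≠ 0 := by cases i <;> simp [poleSign]

/-- The excluded pole lies on the axis, which forces `z = 0`; but there the disc passes through the
other pole. -/
lemma unitVec_polarDisc_mem (i : Bool) (z : EuclideanSpace ℝ (Fin 2)) :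
    unitVec (polarDisc (poleSign i) z) ∈ poleCompl i := by
  have hne := polarDisc_ne_zero (poleSign_ne_zero i) z
  have hr := inv_pos.2 (norm_pos_iff.2 hne)
  have hc := coe_unitVec hne
  set r := ‖polarDisc (poleSign i) z‖⁻¹
  set b := unitVec (polarDisc (poleSign i) z)
  have hs := sum_sq_S2 b
  intro h2
  have hb0 : (b : EuclideanSpace ℝ (Fin 3)) 0 = r * z 0 := by rw [hc]; simp [polarDisc]
  have hb1 : (b : EuclideanSpace ℝ (Fin 3)) 1 = r * z 1 := by rw [hc]; simp [polarDisc]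
  have hb2 : (b : EuclideanSpace ℝ (Fin 3)) 2 = r * (poleSign i * (1 - z 0 ^ 2 - z 1 ^ 2)) := by
    rw [hc]; simp [polarDisc]
  have h3 : (b : EuclideanSpace ℝ (Fin 3)) 2 ^ 2 = 1 := by rw [h2]; split_ifs <;> norm_num
  have h4 : (r * z 0) ^ 2 + (r * z 1) ^ 2 = 0 := by rw [← hb0, ← hb1]; linarith
  have h5 : r * z 0 = 0 := by nlinarith [sq_nonneg (r * z 0), sq_nonneg (r * z 1)]
  have h6 : r * z 1 = 0 := by nlinarith [sq_nonneg (r * z 0), sq_nonneg (r * z 1)]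
  have z0 := (mul_eq_zero.1 h5).resolve_left hr.ne'
  have z1 := (mul_eq_zero.1 h6).resolve_left hr.ne'
  rw [hb2, z0, z1] at h2
  cases i <;> simp [poleSign] at h2 <;> linarith

lemma contMDiff_unitVec_polarDisc {σ : ℝ} (hσ : σ ≠ 0) :
    ContMDiff (𝓡 2) (𝓡 2) ∞ (fun z => unitVec (polarDisc σ z)) := by
  intro z
  have h : ContDiff ℝ ∞ (polarDisc σ) := by
    rw [contDiff_euclidean]
    intro i
    fin_cases i <;> simp [polarDisc] <;> fun_prop
  exact ContMDiffAt.comp z (contMDiffAt_unitVec (polarDisc_ne_zero hσ z)) h.contMDiff.contMDiffAt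

/-- On the unit circle the disc is at the point of the equator with longitude `t`, and a rotation
about the axis preserves the plane used for the central projection. -/
lemma clutch_polarDisc (t : ℝ) (σ : ℝ) (w : EuclideanSpace ℝ (Fin 2)) :
    clutch 1 (unitVec (polarDisc σ !₂[Real.cos t, Real.sin t])) (centralProj w) =
      centralProj (planeRot (Real.cos t) (Real.sin t) w) := by
  have h1 := Real.cos_sq_add_sin_sq t
  have hp : polarDisc σ !₂[Real.cos t, Real.sin t] = !₂[Real.cos t, Real.sin t, 0] := by
    have : 1 - Real.cos t ^ 2 - Real.sin t ^ 2 = 0 := by linarith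
    simp [polarDisc, this]
  have hn : ‖(!₂[Real.cos t, Real.sin t, 0] : EuclideanSpace ℝ (Fin 3))‖ = 1 := by
    rw [EuclideanSpace.norm_eq, Real.sqrt_eq_one, Fin.sum_univ_three]
    simp
  have hc := coe_unitVec_of_norm hn
  obtain ⟨r, hr, hw⟩ := coe_centralProj w
  rw [hp, clutch, axisDist, hc, hw]
  have : rotVec (Real.cos t) (Real.sin t) (r • !₂[w 0, w 1, 1]) =
      r • !₂[planeRot (Real.cos t) (Real.sin t) w 0, planeRot (Real.cos t) (Real.sin t) w 1, 1] := by
    ext i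
    fin_cases i <;> simp [rotVec, planeRot_apply] <;> ring
  simp only [Matrix.cons_val_zero, Matrix.cons_val_one, h1, Real.sqrt_one, div_one,
    one_mul]
  rw [this, unitVec_smul hr, centralProj]

/-- The union over a disc of the fibrewise images of the plane under a global trivialization. -/
def fibreFrame (Φ : ClutchSpace ≃ₘ^∞⟮𝓡 4, (𝓡 2).prod (𝓡 2)⟯ (S2 × S2)) (i : Bool)
    (p : EuclideanSpace ℝ (Fin 2) × EuclideanSpace ℝ (Fin 2)) : EuclideanSpace ℝ (Fin 3) :=
  (Φ ((clutchCore.localTriv i).toOpenPartialHomeomorph.symm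
    (unitVec (polarDisc (poleSign i) p.1), centralProj p.2))).2

lemma contDiff_fibreFrame (Φ : ClutchSpace ≃ₘ^∞⟮𝓡 4, (𝓡 2).prod (𝓡 2)⟯ (S2 × S2)) (i : Bool) :
    ContDiff ℝ ∞ (fibreFrame Φ i) := by
  rw [← contMDiff_iff_contDiff]
  have he := (contMDiffOn_trivialization_totalSpaceCharts _ contMDiffOn_localTriv_clutchCore _
    clutchCore.mem_baseSet_at i).2
  have h1 := (contMDiff_unitVec_polarDisc (poleSign_ne_zero i)).comp
    (contDiff_fst (𝕜 := ℝ) (E := EuclideanSpace ℝ (Fin 2)) (F := EuclideanSpace ℝ (Fin 2))).contMDiff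
  have h2 := contMDiff_centralProj.comp
    (contDiff_snd (𝕜 := ℝ) (E := EuclideanSpace ℝ (Fin 2)) (F := EuclideanSpace ℝ (Fin 2))).contMDiff
  have h3 := he.comp_contMDiff (h1.prodMk h2) fun p =>
    (clutchCore.localTriv i).mem_target.2 (unitVec_polarDisc_mem i p.1)
  exact contMDiff_coe_S2.comp (contMDiff_snd.comp (Φ.contMDiff.comp h3))

/-- A differentiable left inverse makes the derivative of the fiber frame at `w = 0` injective. It
is the inverse of the fiberwise diffeomorphism, extended radially to `ℝ³` and followed by
`centralCoord`. -/
lemma exists_leftInverse_fibreFrame (Φ : ClutchSpace ≃ₘ^∞⟮𝓡 4, (𝓡 2).prod (𝓡 2)⟯ (S2 × S2))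
    (hΦ : ∀ x, (Φ x).1 = clutchCore.proj x) (i : Bool) (z : EuclideanSpace ℝ (Fin 2)) :
    ∃ H : EuclideanSpace ℝ (Fin 3) → EuclideanSpace ℝ (Fin 2),
      DifferentiableAt ℝ H (fibreFrame Φ i (z, 0)) ∧ ∀ w, H (fibreFrame Φ i (z, w)) = w := by
  have he := (contMDiffOn_trivialization_totalSpaceCharts _ contMDiffOn_localTriv_clutchCore _
    clutchCore.mem_baseSet_at i).1
  set b := unitVec (polarDisc (poleSign i) z) with hb
  have hbm : b ∈ (clutchCore.localTriv i).baseSet := unitVec_polarDisc_mem i z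
  have hsrc : ∀ y : S2, Φ.symm (b, y) ∈ (clutchCore.localTriv i).source := by
    intro y
    refine (clutchCore.localTriv i).mem_source.2 ?_
    rw [← hΦ, Φ.apply_symm_apply]
    exact hbm
  have hχ : ContMDiff (𝓡 2) (𝓡 2) ∞ fun y : S2 => (clutchCore.localTriv i (Φ.symm (b, y))).2 :=
    contMDiff_snd.comp (he.comp_contMDiff
      (Φ.symm.contMDiff.comp (contMDiff_const.prodMk contMDiff_id)) hsrc)
  have hinv : ∀ y : S2, (clutchCore.localTriv i (Φ.symm (b,
      (Φ ((clutchCore.localTriv i).toOpenPartialHomeomorph.symm (b, y))).2))).2 = y := by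
    intro y
    have ht : (b, y) ∈ (clutchCore.localTriv i).target := (clutchCore.localTriv i).mem_target.2 hbm
    set m := (clutchCore.localTriv i).toOpenPartialHomeomorph.symm (b, y)
    have hm : clutchCore.proj m = b := (clutchCore.localTriv i).proj_symm_apply ht
    have : (b, (Φ m).2) = Φ m := Prod.ext (by rw [hΦ, hm]) rfl
    rw [this, Φ.symm_apply_apply]
    exact congrArg Prod.snd ((clutchCore.localTriv i).right_inv ht)
  refine ⟨fun v => centralCoord (clutchCore.localTriv i (Φ.symm (b, unitVec v))).2, ?_, ?_⟩
  · have hy := norm_eq_of_mem_sphere ((Φ ((clutchCore.localTriv i).toOpenPartialHomeomorph.symm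
      (b, centralProj 0))).2)
    have hne : fibreFrame Φ i (z, 0) ≠ 0 := by
      intro h0
      change ‖fibreFrame Φ i (z, 0)‖ = 1 at hy
      rw [h0, norm_zero] at hy
      exact zero_ne_one hy
    have h1 := contMDiff_coe_S2.contMDiffAt.comp _ (hχ.contMDiffAt.comp (fibreFrame Φ i (z, 0))
      (contMDiffAt_unitVec hne))
    have h2 := h1.contDiffAt.differentiableAt (by simp)
    refine DifferentiableAt.comp (g := centralCoord) _ ?_ h2
    have h3 : ((clutchCore.localTriv i (Φ.symm (b, unitVec (fibreFrame Φ i (z, 0))))).2 :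
        EuclideanSpace ℝ (Fin 3)) = centralProj 0 := by
      rw [fibreFrame, unitVec_coe, hinv]
    obtain ⟨r, hr, h4⟩ := coe_centralProj 0
    rw [h3, h4, differentiableAt_euclidean]
    intro j
    have hr2 : (r • !₂[(0 : EuclideanSpace ℝ (Fin 2)) 0, (0 : EuclideanSpace ℝ (Fin 2)) 1, 1] :
        EuclideanSpace ℝ (Fin 3)) 2 ≠ 0 := by simpa using hr.ne'
    fin_cases j <;> simp only [centralCoord, PiLp.toLp_apply, Fin.zero_eta, Fin.mk_one,
      Matrix.cons_val_zero, Matrix.cons_val_one] <;> fun_prop (disch := exact hr2)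
  · intro w
    simp only [fibreFrame]
    rw [unitVec_coe, hinv, centralCoord_centralProj]

lemma crossVec_ne_zero {u v : EuclideanSpace ℝ (Fin 3)}
    (h : ∀ a b : ℝ, a • u + b • v = 0 → a = 0 ∧ b = 0) : crossVec u v ≠ 0 := by
  have h1 : LinearIndependent ℝ ![u.ofLp, v.ofLp] := by
    rw [LinearIndependent.pair_iff]
    intro a b hab
    exact h a b (by ext i; exact congrFun hab i)
  have h2 := crossProduct_ne_zero_iff_linearIndependent.2 h1
  intro h3
  refine h2 ?_
  rw [cross_apply]
  exact congrArg WithLp.ofLp h3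

lemma not_isTrivialSphereBundle_clutchCore : ¬ IsTrivialSphereBundle clutchCore.proj := by
  rintro ⟨Φ, hΦ⟩
  -- The clutching rotations fix the poles of the fiber. `A i z` is the derivative, at one such
  -- pole, of the trivialization restricted to a fiber, so it yields two vectors in `ℝ³` depending
  -- continuously on `z`.
  let A : Bool → EuclideanSpace ℝ (Fin 2) →
      EuclideanSpace ℝ (Fin 2) →L[ℝ] EuclideanSpace ℝ (Fin 3) :=
    fun i z => fderiv ℝ (fun w => fibreFrame Φ i (z, w)) 0
  have hd : ∀ i z, HasFDerivAt (fun w => fibreFrame Φ i (z, w)) (A i z) 0 := fun i z =>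
    (((contDiff_fibreFrame Φ i).comp
      (contDiff_const.prodMk contDiff_id)).differentiable (by simp) 0).hasFDerivAt
  have hA : ∀ i v, Continuous fun z => A i z v := by
    intro i v
    have h1 : ∀ z, A i z = (fderiv ℝ (fibreFrame Φ i) (z, 0)).comp
        (ContinuousLinearMap.inr ℝ (EuclideanSpace ℝ (Fin 2)) (EuclideanSpace ℝ (Fin 2))) :=
      fun z => (hd i z).unique ((((contDiff_fibreFrame Φ i).differentiable (by simp)
        (z, 0)).hasFDerivAt).comp 0 (hasFDerivAt_prodMk_right z 0))
    simp only [h1]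
    have h2 := (contDiff_fibreFrame Φ i).continuous_fderiv (by simp)
    exact (h2.comp (by fun_prop : Continuous fun z : EuclideanSpace ℝ (Fin 2) =>
      (z, (0 : EuclideanSpace ℝ (Fin 2))))).clm_apply continuous_const
  have hinj : ∀ i z v, A i z v = 0 → v = 0 := by
    intro i z v hv
    obtain ⟨H, hH, hH'⟩ := exists_leftInverse_fibreFrame Φ hΦ i z
    have h1 := HasFDerivAt.comp (0 : EuclideanSpace ℝ (Fin 2)) hH.hasFDerivAt (hd i z)
    have h2 : (H ∘ fun w => fibreFrame Φ i (z, w)) = id := funext hH'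
    rw [h2] at h1
    have h3 := DFunLike.congr_fun (h1.unique (hasFDerivAt_id _)) v
    simpa [hv] using h3.symm
  let e : Fin 2 → EuclideanSpace ℝ (Fin 2) := ![!₂[1, 0], !₂[0, 1]]
  have hcross : ∀ i z, crossVec (A i z (e 0)) (A i z (e 1)) ≠ 0 := by
    intro i z
    refine crossVec_ne_zero fun a b hab => ?_
    have h1 := hinj i z (a • e 0 + b • e 1) (by simpa using hab)
    constructor
    · simpa [e] using congrArg (fun v : EuclideanSpace ℝ (Fin 2) => v 0) h1
    · simpa [e] using congrArg (fun v : EuclideanSpace ℝ (Fin 2) => v 1) h1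
  -- Over the equator the two discs meet, and the clutching map becomes a plane rotation by `t`.
  -- Differentiating at its fixed point `w = 0` will give the full turn of the frames.
  have htrans : ∀ (t : ℝ) w, fibreFrame Φ false (!₂[Real.cos t, Real.sin t], w) =
      fibreFrame Φ true (!₂[Real.cos t, Real.sin t], planeRot (Real.cos t) (Real.sin t) w) := by
    intro t w
    have h0 : ∀ σ σ' : ℝ, polarDisc σ !₂[Real.cos t, Real.sin t] =
        polarDisc σ' !₂[Real.cos t, Real.sin t] := by
      intro σ σ'
      have h1 := Real.cos_sq_add_sin_sq t
      have : 1 - Real.cos t ^ 2 - Real.sin t ^ 2 = 0 := by linarith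
      simp [polarDisc, this]
    have hf := unitVec_polarDisc_mem false !₂[Real.cos t, Real.sin t]
    have ht := unitVec_polarDisc_mem true !₂[Real.cos t, Real.sin t]
    have hc := clutch_polarDisc t (poleSign true) w
    rw [h0 _ (poleSign true)] at hf
    simp only [fibreFrame]
    rw [h0 (poleSign false) (poleSign true)]
    set b := unitVec (polarDisc (poleSign true) !₂[Real.cos t, Real.sin t])
    have h2 := localTriv_clutchCore_symm false true (p := (b, centralProj w)) ⟨hf, ht⟩
    have h3 : clutchChange false true b (centralProj w) =
        centralProj (planeRot (Real.cos t) (Real.sin t) w) := by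
      simpa [clutchChange] using hc
    simp only [h3] at h2
    rw [← h2]
    congr 3
    refine ((clutchCore.localTriv true).left_inv ?_).symm
    refine (clutchCore.localTriv true).mem_source.2 ?_
    rw [(clutchCore.localTriv false).proj_symm_apply
      ((clutchCore.localTriv false).mem_target (x := (b, centralProj w)).2 hf)]
    exact ht
  refine frames_not_full_turn (hA false (e 0)) (hA false (e 1)) (hA true (e 0)) (hA true (e 1))
    (hcross false) (hcross true) fun t => ?_
  have hrot : ∀ v, A false !₂[Real.cos t, Real.sin t] v =
      A true !₂[Real.cos t, Real.sin t] (planeRot (Real.cos t) (Real.sin t) v) := by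
    intro v
    have h1 := hd true !₂[Real.cos t, Real.sin t]
    rw [← map_zero (planeRot (Real.cos t) (Real.sin t))] at h1
    have h2 := HasFDerivAt.comp (0 : EuclideanSpace ℝ (Fin 2)) h1
      (planeRot (Real.cos t) (Real.sin t)).hasFDerivAt
    have h3 := (hd false !₂[Real.cos t, Real.sin t]).unique
      (h2.congr_of_eventuallyEq (Eventually.of_forall (htrans t)))
    exact DFunLike.congr_fun h3 v
  have r0 : planeRot (Real.cos t) (Real.sin t) (e 0) = Real.cos t • e 0 + Real.sin t • e 1 := by
    ext i
    fin_cases i <;> simp [planeRot_apply, e]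
  have r1 : planeRot (Real.cos t) (Real.sin t) (e 1) = -Real.sin t • e 0 + Real.cos t • e 1 := by
    ext i
    fin_cases i <;> simp [planeRot_apply, e]
  constructor
  · rw [hrot, r0, map_add, map_smul, map_smul]
  · rw [hrot, r1, map_add, map_smul, map_smul]

end Nontrivial

/-! ### A volume form on the sphere -/

section AreaForm

/-- The `2`-form `det(y, ·, ·)` on `ℝ³`. -/
def detForm (y : EuclideanSpace ℝ (Fin 3)) : (EuclideanSpace ℝ (Fin 3)) [⋀^Fin 2]→L[ℝ] ℝ where
  toFun v := y 0 * crossVec (v 0) (v 1) 0 + y 1 * crossVec (v 0) (v 1) 1 +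
    y 2 * crossVec (v 0) (v 1) 2
  map_update_add' v i a b := by
    fin_cases i <;> simp [crossVec] <;> ring
  map_update_smul' v i a b := by
    fin_cases i <;> simp [crossVec] <;> ring
  map_eq_zero_of_eq' v i j h hij := by
    have h' : v 0 = v 1 := by
      fin_cases i <;> fin_cases j <;> simp_all
    simp only [h', crossVec, PiLp.toLp_apply, Matrix.cons_val_zero, Matrix.cons_val_one,
      Matrix.cons_val]
    ring
  cont := by
    simp only [crossVec, PiLp.toLp_apply, Matrix.cons_val_zero, Matrix.cons_val_one,
      Matrix.cons_val]
    fun_prop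

lemma detForm_apply (y : EuclideanSpace ℝ (Fin 3)) (v : Fin 2 → EuclideanSpace ℝ (Fin 3)) :
    detForm y v = y 0 * crossVec (v 0) (v 1) 0 + y 1 * crossVec (v 0) (v 1) 1 +
      y 2 * crossVec (v 0) (v 1) 2 := rfl

/-- The area form of the unit sphere. -/
def sphereArea : DForm 2 2 S2 :=
  DForm.pullback (m := 2) (n := 3) (fun x : S2 => (x : EuclideanSpace ℝ (Fin 3)))
    (detForm : DForm 3 2 (EuclideanSpace ℝ (Fin 3)))

/-- Since `x` is orthogonal to `v` and `w`, the product `x × (v × w)` vanishes. If `x · (v × w)` did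
too, Lagrange's identity would give `|x|² |v × w|² = 0`. -/
lemma detForm_ne_zero {x v w : EuclideanSpace ℝ (Fin 3)} (hx : x ≠ 0) (hv : inner ℝ x v = 0)
    (hw : inner ℝ x w = 0) (h : crossVec v w ≠ 0) : detForm x ![v, w] ≠ 0 := by
  intro h0
  rw [detForm_apply] at h0
  simp only [Matrix.cons_val_zero, Matrix.cons_val_one] at h0
  simp only [PiLp.inner_apply, Fin.sum_univ_three, RCLike.inner_apply, conj_trivial] at hv hw
  have e : (x 0 ^ 2 + x 1 ^ 2 + x 2 ^ 2) *
      (crossVec v w 0 ^ 2 + crossVec v w 1 ^ 2 + crossVec v w 2 ^ 2) = 0 := by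
    have e0 : x 1 * crossVec v w 2 - x 2 * crossVec v w 1 = 0 := by
      simp [crossVec]
      linear_combination v 0 * hw - w 0 * hv
    have e1 : x 2 * crossVec v w 0 - x 0 * crossVec v w 2 = 0 := by
      simp [crossVec]
      linear_combination v 1 * hw - w 1 * hv
    have e2 : x 0 * crossVec v w 1 - x 1 * crossVec v w 0 = 0 := by
      simp [crossVec]
      linear_combination v 2 * hw - w 2 * hv
    linear_combination (x 0 * crossVec v w 0 + x 1 * crossVec v w 1 + x 2 * crossVec v w 2) * h0 +
      (x 1 * crossVec v w 2 - x 2 * crossVec v w 1) * e0 +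
      (x 2 * crossVec v w 0 - x 0 * crossVec v w 2) * e1 +
      (x 0 * crossVec v w 1 - x 1 * crossVec v w 0) * e2
  have key : ∀ u : EuclideanSpace ℝ (Fin 3), u 0 ^ 2 + u 1 ^ 2 + u 2 ^ 2 = ‖u‖ ^ 2 := by
    intro u
    rw [EuclideanSpace.norm_sq_eq, Fin.sum_univ_three]
    simp
  rw [key, key] at e
  have h1 := norm_pos_iff.2 hx
  have h2 := norm_pos_iff.2 h
  exact absurd e (by positivity)

/-- The differential of the inclusion is injective with image the orthogonal complement of `x`, so
the determinant with `x` is nonzero on the images of the standard basis. -/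
lemma isVolumeForm_sphereArea : sphereArea.IsVolumeForm := by
  constructor
  · refine DForm.IsSmoothOn.pullback (m := 2) (n := 3) (W := univ) ?_ isOpen_univ
      contMDiff_coe_S2.contMDiffOn (mapsTo_univ _ _)
    intro x₀ y _ _
    have h : DForm.inChart (detForm : DForm 3 2 (EuclideanSpace ℝ (Fin 3))) x₀ = detForm :=
      DForm.inChart_euclideanSpace _ x₀
    rw [h]
    refine contDiffAt_alternating fun v => ?_
    simp only [detForm_apply]
    fun_prop
  · intro x h0
    have := finrank_euclideanSpace_three
    let A : EuclideanSpace ℝ (Fin 2) →L[ℝ] EuclideanSpace ℝ (Fin 3) :=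
      mfderiv (𝓡 2) 𝓘(ℝ, EuclideanSpace ℝ (Fin 3)) ((↑) : S2 → EuclideanSpace ℝ (Fin 3)) x
    have hinj : Function.Injective A := mfderiv_coe_sphere_injective x
    have hperp : ∀ v, inner ℝ (x : EuclideanSpace ℝ (Fin 3)) (A v) = 0 := by
      intro v
      have h1 : A v ∈ A.range := ⟨v, rfl⟩
      have h2 : A.range = (ℝ ∙ (x : EuclideanSpace ℝ (Fin 3)))ᗮ := range_mfderiv_coe_sphere x
      rw [h2] at h1
      exact Submodule.mem_orthogonal_singleton_iff_inner_right.1 h1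
    have hc : crossVec (A !₂[1, 0]) (A !₂[0, 1]) ≠ 0 := by
      refine crossVec_ne_zero fun a b hab => ?_
      have h1 : (a • !₂[1, 0] + b • !₂[0, 1] : EuclideanSpace ℝ (Fin 2)) = 0 :=
        hinj (by simpa using hab)
      constructor
      · simpa using congrArg (fun v : EuclideanSpace ℝ (Fin 2) => v 0) h1
      · simpa using congrArg (fun v : EuclideanSpace ℝ (Fin 2) => v 1) h1
    have hx : (x : EuclideanSpace ℝ (Fin 3)) ≠ 0 := by
      intro h
      have := norm_eq_of_mem_sphere x
      rw [h, norm_zero] at this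
      exact zero_ne_one this
    refine detForm_ne_zero hx (hperp _) (hperp _) hc ?_
    have h1 : sphereArea x ![!₂[1, 0], !₂[0, 1]] = 0 := by rw [h0]; rfl
    change detForm x (fun i => A (![!₂[1, 0], !₂[0, 1]] i)) = 0 at h1
    refine Eq.trans (congrArg (detForm x) ?_) h1
    funext i
    fin_cases i <;> rfl

end AreaForm

lemma IsSphereBundle.pullback_volumeForm {M : Type*} [TopologicalSpace M]
    [ChartedSpace (EuclideanSpace ℝ (Fin 4)) M] [IsManifold (𝓡 4) ∞ M] [T2Space M] [CompactSpace M]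
    {π : M → S2} (h : IsSphereBundle π) (hn : ¬ IsTrivialSphereBundle π) {dvol : DForm 2 2 S2}
    (hd : dvol.IsVolumeForm) :
    (DForm.pullback π dvol : DForm 4 2 M).IsClosed ∧
      (DForm.pullback π dvol : DForm 4 2 M).IsTransitive ∧
      (DForm.pullback π dvol : DForm 4 2 M).HasConstantRank 2 ∧
      ¬ IsIntrinsicallyHarmonic (k := 2) (l := 2) (DForm.pullback π dvol : DForm 4 2 M) :=
  ⟨h.isClosed_pullback hd, h.isTransitive_pullback hd, h.hasConstantRank_pullback hd,
    h.not_isIntrinsicallyHarmonic hn hd⟩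

end

end HarmonicForms

theorem mainTheorem2 :
    (∀ (M : Type*) [TopologicalSpace M] [ChartedSpace (EuclideanSpace ℝ (Fin 4)) M]
        [IsManifold (𝓡 4) ∞ M] [T2Space M] [CompactSpace M]
        (π : M → S2) (dvol : DForm 2 2 S2) (α : DForm 4 2 M),
      IsSphereBundle π → ¬ IsTrivialSphereBundle π → dvol.IsVolumeForm →
        α = DForm.pullback π dvol →
        α.IsClosed ∧ α.IsTransitive ∧ α.HasConstantRank 2 ∧
        ¬ IsIntrinsicallyHarmonic (k := 2) (l := 2) α) ∧
    (∃ (M : Type) (_ : TopologicalSpace M) (_ : ChartedSpace (EuclideanSpace ℝ (Fin 4)) M)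
        (_ : IsManifold (𝓡 4) ∞ M) (_ : T2Space M) (_ : CompactSpace M)
        (π : M → S2) (dvol : DForm 2 2 S2) (α : DForm 4 2 M),
      IsSphereBundle π ∧ ¬ IsTrivialSphereBundle π ∧ dvol.IsVolumeForm ∧
        α = DForm.pullback π dvol ∧
        α.IsClosed ∧ α.IsTransitive ∧ α.HasConstantRank 2 ∧
        ¬ IsIntrinsicallyHarmonic (k := 2) (l := 2) α) := by
  refine ⟨?_, ClutchSpace, inferInstance, inferInstance, inferInstance, inferInstance,
    inferInstance, clutchCore.proj, sphereArea, _, isSphereBundle_clutchCore,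
    not_isTrivialSphereBundle_clutchCore, isVolumeForm_sphereArea, rfl, ?_⟩
  · rintro M _ _ _ _ _ π dvol _ h hn hd rfl
    exact h.pullback_volumeForm hn hd
  · exact isSphereBundle_clutchCore.pullback_volumeForm not_isTrivialSphereBundle_clutchCore
      isVolumeForm_sphereArea
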